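/- Consider the one-dimensional quartic semirelativistic nonlinear Schrödinger equation $$ i\,\partial_t u=\sqrt{1-\Delta}\,u-u|u|^{3},\qquad u(0,x)=f(x),\qquad (t,x)\in\mathbb R\times\mathbb R, \tag{sNLS}$$ with complex-valued $u$ and initial datum $f\in H^{3/2}(\mathbb R)$, where $H^s(\mathbb R)$ carries the norm $\|(1-\Delta)^{s/2}u\|_{L^2(\mathbb R)}$. By a solution on an open interval $I\ni 0$ we mean a function $u\in C(I;H^{3/2}(\mathbb R))$, differentiable in time with values in $L^2(\mathbb R)$, which satisfies the equation in $L^2(\mathbb R)$ for every $t\in I$ and has $u(0)=f$. Let $u$ be a solution whose interval of existence $(-T_-(f),T_+(f))$, $0<T_\pm(f)\le\infty$, is maximal, that is, $u$ does not extend to a solution on a strictly larger open interval. Assume that $$\sup_{t\in(-T_-(f),T_+(f))}\|u(t,\cdot)\|_{H^{1/2}(\mathbb R)}<\infty .$$ Then $T_-(f)=T_+(f)=\infty$, that is, the solution is global. -/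

import Mathlib

open MeasureTheory Filter Topology
open scoped NNReal ENNReal FourierTransform SchwartzMap

noncomputable section

/-- The complex Hilbert space `L²(ℝ)`. -/
abbrev L2R : Type := Lp ℂ 2 (volume : Measure ℝ)

/-- The symbol `√(1 + (2πξ)²)` of `√(1 - Δ)` for the Fourier transform
`𝓕 f ξ = ∫ f x · exp(-2πi x ξ) dx` used by Mathlib. -/
def bracket (ξ : ℝ) : ℝ := Real.sqrt (1 + (2 * Real.pi * ξ) ^ 2)

/-- The norm `‖(1 - Δ)^{s/2} f‖_{L²}` of `H^s(ℝ)`, computed on the Fourier side by Plancherel. For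
`s ≥ 0` it is defined for every `f ∈ L²(ℝ)` and equals `∞` when `f ∉ H^s(ℝ)`. -/
def sobolevENorm (s : ℝ) (f : L2R) : ℝ≥0∞ :=
  eLpNorm (fun ξ : ℝ => ((bracket ξ ^ s : ℝ) : ℂ) * (𝓕 f : L2R) ξ) 2 volume

/-- `f ∈ H^s(ℝ)` for `f ∈ L²(ℝ)`, `s ≥ 0`. -/
def MemHs (s : ℝ) (f : L2R) : Prop :=
  TemperedDistribution.MemSobolev s 2 (f : 𝓢'(ℝ, ℂ))

/-- `g = √(1 - Δ) f` for `f, g ∈ L²(ℝ)`. -/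
def IsSqrtOneSubLaplacian (f g : L2R) : Prop :=
  ((𝓕 g : L2R) : ℝ → ℂ) =ᵐ[volume] fun ξ => (bracket ξ : ℂ) * (𝓕 f : L2R) ξ

/-- `g = f |f|³` for `f, g ∈ L²(ℝ)`. -/
def IsQuarticTerm (f g : L2R) : Prop :=
  (g : ℝ → ℂ) =ᵐ[volume] fun x => f x * ((‖f x‖ : ℂ)) ^ 3

/-- The open time interval `(-Tm, Tp)` of the real line, where `Tm` and `Tp` may be infinite. -/
def timeInterval (Tm Tp : EReal) : Set ℝ := {t : ℝ | -Tm < (t : EReal) ∧ (t : EReal) < Tp}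

/-- `u` is a solution on `(-Tm, Tp)`, where `0 < Tm, Tp ≤ ∞`, of the quartic semirelativistic
equation `i ∂ₜ u = √(1 - Δ) u - u |u|³` with `u(0) = f`: it is continuous with values in
`H^{3/2}(ℝ)`, and differentiable in time with values in `L²(ℝ)`, where the equation holds. -/
structure IsSolution (f : L2R) (Tm Tp : EReal) (u : ℝ → L2R) : Prop where
  pos_left : 0 < Tm
  pos_right : 0 < Tp
  initial : u 0 = f
  mem : ∀ t ∈ timeInterval Tm Tp, MemHs (3 / 2) (u t)
  continuous : ∀ t ∈ timeInterval Tm Tp,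
    Tendsto (fun τ => sobolevENorm (3 / 2) (u τ - u t)) (𝓝 t) (𝓝 0)
  equation : ∀ t ∈ timeInterval Tm Tp, ∃ u' Au N : L2R, HasDerivAt u u' t ∧
    IsSqrtOneSubLaplacian (u t) Au ∧ IsQuarticTerm (u t) N ∧ Complex.I • u' = Au - N

/-- `u` is a solution whose interval of existence `(-Tm, Tp)` is maximal: `u` has no extension to a
solution on a larger interval. -/
structure IsMaximalSolution (f : L2R) (Tm Tp : EReal) (u : ℝ → L2R) : Prop where
  solution : IsSolution f Tm Tp u
  maximal : ∀ (Sm Sp : EReal) (v : ℝ → L2R), Tm ≤ Sm → Tp ≤ Sp → IsSolution f Sm Sp v →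
    (∀ t ∈ timeInterval Tm Tp, v t = u t) → Sm = Tm ∧ Sp = Tp

/-- A temperate multiple of an `L²` function, as a distribution, is the pointwise product. -/
theorem smulLeft_eq_iff {m : ℝ → ℂ} (hm : m.HasTemperateGrowth) (h g : L2R) :
    TemperedDistribution.smulLeftCLM ℂ m (h : 𝓢'(ℝ, ℂ)) = (g : 𝓢'(ℝ, ℂ)) ↔
      (g : ℝ → ℂ) =ᵐ[volume] fun ξ => m ξ * h ξ := by
  have hL (φ : 𝓢(ℝ, ℂ)) : TemperedDistribution.smulLeftCLM ℂ m (h : 𝓢'(ℝ, ℂ)) φ =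
      ∫ ξ, φ ξ * (m ξ * h ξ) := by
    rw [TemperedDistribution.smulLeftCLM_apply_apply, Lp.toTemperedDistribution_apply]
    refine integral_congr_ae (Eventually.of_forall fun ξ => ?_)
    simp [SchwartzMap.smulLeftCLM_apply_apply hm]; ring
  constructor
  · intro H
    have hgi : LocallyIntegrable (g : ℝ → ℂ) volume :=
      (Lp.memLp g).locallyIntegrable (by norm_num)
    have hhi : LocallyIntegrable (h : ℝ → ℂ) volume :=
      (Lp.memLp h).locallyIntegrable (by norm_num)
    have hmi : LocallyIntegrable (fun ξ => m ξ * h ξ) volume := by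
      rw [← locallyIntegrableOn_univ] at hhi ⊢
      exact hhi.continuousOn_mul hm.1.continuous.continuousOn isOpen_univ.isLocallyClosed
    apply ae_eq_of_integral_contDiff_smul_eq hgi hmi
    intro φ hφ hc
    have hg₁ : HasCompactSupport (Complex.ofRealCLM ∘ φ) := hc.comp_left rfl
    have hg₂ : ContDiff ℝ (⊤ : ℕ∞) (Complex.ofRealCLM ∘ φ) := by fun_prop
    have := hL (hg₁.toSchwartzMap hg₂)
    rw [H, Lp.toTemperedDistribution_apply] at this
    simpa using this
  · intro H
    ext φ
    rw [hL, Lp.toTemperedDistribution_apply]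
    refine integral_congr_ae ?_
    filter_upwards [H] with ξ hξ
    simp [hξ]

theorem bracket_pos (ξ : ℝ) : 0 < bracket ξ := Real.sqrt_pos.2 (by positivity)

/-- `H^s(ℝ)` consists of the `f ∈ L²(ℝ)` whose `H^s` norm is finite. -/
theorem memHs_iff {s : ℝ} (hs : 0 ≤ s) (f : L2R) : MemHs s f ↔ sobolevENorm s f < ⊤ := by
  have hw : (fun ξ : ℝ => (((1 + ‖ξ‖ ^ 2) ^ (s / 2) : ℝ) : ℂ)).HasTemperateGrowth := by fun_prop
  have h1 : MemHs s f ↔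
      MemLp (fun ξ : ℝ => (((1 + ‖ξ‖ ^ 2) ^ (s / 2) : ℝ) : ℂ) * (𝓕 f : L2R) ξ) 2 volume := by
    rw [MemHs, TemperedDistribution.memSobolev_iff_exists_smulLeftCLM_fourier,
      Lp.fourier_toTemperedDistribution_eq]
    constructor
    · rintro ⟨g, hg⟩
      exact (memLp_congr_ae ((smulLeft_eq_iff hw _ _).1 hg)).1 (Lp.memLp g)
    · intro H
      exact ⟨H.toLp _, (smulLeft_eq_iff hw _ _).2 H.coeFn_toLp⟩
  have hb (ξ : ℝ) : bracket ξ ^ s = (1 + (2 * Real.pi * ξ) ^ 2) ^ (s / 2) := by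
    rw [bracket, Real.sqrt_eq_rpow, ← Real.rpow_mul (by positivity)]
    ring_nf
  have hpi : 1 ≤ (2 * Real.pi) ^ 2 := by nlinarith [Real.pi_gt_three]
  have hbm : AEStronglyMeasurable
      (fun ξ : ℝ => ((bracket ξ ^ s : ℝ) : ℂ) * (𝓕 f : L2R) ξ) volume := by
    refine AEStronglyMeasurable.mul ?_ (Lp.aestronglyMeasurable _)
    refine Continuous.aestronglyMeasurable (Complex.continuous_ofReal.comp ?_)
    refine Continuous.rpow_const (by unfold bracket; fun_prop) fun ξ => Or.inl (bracket_pos ξ).ne'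
  rw [h1]
  constructor
  · intro H
    refine (MemLp.of_le_mul (c := ((2 * Real.pi) ^ 2) ^ (s / 2)) H hbm
      (Eventually.of_forall fun ξ => ?_)).2
    rw [norm_mul, norm_mul, ← mul_assoc]
    refine mul_le_mul_of_nonneg_right ?_ (norm_nonneg _)
    rw [Complex.norm_real, Complex.norm_real, hb, Real.norm_of_nonneg (by positivity),
      Real.norm_of_nonneg (by positivity), ← Real.mul_rpow (by positivity) (by positivity)]
    refine Real.rpow_le_rpow (by positivity) ?_ (by positivity)
    rw [Real.norm_eq_abs, sq_abs]
    nlinarith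
  · intro H
    refine MemLp.of_le_mul (c := 1) (g := fun ξ : ℝ => ((bracket ξ ^ s : ℝ) : ℂ) * (𝓕 f : L2R) ξ)
      ⟨hbm, H⟩
      (hw.1.continuous.aestronglyMeasurable.mul (Lp.aestronglyMeasurable _))
      (Eventually.of_forall fun ξ => ?_)
    rw [norm_mul, norm_mul, one_mul]
    refine mul_le_mul_of_nonneg_right ?_ (norm_nonneg _)
    rw [Complex.norm_real, Complex.norm_real, hb,
      Real.norm_of_nonneg (show (0 : ℝ) ≤ (1 + ‖ξ‖ ^ 2) ^ (s / 2) by positivity),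
      Real.norm_of_nonneg
        (show (0 : ℝ) ≤ (1 + (2 * Real.pi * ξ) ^ 2) ^ (s / 2) by positivity)]
    refine Real.rpow_le_rpow (by positivity) ?_ (by positivity)
    rw [Real.norm_eq_abs, sq_abs]
    nlinarith [sq_nonneg ξ]

/-- `√(1 - Δ)` is the Fourier multiplier with symbol `bracket` on tempered distributions. -/
theorem isSqrtOneSubLaplacian_iff (f g : L2R) : IsSqrtOneSubLaplacian f g ↔
    TemperedDistribution.fourierMultiplierCLM ℂ (fun ξ : ℝ => (bracket ξ : ℂ)) (f : 𝓢'(ℝ, ℂ)) =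
      (g : 𝓢'(ℝ, ℂ)) := by
  have hw : (fun ξ : ℝ => (bracket ξ : ℂ)).HasTemperateGrowth := by
    have h1 : (fun x : ℝ => (1 + ‖x‖ ^ 2) ^ (1 / 2 : ℝ)).HasTemperateGrowth := by fun_prop
    have h2 : (fun ξ : ℝ => (2 * Real.pi) * ξ).HasTemperateGrowth := by fun_prop
    have h3 := (h1.comp h2)
    have h4 : bracket = (fun x : ℝ => (1 + ‖x‖ ^ 2) ^ (1 / 2 : ℝ)) ∘
        fun ξ : ℝ => (2 * Real.pi) * ξ := by
      funext ξ
      simp only [bracket, Real.sqrt_eq_rpow, Function.comp, Real.norm_eq_abs, sq_abs]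
    rw [← h4] at h3
    fun_prop
  rw [IsSqrtOneSubLaplacian, ← smulLeft_eq_iff hw, ← Lp.fourier_toTemperedDistribution_eq,
    ← Lp.fourier_toTemperedDistribution_eq, TemperedDistribution.fourierMultiplierCLM_apply]
  constructor
  · intro H
    rw [H, FourierTransform.fourierInv_fourier_eq]
  · intro H
    rw [← H, FourierTransform.fourier_fourierInv_eq]

end

/-! Only growth of the `H^{3/2}` norm can stop a solution: local existence holds for a time that
depends on the `H^{3/2}` norm of the datum alone (`exists_local_path`), so a solution bounded in
`H^{3/2}` up to a finite end could be continued past it (`IsMaximalSolution.exists_lower_bound`). It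
remains to turn the `H^{1/2}` bound `A` into an `H^{3/2}` bound on bounded time intervals, and this
goes through `H^1`.

For `H^1`, follow `v = ∂ₜu`. The equation gives `√(1-Δ)u = iv + u|u|³`, so `‖u‖_{H^1}` is bounded by
`‖v‖` plus lower order terms. Since `∂ₜ(u|u|³) = |u|³v + p` with `p = u ∂ₜ|u|³`, and `⟨v, i|u|³v⟩`
has no real part, the derivative of `‖v‖²` is `2 Re⟨v, ip⟩`, that is `-2 Re⟨√(1-Δ)u, p⟩` up to lower
order. With `R` a sup bound of `u`, Cauchy–Schwarz gives `R³ ‖v‖ ‖u‖_{H^1}`. The Brezis–Gallouët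
inequality bounds `R²` by a logarithm of `‖u‖_{H^1}`, so this costs a logarithm to the power 3/2,
which Osgood's lemma does not tolerate. A modified energy saves one power of `R`.

Write `|D|` as an integral over `h` of squared differences with weight `h⁻²`. For real functions
`r`, the pairing of `Δ_h(ru)` with `Δ_h u` has real part `½ Δ_h r · Δ_h|u|²` up to a term quadratic
in `Δ_h u` (`re_conj_diff_uCube`). With `r = ∂ₜ|u|³`, and after moving half of the time derivative
from `|u|³` to `|u|²` at the cost of another quadratic term, the main part is an exact time
derivative, that of a quarter of `⟨|u|³, |D||u|²⟩`. Adding a multiple of this nonnegative quantity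
to `‖v‖²` cancels it (`energy_inequality`). The quadratic remainders are bounded by `R² A² ‖u‖_{H^1}
‖v‖` (`exists_majorant_diff`), which costs one logarithm only. The result is an integral inequality
for `z = ‖v‖²` with right-hand side `C(1+z)(1+log(1+z))`, and Osgood's lemma bounds `v`, hence
`‖u‖_{H^1}`, in finite time.

Given the `H^1` bound, second differences show that `u|u|³` grows at most linearly in the `H^{3/2}`
norm of `u` (`exists_tame_bound`), and a Gronwall argument bounds that norm.

Two regularisations make the energy computation legitimate in `L²`: `|D|` is replaced by its
differences with step larger than `ε`, a bounded operator, and `∂ₜu`, which need not be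
differentiable in `L²`, is truncated in frequency. -/

noncomputable section

/-! ### Fourier multipliers on `L²` -/

/-- The Fourier multiplier with symbol `m` is defined on `f`. -/
def MemMul (m : ℝ → ℂ) (f : L2R) : Prop := MemLp (fun ξ => m ξ * (𝓕 f : L2R) ξ) 2 volume

open Classical in
/-- The Fourier multiplier with symbol `m`, equal to `0` outside its domain. -/
def fmul (m : ℝ → ℂ) (f : L2R) : L2R :=
  if h : MemMul m f then 𝓕⁻ (MemLp.toLp _ h : L2R) else 0

theorem fourier_fmul {m : ℝ → ℂ} {f : L2R} (h : MemMul m f) :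
    ((𝓕 (fmul m f) : L2R) : ℝ → ℂ) =ᵐ[volume] fun ξ => m ξ * (𝓕 f : L2R) ξ := by
  rw [fmul, dif_pos h, FourierTransform.fourier_fourierInv_eq]
  exact MemLp.coeFn_toLp h

theorem fourier_ext {f g : L2R} (h : ((𝓕 f : L2R) : ℝ → ℂ) =ᵐ[volume] (𝓕 g : L2R)) : f = g :=
  (Lp.fourierTransformₗᵢ ℝ ℂ).injective (Lp.ext h)

theorem fourier_add_ae (f g : L2R) : ((𝓕 (f + g) : L2R) : ℝ → ℂ) =ᵐ[volume]
    fun ξ => (𝓕 f : L2R) ξ + (𝓕 g : L2R) ξ := by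
  rw [FourierTransform.fourier_add]; exact Lp.coeFn_add _ _

theorem fourier_sub_ae (f g : L2R) : ((𝓕 (f - g) : L2R) : ℝ → ℂ) =ᵐ[volume]
    fun ξ => (𝓕 f : L2R) ξ - (𝓕 g : L2R) ξ := by
  have : (𝓕 (f - g) : L2R) = 𝓕 f - 𝓕 g := (Lp.fourierTransformₗᵢ ℝ ℂ).map_sub f g
  rw [this]; exact Lp.coeFn_sub _ _

theorem fourier_smul_ae (c : ℂ) (f : L2R) : ((𝓕 (c • f) : L2R) : ℝ → ℂ) =ᵐ[volume]
    fun ξ => c * (𝓕 f : L2R) ξ := by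
  rw [FourierTransform.fourier_smul]; exact Lp.coeFn_smul _ _

/-- The Fourier transform of an element of `L²` is square integrable, so an a.e. identity of symbols
yields membership in the domain together with the value. Every algebraic rule for multipliers below
is read off from such an identity. -/
theorem MemMul.eq_fmul {m : ℝ → ℂ} {f g : L2R}
    (h : ((𝓕 g : L2R) : ℝ → ℂ) =ᵐ[volume] fun ξ => m ξ * (𝓕 f : L2R) ξ) :
    MemMul m f ∧ g = fmul m f := by
  have h1 : MemMul m f := (memLp_congr_ae h).1 (Lp.memLp _)
  exact ⟨h1, fourier_ext (h.trans (fourier_fmul h1).symm)⟩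

theorem MemMul.add {m : ℝ → ℂ} {f g : L2R} (hf : MemMul m f) (hg : MemMul m g) :
    MemMul m (f + g) ∧ fmul m (f + g) = fmul m f + fmul m g := by
  have := MemMul.eq_fmul (m := m) (f := f + g) (g := fmul m f + fmul m g) (by
    filter_upwards [fourier_add_ae f g, fourier_add_ae (fmul m f) (fmul m g), fourier_fmul hf,
      fourier_fmul hg] with ξ h1 h2 h3 h4
    rw [h1, h2, h3, h4]; ring)
  exact ⟨this.1, this.2.symm⟩

theorem MemMul.smul {m : ℝ → ℂ} {f : L2R} (c : ℂ) (hf : MemMul m f) :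
    MemMul m (c • f) ∧ fmul m (c • f) = c • fmul m f := by
  have := MemMul.eq_fmul (m := m) (f := c • f) (g := c • fmul m f) (by
    filter_upwards [fourier_smul_ae c f, fourier_smul_ae c (fmul m f), fourier_fmul hf]
      with ξ h1 h2 h3
    rw [h1, h2, h3]; ring)
  exact ⟨this.1, this.2.symm⟩

theorem MemMul.sub {m : ℝ → ℂ} {f g : L2R} (hf : MemMul m f) (hg : MemMul m g) :
    MemMul m (f - g) ∧ fmul m (f - g) = fmul m f - fmul m g := by
  have := MemMul.eq_fmul (m := m) (f := f - g) (g := fmul m f - fmul m g) (by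
    filter_upwards [fourier_sub_ae f g, fourier_sub_ae (fmul m f) (fmul m g), fourier_fmul hf,
      fourier_fmul hg] with ξ h1 h2 h3 h4
    rw [h1, h2, h3, h4]; ring)
  exact ⟨this.1, this.2.symm⟩

theorem MemMul.comp {m₁ m₂ : ℝ → ℂ} {f : L2R} (h₂ : MemMul m₂ f)
    (h : MemMul (fun ξ => m₁ ξ * m₂ ξ) f) :
    MemMul m₁ (fmul m₂ f) ∧ fmul m₁ (fmul m₂ f) = fmul (fun ξ => m₁ ξ * m₂ ξ) f := by
  have := MemMul.eq_fmul (m := m₁) (f := fmul m₂ f) (g := fmul (fun ξ => m₁ ξ * m₂ ξ) f) (by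
    filter_upwards [fourier_fmul h₂, fourier_fmul h] with ξ h1 h2
    rw [h1, h2]; ring)
  exact ⟨this.1, this.2.symm⟩

theorem MemMul.comp_iff {m₁ m₂ : ℝ → ℂ} {f : L2R} (h₂ : MemMul m₂ f) :
    MemMul m₁ (fmul m₂ f) ↔ MemMul (fun ξ => m₁ ξ * m₂ ξ) f := by
  refine memLp_congr_ae ?_
  filter_upwards [fourier_fmul h₂] with ξ h1
  rw [h1]; ring

theorem fmul_one (f : L2R) : MemMul (fun _ => 1) f ∧ fmul (fun _ => 1) f = f := by
  have := MemMul.eq_fmul (m := fun _ => 1) (f := f) (g := f)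
    (Eventually.of_forall fun ξ => (one_mul _).symm)
  exact ⟨this.1, this.2.symm⟩

theorem norm_sq_eq_integral (f : L2R) : ‖f‖ ^ 2 = ∫ x, ‖f x‖ ^ 2 := by
  have := @L2.inner_def ℝ ℂ ℂ _ _ _ _ _ f f
  rw [inner_self_eq_norm_sq_to_K] at this
  have h2 : ∫ a, inner ℂ (f a) (f a) = ((∫ x, ‖f x‖ ^ 2 : ℝ) : ℂ) := by
    rw [← integral_complex_ofReal]
    congr 1; ext x; rw [inner_self_eq_norm_sq_to_K]; simp
  rw [h2] at this
  exact Complex.ofReal_injective (by simpa using this)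

theorem integrable_norm_sq (f : L2R) : Integrable (fun x => ‖f x‖ ^ 2) :=
  (memLp_two_iff_integrable_sq_norm (Lp.aestronglyMeasurable f)).1 (Lp.memLp f)

theorem enorm_sq_eq_lintegral (f : L2R) : ‖f‖ₑ ^ 2 = ∫⁻ x, ‖f x‖ₑ ^ 2 := by
  rw [Lp.enorm_def, eLpNorm_eq_lintegral_rpow_enorm_toReal (by norm_num) (by norm_num)]
  simp only [ENNReal.toReal_ofNat, ENNReal.rpow_ofNat]
  rw [← ENNReal.rpow_ofNat, ← ENNReal.rpow_mul]; norm_num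

theorem enorm_fourier (f : L2R) : ‖(𝓕 f : L2R)‖ₑ = ‖f‖ₑ := by
  rw [← ofReal_norm, ← ofReal_norm, Lp.norm_fourier_eq]

theorem enorm_fmul_sq {m : ℝ → ℂ} {f : L2R} (h : MemMul m f) :
    ‖fmul m f‖ₑ ^ 2 = ∫⁻ ξ, ‖m ξ‖ₑ ^ 2 * ‖(𝓕 f : L2R) ξ‖ₑ ^ 2 := by
  rw [← enorm_fourier, enorm_sq_eq_lintegral]
  refine lintegral_congr_ae ?_
  filter_upwards [fourier_fmul h] with ξ h1
  rw [h1, enorm_mul, mul_pow]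

theorem norm_fmul_sq {m : ℝ → ℂ} {f : L2R} (h : MemMul m f) :
    ‖fmul m f‖ ^ 2 = ∫ ξ, ‖m ξ‖ ^ 2 * ‖(𝓕 f : L2R) ξ‖ ^ 2 := by
  rw [← Lp.norm_fourier_eq, norm_sq_eq_integral]
  refine integral_congr_ae ?_
  filter_upwards [fourier_fmul h] with ξ h1
  simp only [h1, norm_mul, mul_pow]

theorem MemMul.integrable {m : ℝ → ℂ} {f : L2R} (h : MemMul m f) :
    Integrable (fun ξ => ‖m ξ‖ ^ 2 * ‖(𝓕 f : L2R) ξ‖ ^ 2) := by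
  refine (integrable_norm_sq (𝓕 (fmul m f))).congr ?_
  filter_upwards [fourier_fmul h] with ξ h1
  rw [h1, norm_mul, mul_pow]

/-- By Plancherel, comparing two operators amounts to comparing their symbols pointwise; all Sobolev
and difference bounds are instances of this. -/
theorem MemMul.mono {m₁ m₂ : ℝ → ℂ} {f : L2R} {C : ℝ} (h₂ : MemMul m₂ f)
    (hm : AEStronglyMeasurable m₁) (h : ∀ ξ, ‖m₁ ξ‖ ≤ C * ‖m₂ ξ‖) :
    MemMul m₁ f ∧ ‖fmul m₁ f‖ ≤ C * ‖fmul m₂ f‖ := by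
  have h1 : MemMul m₁ f := by
    refine MemLp.of_le_mul (c := C) h₂ (hm.mul (Lp.aestronglyMeasurable _))
      (Eventually.of_forall fun ξ => ?_)
    rw [norm_mul, norm_mul, ← mul_assoc]
    exact mul_le_mul_of_nonneg_right (h ξ) (norm_nonneg _)
  refine ⟨h1, ?_⟩
  rw [← Lp.norm_fourier_eq, ← Lp.norm_fourier_eq (fmul m₂ f)]
  refine Lp.norm_le_mul_norm_of_ae_le_mul ?_
  filter_upwards [fourier_fmul h1, fourier_fmul h₂] with ξ e1 e2
  rw [e1, e2, norm_mul, norm_mul, ← mul_assoc]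
  exact mul_le_mul_of_nonneg_right (h ξ) (norm_nonneg _)

theorem MemMul.of_bounded {m : ℝ → ℂ} {C : ℝ} (hm : AEStronglyMeasurable m)
    (h : ∀ ξ, ‖m ξ‖ ≤ C) (f : L2R) : MemMul m f ∧ ‖fmul m f‖ ≤ C * ‖f‖ := by
  have := MemMul.mono (m₁ := m) (fmul_one f).1 hm (by simpa using h)
  rwa [(fmul_one f).2] at this

/-- The Fourier multiplier with a bounded symbol. -/
def bmul (m : ℝ → ℂ) (hm : AEStronglyMeasurable m) (C : ℝ) (h : ∀ ξ, ‖m ξ‖ ≤ C) :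
    L2R →L[ℂ] L2R :=
  LinearMap.mkContinuous
    { toFun := fmul m
      map_add' := fun f g => (MemMul.add (MemMul.of_bounded hm h f).1
        (MemMul.of_bounded hm h g).1).2
      map_smul' := fun c f => (MemMul.smul c (MemMul.of_bounded hm h f).1).2 } C
    fun f => (MemMul.of_bounded hm h f).2

theorem bmul_apply {m : ℝ → ℂ} {hm : AEStronglyMeasurable m} {C : ℝ}
    {h : ∀ ξ, ‖m ξ‖ ≤ C} (f : L2R) : bmul m hm C h f = fmul m f := rfl

theorem inner_eq_integral_fourier (f g : L2R) :
    inner ℂ f g = ∫ ξ, (starRingEnd ℂ) ((𝓕 f : L2R) ξ) * (𝓕 g : L2R) ξ := by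
  rw [← Lp.inner_fourier_eq, L2.inner_def]
  congr 1; ext ξ; rw [RCLike.inner_apply]; ring

/-- Dominated convergence for Fourier multipliers. -/
theorem tendsto_fmul {ι : Type*} {l : Filter ι} [l.IsCountablyGenerated] {m : ι → ℝ → ℂ}
    {m₀ G : ℝ → ℂ} {f : L2R} (hG : MemMul G f) (hm : ∀ i, AEStronglyMeasurable (m i))
    (hm₀ : AEStronglyMeasurable m₀)
    (hb : ∀ᶠ i in l, ∀ ξ, ‖m i ξ‖ ≤ ‖G ξ‖) (hb₀ : ∀ ξ, ‖m₀ ξ‖ ≤ ‖G ξ‖)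
    (hlim : ∀ ξ, Tendsto (fun i => m i ξ) l (𝓝 (m₀ ξ))) :
    Tendsto (fun i => fmul (m i) f) l (𝓝 (fmul m₀ f)) := by
  rw [tendsto_iff_norm_sub_tendsto_zero]
  have h0 := (MemMul.mono (C := 1) hG hm₀ (by simpa using hb₀)).1
  have key : Tendsto (fun i => ∫ ξ, ‖m i ξ - m₀ ξ‖ ^ 2 * ‖(𝓕 f : L2R) ξ‖ ^ 2) l (𝓝 0) := by
    have hz : ∫ ξ : ℝ, (0 : ℝ) = 0 := by simp
    rw [← hz]
    refine tendsto_integral_filter_of_dominated_convergence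
      (fun ξ => 4 * (‖G ξ‖ ^ 2 * ‖(𝓕 f : L2R) ξ‖ ^ 2)) ?_ ?_ (hG.integrable.const_mul 4) ?_
    · exact Eventually.of_forall fun i => (((hm i).sub hm₀).norm.pow 2).mul
        ((Lp.aestronglyMeasurable _).norm.pow 2)
    · filter_upwards [hb] with i hi
      refine Eventually.of_forall fun ξ => ?_
      rw [Real.norm_of_nonneg (by positivity), ← mul_assoc]
      refine mul_le_mul_of_nonneg_right ?_ (by positivity)
      have := norm_sub_le (m i ξ) (m₀ ξ)
      have h2 : ‖m i ξ - m₀ ξ‖ ≤ 2 * ‖G ξ‖ := by linarith [hi ξ, hb₀ ξ]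
      calc ‖m i ξ - m₀ ξ‖ ^ 2 ≤ (2 * ‖G ξ‖) ^ 2 := by gcongr
        _ = _ := by ring
    · refine Eventually.of_forall fun ξ => ?_
      have := (((hlim ξ).sub_const (m₀ ξ)).norm.pow 2).mul_const (‖(𝓕 f : L2R) ξ‖ ^ 2)
      simpa using this
  have key2 : Tendsto (fun i => ‖fmul (m i) f - fmul m₀ f‖ ^ 2) l (𝓝 0) := by
    refine key.congr' ?_
    filter_upwards [hb] with i hi
    have hmi := (MemMul.mono (C := 1) hG (hm i) (by simpa using hi)).1
    rw [← Lp.norm_fourier_eq, norm_sq_eq_integral]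
    refine integral_congr_ae ?_
    filter_upwards [fourier_sub_ae (fmul (m i) f) (fmul m₀ f), fourier_fmul hmi, fourier_fmul h0]
      with ξ h1 h2 h3
    simp only [h1, h2, h3]
    rw [← sub_mul, norm_mul, mul_pow]
  have := key2.sqrt
  simpa [Real.sqrt_sq] using this

/-- `L²` functions are dominated a.e. by the `L¹` norm of their Fourier transform. -/
theorem ae_norm_le_integral_fourier {f : L2R} (h : Integrable ((𝓕 f : L2R) : ℝ → ℂ)) :
    ∀ᵐ x, ‖f x‖ ≤ ∫ ξ, ‖(𝓕 f : L2R) ξ‖ := by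
  set g : ℝ → ℂ := ((𝓕 f : L2R) : ℝ → ℂ) with hg
  have hneg : Continuous fun p : ℝ × ℝ => (-innerₗ ℝ) p.1 p.2 := by
    simp only [LinearMap.neg_apply, innerₗ_apply_apply]; fun_prop
  have hcont : Continuous (𝓕⁻ g) :=
    VectorFourier.fourierIntegral_continuous Real.continuous_fourierChar hneg h
  have key : (f : ℝ → ℂ) =ᵐ[volume] 𝓕⁻ g := by
    apply ae_eq_of_integral_contDiff_smul_eq ((Lp.memLp f).locallyIntegrable (by norm_num))
      hcont.locallyIntegrable
    intro φ hφ hc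
    have hg₁ : HasCompactSupport (Complex.ofRealCLM ∘ φ) := hc.comp_left rfl
    have hg₂ : ContDiff ℝ (⊤ : ℕ∞) (Complex.ofRealCLM ∘ φ) := by fun_prop
    set Φ : 𝓢(ℝ, ℂ) := hg₁.toSchwartzMap hg₂
    -- The `L²` function and the inverse Fourier integral of its transform are compared by duality:
    -- the transform is moved onto the test function once for tempered distributions and once, in
    -- `e2`, for integrable functions.
    have e1 : (f : 𝓢'(ℝ, ℂ)) Φ = ((𝓕 f : L2R) : 𝓢'(ℝ, ℂ)) (𝓕⁻ Φ) := by
      rw [← Lp.fourier_toTemperedDistribution_eq, TemperedDistribution.fourier_apply,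
        FourierTransform.fourier_fourierInv_eq]
    rw [Lp.toTemperedDistribution_apply, Lp.toTemperedDistribution_apply] at e1
    have e2 : ∫ x, Φ x • (𝓕⁻ g) x = ∫ ξ, (𝓕⁻ Φ : 𝓢(ℝ, ℂ)) ξ • g ξ := by
      have := VectorFourier.integral_fourierIntegral_smul_eq_flip (L := -innerₗ ℝ)
        (μ := volume) (ν := volume) Real.continuous_fourierChar hneg (f := Φ) (g := g)
        Φ.integrable h
      have hflip : (-innerₗ ℝ).flip = -innerₗ ℝ := by
        ext; simp
      rw [hflip] at this
      rw [SchwartzMap.fourierInv_coe]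
      exact this.symm
    rw [← e2] at e1
    have hΦ (x : ℝ) : Φ x = ((φ x : ℝ) : ℂ) := rfl
    simpa [hΦ] using e1
  filter_upwards [key] with x hx
  rw [hx, Real.fourierInv_eq]
  refine (norm_integral_le_integral_norm _).trans_eq ?_
  simp

/-! ### Translations and first differences -/

/-- Translation `(τ_h f)(x) = f(x + h)`. -/
def shiftL (h : ℝ) : L2R →ₗᵢ[ℂ] L2R :=
  Lp.compMeasurePreservingₗᵢ ℂ (fun x => x + h) (measurePreserving_add_right volume h)

theorem shiftL_ae (h : ℝ) (f : L2R) :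
    (shiftL h f : ℝ → ℂ) =ᵐ[volume] fun x => f (x + h) :=
  Lp.coeFn_compMeasurePreserving f (measurePreserving_add_right volume h)

theorem ae_shiftL {p : ℝ → Prop} (h : ℝ) (hp : ∀ᵐ x, p x) : ∀ᵐ x, p (x + h) :=
  (measurePreserving_add_right volume h).quasiMeasurePreserving.ae hp

/-- The symbol of the translation by `h`. -/
def transSymbol (h ξ : ℝ) : ℂ := Complex.exp ((2 * Real.pi * (h * ξ) : ℝ) * Complex.I)

theorem norm_transSymbol (h ξ : ℝ) : ‖transSymbol h ξ‖ = 1 := Complex.norm_exp_ofReal_mul_I _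

theorem continuous_transSymbol (h : ℝ) : Continuous (transSymbol h) := by
  unfold transSymbol; fun_prop

/-- Both sides are continuous on `L²`, so the classical formula on the dense image of Schwartz
functions suffices. -/
theorem shiftL_eq_fmul (h : ℝ) (f : L2R) : shiftL h f = fmul (transSymbol h) f := by
  have hb := fun ξ => (norm_transSymbol h ξ).le
  have hm := (continuous_transSymbol h).aestronglyMeasurable (μ := volume)
  change shiftL h f = bmul (transSymbol h) hm 1 hb f
  refine DenseRange.induction_on
    (p := fun f => shiftL h f = bmul (transSymbol h) hm 1 hb f)
    (SchwartzMap.denseRange_toLpCLM (F := ℂ) (p := 2) (μ := (volume : Measure ℝ)) ENNReal.ofNat_ne_top) f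
    (isClosed_eq (shiftL h).continuous (ContinuousLinearMap.continuous _)) fun φ => ?_
  rw [bmul_apply]
  refine (MemMul.eq_fmul ?_).2
  change ((𝓕 (shiftL h (φ.toLp 2)) : L2R) : ℝ → ℂ) =ᵐ[volume]
    fun ξ => transSymbol h ξ * (𝓕 (φ.toLp 2) : L2R) ξ
  set ψ : 𝓢(ℝ, ℂ) := SchwartzMap.compCLMOfAntilipschitz (K := 1) ℂ (g := fun x : ℝ => x + h) (by fun_prop)
    (by
      refine AntilipschitzWith.of_le_mul_dist fun x y => ?_
      simp) φ
  have e1 : shiftL h (φ.toLp 2) = ψ.toLp 2 := by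
    refine Lp.ext ?_
    filter_upwards [shiftL_ae h (φ.toLp 2), ψ.coeFn_toLp 2 volume,
      ae_shiftL h (φ.coeFn_toLp 2 volume)] with x h1 h2 h3
    rw [h1, h2, h3]; rfl
  rw [e1, SchwartzMap.toLp_fourier_eq, SchwartzMap.toLp_fourier_eq]
  filter_upwards [(𝓕 ψ).coeFn_toLp 2 volume, (𝓕 φ).coeFn_toLp 2 volume] with ξ h1 h2
  rw [h1, h2, SchwartzMap.fourier_coe, SchwartzMap.fourier_coe]
  have := congrFun (VectorFourier.fourierIntegral_comp_add_right Real.fourierChar volume (innerₗ ℝ) φ h) ξ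
  refine this.trans ?_
  rw [Circle.smul_def, Real.fourierChar_apply, transSymbol, smul_eq_mul]
  congr 3
  simp [mul_comm]

/-- The difference `Δ_h f = f(· + h) - f`. -/
def diff (h : ℝ) (f : L2R) : L2R := shiftL h f - f

theorem diff_ae (h : ℝ) (f : L2R) :
    (diff h f : ℝ → ℂ) =ᵐ[volume] fun x => f (x + h) - f x := by
  filter_upwards [Lp.coeFn_sub (shiftL h f) f, shiftL_ae h f] with x h1 h2
  rw [diff, h1, Pi.sub_apply, h2]

/-- The symbol of `Δ_h`. -/
def diffSymbol (h ξ : ℝ) : ℂ := transSymbol h ξ - 1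

theorem continuous_diffSymbol (h : ℝ) : Continuous (diffSymbol h) :=
  (continuous_transSymbol h).sub continuous_const

theorem norm_diffSymbol_le_two (h ξ : ℝ) : ‖diffSymbol h ξ‖ ≤ 2 := by
  refine (norm_sub_le _ _).trans ?_
  rw [norm_transSymbol, norm_one]; norm_num

theorem norm_diffSymbol_le (h ξ : ℝ) : ‖diffSymbol h ξ‖ ≤ 2 * Real.pi * (|h| * |ξ|) := by
  have := Real.norm_exp_I_mul_ofReal_sub_one_le (x := 2 * Real.pi * (h * ξ))
  rw [diffSymbol, transSymbol, mul_comm _ Complex.I]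
  refine this.trans_eq ?_
  rw [Real.norm_eq_abs, abs_mul, abs_mul, abs_mul, abs_of_pos Real.pi_pos]; simp

/-- This form shows that the modulus depends on `hξ` only and is even, which gives the scaling laws
of the integrated kernels. -/
theorem norm_diffSymbol_sq (h ξ : ℝ) :
    ‖diffSymbol h ξ‖ ^ 2 = 2 - 2 * Real.cos (2 * Real.pi * (h * ξ)) := by
  rw [diffSymbol, transSymbol, Complex.exp_mul_I, ← Complex.ofReal_cos, ← Complex.ofReal_sin,
    ← Complex.normSq_eq_norm_sq, Complex.normSq_apply]
  simp only [Complex.sub_re, Complex.add_re, Complex.ofReal_re, Complex.mul_re, Complex.I_re,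
    Complex.ofReal_im, Complex.I_im, Complex.one_re, Complex.sub_im, Complex.add_im,
    Complex.mul_im, Complex.one_im]
  nlinarith [Real.sin_sq_add_cos_sq (2 * Real.pi * (h * ξ))]

theorem memMul_diffSymbol (h : ℝ) (f : L2R) : MemMul (diffSymbol h) f :=
  (MemMul.of_bounded (continuous_diffSymbol h).aestronglyMeasurable
    (norm_diffSymbol_le_two h) f).1

theorem diff_eq_fmul (h : ℝ) (f : L2R) : diff h f = fmul (diffSymbol h) f := by
  refine (MemMul.eq_fmul ?_).2
  have h0 := (MemMul.of_bounded (continuous_transSymbol h).aestronglyMeasurable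
    (fun ξ => (norm_transSymbol h ξ).le) f).1
  filter_upwards [fourier_sub_ae (shiftL h f) f, fourier_fmul h0] with ξ h1 h2
  rw [diff, h1, shiftL_eq_fmul, h2, diffSymbol]; ring

theorem norm_diff_le (h : ℝ) (f : L2R) : ‖diff h f‖ ≤ 2 * ‖f‖ := by
  refine (norm_sub_le _ _).trans ?_
  rw [LinearIsometry.norm_map]; linarith

/-! ### Sobolev norms and their effect on differences -/

/-- The symbol of `(1 - Δ)^{s/2}`. -/
def wt (s ξ : ℝ) : ℂ := ((bracket ξ ^ s : ℝ) : ℂ)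

theorem continuous_bracket : Continuous bracket := by unfold bracket; fun_prop

theorem one_le_bracket (ξ : ℝ) : 1 ≤ bracket ξ := by
  rw [bracket, Real.one_le_sqrt]; nlinarith [sq_nonneg (2 * Real.pi * ξ)]

theorem abs_le_bracket (ξ : ℝ) : 2 * Real.pi * |ξ| ≤ bracket ξ := by
  refine Real.le_sqrt_of_sq_le ?_
  rw [mul_pow, sq_abs]; nlinarith

theorem bracket_le (ξ : ℝ) : bracket ξ ≤ 1 + 2 * Real.pi * |ξ| := by
  refine Real.sqrt_le_iff.2 ⟨by positivity, ?_⟩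
  have : 0 ≤ Real.pi * |ξ| := by positivity
  have h2 : (2 * Real.pi * ξ) ^ 2 = (2 * Real.pi * |ξ|) ^ 2 := by rw [mul_pow _ ξ, mul_pow _ |ξ|, sq_abs]
  rw [h2]
  nlinarith

theorem continuous_wt (s : ℝ) : Continuous (wt s) :=
  Complex.continuous_ofReal.comp
    (continuous_bracket.rpow_const fun ξ => Or.inl (bracket_pos ξ).ne')

theorem aesm_wt (s : ℝ) : AEStronglyMeasurable (wt s) (volume : Measure ℝ) :=
  (continuous_wt s).aestronglyMeasurable

theorem norm_wt (s ξ : ℝ) : ‖wt s ξ‖ = bracket ξ ^ s := by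
  rw [wt, Complex.norm_real, Real.norm_of_nonneg (Real.rpow_nonneg (bracket_pos ξ).le _)]

theorem wt_one (ξ : ℝ) : wt 1 ξ = (bracket ξ : ℂ) := by rw [wt, Real.rpow_one]

theorem norm_wt_mono {s t : ℝ} (h : s ≤ t) (ξ : ℝ) : ‖wt s ξ‖ ≤ ‖wt t ξ‖ := by
  rw [norm_wt, norm_wt]; exact Real.rpow_le_rpow_of_exponent_le (one_le_bracket ξ) h

/-- `f ∈ H^s`. -/
abbrev InH (s : ℝ) (f : L2R) : Prop := MemMul (wt s) f

/-- The `H^s` norm for `f ∈ H^s`. -/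
abbrev hNorm (s : ℝ) (f : L2R) : ℝ := ‖fmul (wt s) f‖

theorem InH.mono {s t : ℝ} (h : s ≤ t) {f : L2R} (hf : InH t f) :
    InH s f ∧ hNorm s f ≤ hNorm t f := by
  simpa using MemMul.mono (C := 1) hf (aesm_wt s) (by simpa using norm_wt_mono h)

theorem norm_le_hNorm {s : ℝ} (hs : 0 ≤ s) {f : L2R} (hf : InH s f) : ‖f‖ ≤ hNorm s f := by
  have := (InH.mono hs hf).2
  have h0 : wt 0 = fun _ => 1 := by ext ξ; simp [wt]
  rwa [hNorm, h0, (fmul_one f).2] at this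

theorem inH_iff {s : ℝ} (f : L2R) : InH s f ↔ sobolevENorm s f < ⊤ := by
  refine ⟨fun h => h.2, fun h => ⟨(aesm_wt s).mul (Lp.aestronglyMeasurable _), h⟩⟩

theorem sobolevENorm_eq {s : ℝ} {f : L2R} (hf : InH s f) :
    sobolevENorm s f = ENNReal.ofReal (hNorm s f) := by
  rw [ofReal_norm, ← enorm_fourier, Lp.enorm_def]
  exact eLpNorm_congr_ae (fourier_fmul hf).symm

theorem InH.diff {s : ℝ} {f : L2R} (hf : InH s f) (h : ℝ) :
    InH s (diff h f) ∧ hNorm s (_root_.diff h f) ≤ 2 * hNorm s f := by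
  have hm : AEStronglyMeasurable (fun ξ => wt s ξ * diffSymbol h ξ) (volume : Measure ℝ) :=
    (aesm_wt s).mul (continuous_diffSymbol h).aestronglyMeasurable
  have h1 := MemMul.mono (C := 2) hf hm fun ξ => by
    rw [norm_mul, mul_comm]
    exact mul_le_mul_of_nonneg_right (norm_diffSymbol_le_two h ξ) (norm_nonneg _)
  have h2 := MemMul.comp (memMul_diffSymbol h f) h1.1
  rw [diff_eq_fmul]
  exact ⟨h2.1, by rw [hNorm, h2.2]; exact h1.2⟩

theorem norm_diff_le_hNorm_one {f : L2R} (hf : InH 1 f) (h : ℝ) :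
    ‖diff h f‖ ≤ |h| * hNorm 1 f := by
  rw [diff_eq_fmul]
  refine (MemMul.mono hf (continuous_diffSymbol h).aestronglyMeasurable fun ξ => ?_).2
  rw [norm_wt, Real.rpow_one]
  calc _ ≤ |h| * (2 * Real.pi * |ξ|) := (norm_diffSymbol_le h ξ).trans_eq (by ring)
    _ ≤ _ := by gcongr; exact abs_le_bracket ξ

/-- Geometric mean of the two bounds `2` and `|h| bracket ξ`: half a derivative buys the factor
`|h|^{1/2}`. -/
theorem norm_diffSymbol_le_half (h ξ : ℝ) :
    ‖diffSymbol h ξ‖ ≤ Real.sqrt 2 * |h| ^ (1 / 2 : ℝ) * bracket ξ ^ (1 / 2 : ℝ) := by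
  rw [← Real.sqrt_eq_rpow, ← Real.sqrt_eq_rpow, ← Real.sqrt_mul (by norm_num),
    ← Real.sqrt_mul (by positivity)]
  refine Real.le_sqrt_of_sq_le ?_
  have h1 : ‖diffSymbol h ξ‖ ≤ |h| * bracket ξ :=
    (norm_diffSymbol_le h ξ).trans (by
      have := mul_le_mul_of_nonneg_left (abs_le_bracket ξ) (abs_nonneg h); linarith)
  nlinarith [norm_diffSymbol_le_two h ξ, norm_nonneg (diffSymbol h ξ)]

theorem norm_diff_le_half {s : ℝ} {f : L2R} (hf : InH (s + 1 / 2) f) (h : ℝ) :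
    hNorm s (diff h f) ≤ Real.sqrt 2 * |h| ^ (1 / 2 : ℝ) * hNorm (s + 1 / 2) f := by
  have hm : AEStronglyMeasurable (fun ξ => wt s ξ * diffSymbol h ξ) (volume : Measure ℝ) :=
    (aesm_wt s).mul (continuous_diffSymbol h).aestronglyMeasurable
  have h1 := MemMul.mono (C := Real.sqrt 2 * |h| ^ (1 / 2 : ℝ)) hf hm fun ξ => by
    rw [norm_mul, norm_wt, norm_wt, Real.rpow_add (bracket_pos ξ)]
    have := mul_le_mul_of_nonneg_left (norm_diffSymbol_le_half h ξ)
      (Real.rpow_nonneg (bracket_pos ξ).le s)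
    linarith
  have h2 := MemMul.comp (memMul_diffSymbol h f) h1.1
  rw [diff_eq_fmul, hNorm, h2.2]
  exact h1.2

theorem hNorm_zero (f : L2R) : hNorm 0 f = ‖f‖ := by
  have h0 : wt 0 = fun _ => 1 := by ext ξ; simp [wt]
  rw [hNorm, h0, (fmul_one f).2]

/-! ### Sup bounds: Gagliardo–Nirenberg and Brezis–Gallouët -/

/-- The `L¹` norm of the Fourier transform. -/
def wiener (f : L2R) : ℝ := ∫ ξ, ‖(𝓕 f : L2R) ξ‖

theorem wiener_nonneg (f : L2R) : 0 ≤ wiener f := integral_nonneg fun _ => norm_nonneg _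

/-- Weighted Cauchy–Schwarz bound of the `L¹` norm of the Fourier transform on a set. -/
theorem integrable_fourier_of_weight {f : L2R} {w : ℝ → ℝ} {S : Set ℝ}
    (hw : Measurable w) (hw0 : ∀ ξ, 0 < w ξ) (hi : IntegrableOn (fun ξ => (w ξ ^ 2)⁻¹) S)
    (hf : MemMul (fun ξ => (w ξ : ℂ)) f) :
    IntegrableOn ((𝓕 f : L2R) : ℝ → ℂ) S ∧
    (∫ ξ in S, ‖(𝓕 f : L2R) ξ‖) ≤
      Real.sqrt (∫ ξ in S, (w ξ ^ 2)⁻¹) * ‖fmul (fun ξ => (w ξ : ℂ)) f‖ := by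
  have hW : MemLp (fun ξ => (w ξ)⁻¹) 2 (volume.restrict S) := by
    refine (memLp_two_iff_integrable_sq hw.inv.aestronglyMeasurable).2 ?_
    simpa [IntegrableOn] using hi
  have hg : MemLp (fun ξ => ‖(w ξ : ℂ) * (𝓕 f : L2R) ξ‖) 2 (volume.restrict S) :=
    (MemLp.restrict S hf).norm
  have hprod := MemLp.integrable_mul hW hg
  have heq (ξ : ℝ) : (w ξ)⁻¹ * ‖(w ξ : ℂ) * (𝓕 f : L2R) ξ‖ = ‖(𝓕 f : L2R) ξ‖ := by
    rw [norm_mul, Complex.norm_real, Real.norm_of_nonneg (hw0 ξ).le, ← mul_assoc,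
      inv_mul_cancel₀ (hw0 ξ).ne', one_mul]
  refine ⟨?_, ?_⟩
  · have : Integrable (fun ξ => ‖(𝓕 f : L2R) ξ‖) (volume.restrict S) := by
      refine hprod.congr (Eventually.of_forall fun ξ => ?_)
      exact heq ξ
    exact (integrable_norm_iff (Lp.aestronglyMeasurable _).restrict).1 this
  · have h1 := integral_mul_le_Lp_mul_Lq_of_nonneg (μ := volume.restrict S) (p := 2) (q := 2)
      Real.HolderConjugate.two_two
      (Eventually.of_forall fun ξ => (inv_pos.2 (hw0 ξ)).le)
      (Eventually.of_forall fun ξ => norm_nonneg ((w ξ : ℂ) * (𝓕 f : L2R) ξ))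
      (by simpa using hW) (by simpa using hg)
    simp only [heq] at h1
    refine h1.trans ?_
    rw [← Real.sqrt_eq_rpow, ← Real.sqrt_eq_rpow]
    simp only [Real.rpow_ofNat, inv_pow]
    refine mul_le_mul_of_nonneg_left ?_ (Real.sqrt_nonneg _)
    refine Real.sqrt_le_iff.2 ⟨norm_nonneg _, ?_⟩
    rw [norm_fmul_sq hf]
    simp only [norm_mul, mul_pow]
    exact setIntegral_le_integral hf.integrable (Eventually.of_forall fun ξ => by positivity)

theorem integrable_inv_sq_add_sq {μ : ℝ} (hμ : 0 < μ) :
    Integrable (fun ξ : ℝ => (μ ^ 2 + ξ ^ 2)⁻¹) ∧ ∫ ξ : ℝ, (μ ^ 2 + ξ ^ 2)⁻¹ = Real.pi / μ := by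
  have h1 : (fun ξ : ℝ => (μ ^ 2 + ξ ^ 2)⁻¹) = fun ξ => (μ ^ 2)⁻¹ * (1 + (ξ / μ) ^ 2)⁻¹ := by
    ext ξ
    rw [← mul_inv]; congr 1; field_simp
  rw [h1]
  refine ⟨(integrable_inv_one_add_sq.comp_div hμ.ne').const_mul _, ?_⟩
  rw [integral_const_mul, Measure.integral_comp_div (fun x : ℝ => (1 + x ^ 2)⁻¹),
    integral_univ_inv_one_add_sq, abs_of_pos hμ, smul_eq_mul]
  field_simp

/-- Gagliardo–Nirenberg: the `L¹` norm of the Fourier transform, hence the sup norm, is controlled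
by the `L²` and the `H¹` norm. -/
theorem wiener_sq_le {f : L2R} (hf : InH 1 f) :
    Integrable ((𝓕 f : L2R) : ℝ → ℂ) ∧ wiener f ^ 2 ≤ 2 * Real.pi * ‖f‖ * hNorm 1 f := by
  -- Cauchy–Schwarz with the weight `√(μ² + ξ²)`, whose inverse square integrates to `π/μ`; the
  -- frequency scale `μ` stays free until the end.
  have key (μ : ℝ) (hμ : 0 < μ) : Integrable ((𝓕 f : L2R) : ℝ → ℂ) ∧
      wiener f ^ 2 ≤ Real.pi / μ * (μ ^ 2 * ‖f‖ ^ 2 + hNorm 1 f ^ 2) := by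
    set w : ℝ → ℝ := fun ξ => Real.sqrt (μ ^ 2 + ξ ^ 2) with hwdef
    have hw0 (ξ : ℝ) : 0 < w ξ := Real.sqrt_pos.2 (by positivity)
    have hwc : Continuous w := by fun_prop
    have hwsq (ξ : ℝ) : w ξ ^ 2 = μ ^ 2 + ξ ^ 2 := Real.sq_sqrt (by positivity)
    have hle (ξ : ℝ) : μ ^ 2 + ξ ^ 2 ≤ (μ ^ 2 + 1) * bracket ξ ^ 2 := by
      have h1 := abs_le_bracket ξ
      have h2 : |ξ| ≤ bracket ξ := le_trans (by nlinarith [abs_nonneg ξ, Real.pi_gt_three]) h1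
      have h3 : ξ ^ 2 ≤ bracket ξ ^ 2 := by rw [← sq_abs]; gcongr
      have h4 : 1 ≤ bracket ξ ^ 2 := one_le_pow₀ (one_le_bracket ξ)
      nlinarith [mul_nonneg (sq_nonneg μ) (sub_nonneg.2 h4)]
    have hm : MemMul (fun ξ => (w ξ : ℂ)) f := by
      refine (MemMul.mono (C := Real.sqrt (μ ^ 2 + 1)) hf
        (Complex.continuous_ofReal.comp hwc).aestronglyMeasurable fun ξ => ?_).1
      rw [norm_wt, Real.rpow_one, Function.comp_apply, Complex.norm_real,
        Real.norm_of_nonneg (hw0 ξ).le]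
      refine Real.sqrt_le_iff.2 ⟨by have := bracket_pos ξ; positivity, ?_⟩
      rw [mul_pow, Real.sq_sqrt (by positivity)]
      exact hle ξ
    have hint := integrable_inv_sq_add_sq hμ
    have h := integrable_fourier_of_weight (S := Set.univ) hwc.measurable hw0
      (by simpa [hwsq] using hint.1) hm
    simp only [Measure.restrict_univ, integrableOn_univ, hwsq, hint.2] at h
    refine ⟨h.1, ?_⟩
    have h2 : ‖fmul (fun ξ => (w ξ : ℂ)) f‖ ^ 2 ≤ μ ^ 2 * ‖f‖ ^ 2 + hNorm 1 f ^ 2 := by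
      rw [norm_fmul_sq hm, norm_fmul_sq hf, ← Lp.norm_fourier_eq f, norm_sq_eq_integral,
        ← integral_const_mul, ← integral_add ((integrable_norm_sq _).const_mul _) hf.integrable]
      refine integral_mono hm.integrable
        (((integrable_norm_sq _).const_mul _).add hf.integrable) fun ξ => ?_
      simp only [Complex.norm_real, Real.norm_of_nonneg (hw0 ξ).le, hwsq, norm_wt, Real.rpow_one]
      rw [← add_mul]
      refine mul_le_mul_of_nonneg_right ?_ (by positivity)
      have h1 := abs_le_bracket ξ
      have h2 : |ξ| ≤ bracket ξ := le_trans (by nlinarith [abs_nonneg ξ, Real.pi_gt_three]) h1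
      have h3 : ξ ^ 2 ≤ bracket ξ ^ 2 := by rw [← sq_abs]; gcongr
      linarith
    calc wiener f ^ 2 ≤ (Real.sqrt (Real.pi / μ) * ‖fmul (fun ξ => (w ξ : ℂ)) f‖) ^ 2 :=
          pow_le_pow_left₀ (wiener_nonneg f) h.2 2
      _ = Real.pi / μ * ‖fmul (fun ξ => (w ξ : ℂ)) f‖ ^ 2 := by
          rw [mul_pow, Real.sq_sqrt (by positivity)]
      _ ≤ _ := by gcongr
  refine ⟨(key 1 one_pos).1, ?_⟩
  have hle := norm_le_hNorm zero_le_one hf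
  rcases eq_or_lt_of_le (norm_nonneg f) with h0 | h0
  · have hz : f = 0 := norm_eq_zero.1 h0.symm
    have h1 := (MemMul.smul 0 hf).2
    rw [zero_smul, zero_smul] at h1
    have := (key 1 one_pos).2
    rw [hz, hNorm, h1] at this ⊢
    simpa using this
  · have hB : 0 < hNorm 1 f := lt_of_lt_of_le h0 hle
    -- This value of `μ` makes `μ²‖f‖²` equal to the squared `H^1` norm, which optimises the bound;
    -- it needs `f ≠ 0`, whence the separate case above.
    refine ((key (hNorm 1 f / ‖f‖) (by positivity)).2).trans_eq ?_
    field_simp; ring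

theorem wiener_le_three {f : L2R} (hf : InH 1 f) : wiener f ≤ 3 * hNorm 1 f := by
  refine le_of_sq_le_sq ?_ (by positivity)
  refine (wiener_sq_le hf).2.trans ?_
  have hle := norm_le_hNorm zero_le_one hf
  have : Real.pi < 3.15 := Real.pi_lt_d2
  have h0 := norm_nonneg (fmul (wt 1) f)
  calc 2 * Real.pi * ‖f‖ * hNorm 1 f ≤ 2 * Real.pi * hNorm 1 f * hNorm 1 f := by gcongr
    _ ≤ 2 * 3.15 * hNorm 1 f * hNorm 1 f := by gcongr
    _ ≤ _ := by nlinarith [mul_nonneg h0 h0]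

theorem ae_norm_le_wiener {f : L2R} (hf : InH 1 f) : ∀ᵐ x, ‖f x‖ ≤ wiener f :=
  ae_norm_le_integral_fourier (wiener_sq_le hf).1

theorem integral_inv_bracket_le {l : ℝ} (hl : 0 ≤ l) :
    ∫ ξ in Set.Icc (-l) l, (bracket ξ)⁻¹ ≤ 4 * Real.log (1 + l) := by
  have hc : Continuous fun ξ => (bracket ξ)⁻¹ :=
    continuous_bracket.inv₀ fun ξ => (bracket_pos ξ).ne'
  have hc2 : Continuous fun ξ : ℝ => 2 * (1 + |ξ|)⁻¹ :=
    continuous_const.mul ((by fun_prop : Continuous fun ξ : ℝ => 1 + |ξ|).inv₀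
      fun ξ => by positivity)
  have h1 : ∫ ξ in Set.Icc (-l) l, (bracket ξ)⁻¹ ≤ ∫ ξ in Set.Icc (-l) l, 2 * (1 + |ξ|)⁻¹ := by
    refine setIntegral_mono_on hc.continuousOn.integrableOn_Icc hc2.continuousOn.integrableOn_Icc
      measurableSet_Icc fun ξ _ => ?_
    rw [← div_eq_mul_inv, inv_eq_one_div, div_le_div_iff₀ (bracket_pos ξ) (by positivity)]
    nlinarith [one_le_bracket ξ, abs_le_bracket ξ, abs_nonneg ξ, Real.pi_gt_three]
  refine h1.trans_eq ?_
  rw [integral_Icc_eq_integral_Ioc, ← intervalIntegral.integral_of_le (by linarith),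
    ← intervalIntegral.integral_add_adjacent_intervals (b := 0)
      (hc2.intervalIntegrable _ _) (hc2.intervalIntegrable _ _)]
  have hpos : ∫ ξ in (0 : ℝ)..l, 2 * (1 + |ξ|)⁻¹ = 2 * Real.log (1 + l) := by
    rw [intervalIntegral.integral_const_mul]
    congr 1
    have : ∫ ξ in (0 : ℝ)..l, (1 + |ξ|)⁻¹ = ∫ ξ in (0 : ℝ)..l, (1 + ξ)⁻¹ := by
      refine intervalIntegral.integral_congr fun ξ hξ => ?_
      rw [Set.uIcc_of_le hl] at hξ
      simp only [abs_of_nonneg hξ.1]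
    rw [this, intervalIntegral.integral_comp_add_left (fun x : ℝ => x⁻¹), integral_inv_of_pos
      (by norm_num) (by linarith)]
    simp
  have hneg : ∫ ξ in (-l)..0, 2 * (1 + |ξ|)⁻¹ = 2 * Real.log (1 + l) := by
    have := intervalIntegral.integral_comp_neg (a := 0) (b := l) fun ξ : ℝ => 2 * (1 + |ξ|)⁻¹
    simp only [abs_neg, neg_zero] at this
    rw [← this, hpos]
  rw [hpos, hneg]; ring

/-- Brezis–Gallouët inequality. -/
theorem brezis_gallouet {f : L2R} (hf : InH 1 f) {A B : ℝ} (hA : hNorm (1 / 2) f ≤ A)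
    (hB : hNorm 1 f ≤ B) : wiener f ^ 2 ≤ 16 * (A ^ 2 + 1) * (1 + Real.log (1 + B)) := by
  have hB0 : 0 ≤ B := (norm_nonneg _).trans hB
  have hA0 : 0 ≤ A := (norm_nonneg _).trans hA
  -- Frequency threshold: the `H^{1/2}` norm controls frequencies below `l` up to `√log`, the `H^1`
  -- norm those above it up to `l^{-1/2}`. With `l ≥ B²` the high part is bounded by a constant,
  -- while `log(1 + l)` is still comparable to `1 + log(1 + B)`.
  set l : ℝ := 1 + B ^ 2 with hl
  have hl0 : 0 < l := by positivity
  have hI := (wiener_sq_le hf).1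
  have hhalf := (InH.mono (s := 1 / 2) (by norm_num) hf).1
  have hsplit : wiener f = (∫ ξ in Set.Icc (-l) l, ‖(𝓕 f : L2R) ξ‖) +
      ∫ ξ in (Set.Icc (-l) l)ᶜ, ‖(𝓕 f : L2R) ξ‖ :=
    (integral_add_compl measurableSet_Icc hI.norm).symm
  have hcb : Continuous fun ξ => (bracket ξ)⁻¹ :=
    continuous_bracket.inv₀ fun ξ => (bracket_pos ξ).ne'
  have h1 : (∫ ξ in Set.Icc (-l) l, ‖(𝓕 f : L2R) ξ‖) ≤ Real.sqrt (4 * Real.log (1 + l)) * A := by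
    have hsq (ξ : ℝ) : (bracket ξ ^ (1 / 2 : ℝ)) ^ 2 = bracket ξ := by
      rw [← Real.sqrt_eq_rpow, Real.sq_sqrt (bracket_pos ξ).le]
    have := (integrable_fourier_of_weight (S := Set.Icc (-l) l) (f := f)
      (w := fun ξ => bracket ξ ^ (1 / 2 : ℝ))
      (continuous_bracket.rpow_const fun ξ => Or.inl (bracket_pos ξ).ne').measurable
      (fun ξ => Real.rpow_pos_of_pos (bracket_pos ξ) _)
      (by simp only [hsq]; exact hcb.continuousOn.integrableOn_Icc) hhalf).2
    simp only [hsq] at this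
    refine this.trans (mul_le_mul (Real.sqrt_le_sqrt (integral_inv_bracket_le hl0.le)) hA
      (norm_nonneg _) (Real.sqrt_nonneg _))
  have h2 : (∫ ξ in (Set.Icc (-l) l)ᶜ, ‖(𝓕 f : L2R) ξ‖) ≤ Real.sqrt (2 * Real.pi / l) * B := by
    have hint := integrable_inv_sq_add_sq hl0
    have hle (ξ : ℝ) (hξ : ξ ∈ (Set.Icc (-l) l)ᶜ) :
        (bracket ξ ^ 2)⁻¹ ≤ 2 * (l ^ 2 + ξ ^ 2)⁻¹ := by
      have h3 : l ≤ |ξ| := by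
        by_contra hc
        exact hξ (abs_le.1 (not_le.1 hc).le)
      have h4 : ξ ^ 2 ≤ bracket ξ ^ 2 := by
        rw [← sq_abs]; gcongr
        exact le_trans (by nlinarith [abs_nonneg ξ, Real.pi_gt_three]) (abs_le_bracket ξ)
      have h5 : l ^ 2 ≤ ξ ^ 2 := by rw [← sq_abs ξ]; gcongr
      rw [← div_eq_mul_inv, inv_eq_one_div, div_le_div_iff₀ (by have := bracket_pos ξ; positivity)
        (add_pos_of_pos_of_nonneg (pow_pos hl0 2) (sq_nonneg ξ))]
      linarith
    have hi : IntegrableOn (fun ξ => (bracket ξ ^ 2)⁻¹) (Set.Icc (-l) l)ᶜ := by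
      refine Integrable.mono' ((hint.1.const_mul 2).integrableOn)
        (((continuous_bracket.pow 2).inv₀ fun ξ =>
          (pow_pos (bracket_pos ξ) 2).ne').aestronglyMeasurable) ?_
      refine (ae_restrict_iff' measurableSet_Icc.compl).2 (Eventually.of_forall fun ξ hξ => ?_)
      rw [Real.norm_of_nonneg (by positivity)]
      exact hle ξ hξ
    have hf' : MemMul (fun ξ => (bracket ξ : ℂ)) f := by simpa only [← wt_one] using hf
    have hB' : ‖fmul (fun ξ => (bracket ξ : ℂ)) f‖ ≤ B := by
      simpa only [hNorm, ← wt_one] using hB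
    have := (integrable_fourier_of_weight (S := (Set.Icc (-l) l)ᶜ) (f := f) (w := bracket)
      continuous_bracket.measurable bracket_pos hi hf').2
    refine this.trans (mul_le_mul (Real.sqrt_le_sqrt ?_) hB' (norm_nonneg _) (Real.sqrt_nonneg _))
    calc ∫ ξ in (Set.Icc (-l) l)ᶜ, (bracket ξ ^ 2)⁻¹
        ≤ ∫ ξ in (Set.Icc (-l) l)ᶜ, 2 * (l ^ 2 + ξ ^ 2)⁻¹ :=
          setIntegral_mono_on hi (hint.1.const_mul 2).integrableOn measurableSet_Icc.compl hle
      _ ≤ ∫ ξ, 2 * (l ^ 2 + ξ ^ 2)⁻¹ :=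
          setIntegral_le_integral (hint.1.const_mul 2) (Eventually.of_forall fun ξ => by positivity)
      _ = _ := by rw [integral_const_mul, hint.2]; ring
  have h2' : Real.sqrt (2 * Real.pi / l) * B ≤ Real.sqrt (2 * Real.pi) := by
    rw [← Real.sqrt_sq hB0, ← Real.sqrt_mul (by positivity)]
    refine Real.sqrt_le_sqrt ?_
    rw [div_mul_eq_mul_div, div_le_iff₀ hl0]
    refine mul_le_mul_of_nonneg_left ?_ (by positivity)
    linarith
  have hlog0 : 0 ≤ Real.log (1 + l) := Real.log_nonneg (by linarith)
  have hlogB : 0 ≤ Real.log (1 + B) := Real.log_nonneg (by linarith)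
  have hlog : Real.log (1 + l) ≤ 1 + 2 * Real.log (1 + B) := by
    have : 1 + 2 * Real.log (1 + B) = Real.log (Real.exp 1 * (1 + B) ^ 2) := by
      rw [Real.log_mul (Real.exp_pos _).ne' (by positivity), Real.log_exp, Real.log_pow]; simp
    rw [this]
    refine Real.log_le_log (by positivity) ?_
    have : (2 : ℝ) ≤ Real.exp 1 := by have := Real.add_one_le_exp (1 : ℝ); linarith
    nlinarith [sq_nonneg (1 + B)]
  have hw : wiener f ≤ Real.sqrt (4 * Real.log (1 + l)) * A + Real.sqrt (2 * Real.pi) := by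
    rw [hsplit]; linarith
  have hpi : Real.pi < 3.15 := Real.pi_lt_d2
  calc wiener f ^ 2 ≤ (Real.sqrt (4 * Real.log (1 + l)) * A + Real.sqrt (2 * Real.pi)) ^ 2 :=
        pow_le_pow_left₀ (wiener_nonneg f) hw 2
    _ ≤ 2 * ((Real.sqrt (4 * Real.log (1 + l)) * A) ^ 2 + Real.sqrt (2 * Real.pi) ^ 2) :=
        add_sq_le
    _ = 8 * Real.log (1 + l) * A ^ 2 + 4 * Real.pi := by
        rw [mul_pow, Real.sq_sqrt (by positivity), Real.sq_sqrt (by positivity)]; ring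
    _ ≤ 8 * (1 + 2 * Real.log (1 + B)) * A ^ 2 + 4 * Real.pi := by gcongr
    _ ≤ _ := by nlinarith [mul_nonneg hlogB (sq_nonneg A), sq_nonneg A]

/-- Only the `H^1` factor of Gagliardo–Nirenberg is estimated trivially. The factor `‖diff h f‖` is
kept, since it carries the smallness as `h → 0`. -/
theorem wiener_diff_sq_le {f : L2R} (hf : InH 1 f) (h : ℝ) :
    wiener (diff h f) ^ 2 ≤ 4 * Real.pi * ‖diff h f‖ * hNorm 1 f := by
  have h1 := hf.diff h
  refine (wiener_sq_le h1.1).2.trans ?_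
  have := mul_le_mul_of_nonneg_left h1.2
    (show 0 ≤ 2 * Real.pi * ‖diff h f‖ by positivity)
  linarith

/-- The square function estimate behind the bound of the remainders of the modified energy. -/
theorem exists_majorant_diff {f : L2R} (hf : InH 1 f) {A B : ℝ} (hA1 : 1 ≤ A) (hB1 : 1 ≤ B)
    (hA : hNorm (1 / 2) f ≤ A) (hB : hNorm 1 f ≤ B) :
    ∃ g : ℝ → ℝ, IntegrableOn g (Set.Ioi 0) ∧ (∀ h, 0 < h → 0 ≤ g h) ∧
      (∀ h, 0 < h → wiener (diff h f) * ‖diff h f‖ / h ^ 2 ≤ g h) ∧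
      ∫ h in Set.Ioi 0, g h ≤ 32 * A ^ 2 * B := by
  -- Up to powers of `A`, the bounds `hB` and `h^{1/2}A` of the `L²` norm of the difference cross at
  -- `h = B⁻²`. With this threshold both ranges of `h` contribute a multiple of `B` to the integral,
  -- and this linear growth in `B` is what the energy argument can afford.
  set δ : ℝ := (B ^ 2)⁻¹ with hδ
  have hB0 : 0 < B := by linarith
  have hA0 : 0 < A := by linarith
  have hδ0 : 0 < δ := by positivity
  -- The squared product is at most `4πB‖diff h f‖³`. Inserting `hB` gives `4πB⁴h³`, and `√(4π) <
  -- 4`; inserting `√2 h^{1/2}A` gives at most `36 B A⁴ h^{3/2}`. Dividing the square roots by `h²`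
  -- leaves powers integrable at `0` and at `∞` respectively.
  set g₁ : ℝ → ℝ := fun h => 4 * B ^ 2 * h ^ (-(1 / 2) : ℝ)
  set g₂ : ℝ → ℝ := fun h => 6 * B ^ (1 / 2 : ℝ) * A ^ 2 * h ^ (-(5 / 4) : ℝ)
  have i₁ : IntegrableOn g₁ (Set.Ioc 0 δ) := by
    have := (intervalIntegral.intervalIntegrable_rpow' (a := 0) (b := δ) (r := -(1 / 2))
      (by norm_num)).const_mul (4 * B ^ 2)
    rwa [intervalIntegrable_iff_integrableOn_Ioc_of_le hδ0.le] at this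
  have i₂ : IntegrableOn g₂ (Set.Ioi δ) :=
    (integrableOn_Ioi_rpow_of_lt (by norm_num) hδ0).const_mul _
  have hbound (h : ℝ) (hh : 0 < h) :
      (wiener (diff h f) * ‖diff h f‖) ^ 2 ≤ 4 * Real.pi * B * ‖diff h f‖ ^ 3 := by
    rw [mul_pow]
    have h1 := wiener_diff_sq_le hf h
    calc wiener (diff h f) ^ 2 * ‖diff h f‖ ^ 2
        ≤ (4 * Real.pi * ‖diff h f‖ * hNorm 1 f) * ‖diff h f‖ ^ 2 := by gcongr
      _ ≤ (4 * Real.pi * ‖diff h f‖ * B) * ‖diff h f‖ ^ 2 := by gcongr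
      _ = _ := by ring
  have hpi : Real.pi < 3.15 := Real.pi_lt_d2
  have b₁ (h : ℝ) (hh : 0 < h) : wiener (diff h f) * ‖diff h f‖ / h ^ 2 ≤ g₁ h := by
    rw [div_le_iff₀ (by positivity)]
    refine le_of_sq_le_sq ?_ (by positivity)
    refine (hbound h hh).trans ?_
    have h1 : ‖diff h f‖ ≤ h * B := by
      have := norm_diff_le_hNorm_one hf h
      rw [abs_of_pos hh] at this
      exact this.trans (by gcongr)
    have h2 : (h ^ (-(1 / 2) : ℝ)) ^ 2 = h⁻¹ := by
      rw [← Real.rpow_natCast, ← Real.rpow_mul hh.le]; norm_num [Real.rpow_neg_one]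
    calc 4 * Real.pi * B * ‖diff h f‖ ^ 3 ≤ 4 * 3.15 * B * (h * B) ^ 3 := by gcongr
      _ ≤ 16 * (B ^ 4 * h ^ 3) := by
          have : 0 < B ^ 4 * h ^ 3 := by positivity
          nlinarith
      _ = _ := by
          simp only [g₁]
          rw [mul_pow, mul_pow, h2]; field_simp; ring
  have b₂ (h : ℝ) (hh : 0 < h) : wiener (diff h f) * ‖diff h f‖ / h ^ 2 ≤ g₂ h := by
    rw [div_le_iff₀ (by positivity)]
    refine le_of_sq_le_sq ?_ (by positivity)
    refine (hbound h hh).trans ?_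
    have h1 : ‖diff h f‖ ≤ Real.sqrt 2 * h ^ (1 / 2 : ℝ) * A := by
      have := norm_diff_le_half (s := 0) (f := f)
        (by simpa using (InH.mono (s := 1 / 2) (by norm_num) hf).1) h
      rw [hNorm_zero, abs_of_pos hh, zero_add] at this
      exact this.trans (by gcongr)
    have h2 : (h ^ (-(5 / 4) : ℝ)) ^ 2 * h ^ 4 = (h ^ (1 / 2 : ℝ)) ^ 3 := by
      rw [← Real.rpow_natCast, ← Real.rpow_natCast, ← Real.rpow_natCast, ← Real.rpow_mul hh.le,
        ← Real.rpow_add hh, ← Real.rpow_mul hh.le]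
      norm_num
    have h3 : (B ^ (1 / 2 : ℝ)) ^ 2 = B := by rw [← Real.sqrt_eq_rpow, Real.sq_sqrt hB0.le]
    have h4 : Real.sqrt 2 ^ 3 ≤ 2.83 := by
      have : Real.sqrt 2 ≤ 1.415 := Real.sqrt_le_iff.2 (by norm_num)
      rw [pow_succ, Real.sq_sqrt (by norm_num)]; linarith
    have h5 : 0 < (h ^ (1 / 2 : ℝ)) ^ 3 := by positivity
    calc 4 * Real.pi * B * ‖diff h f‖ ^ 3
        ≤ 4 * 3.15 * B * (Real.sqrt 2 * h ^ (1 / 2 : ℝ) * A) ^ 3 := by gcongr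
      _ = 4 * 3.15 * B * (Real.sqrt 2 ^ 3 * (h ^ (1 / 2 : ℝ)) ^ 3 * A ^ 3) := by ring
      -- `A³` is raised to `A⁴`, which uses `1 ≤ A`, to make the square root an integer power of
      -- `A`.
      _ ≤ 4 * 3.15 * B * (2.83 * (h ^ (1 / 2 : ℝ)) ^ 3 * A ^ 4) := by
          gcongr
          norm_num
      _ ≤ 36 * B * ((h ^ (1 / 2 : ℝ)) ^ 3 * A ^ 4) := by
          have : 0 < B * ((h ^ (1 / 2 : ℝ)) ^ 3 * A ^ 4) := by positivity
          nlinarith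
      _ = (6 * B ^ (1 / 2 : ℝ) * A ^ 2 * h ^ (-(5 / 4) : ℝ) * h ^ 2) ^ 2 := by
          rw [← h2]
          linear_combination (-36 * A ^ 4 * (h ^ (-(5 / 4) : ℝ)) ^ 2 * h ^ 4) * h3
  have hU : Set.Ioi (0 : ℝ) = Set.Ioc 0 δ ∪ Set.Ioi δ := (Set.Ioc_union_Ioi_eq_Ioi hδ0.le).symm
  have hdisj : Disjoint (Set.Ioc 0 δ) (Set.Ioi δ) := Set.Ioc_disjoint_Ioi le_rfl
  set g : ℝ → ℝ := fun h => if h ≤ δ then g₁ h else g₂ h with hg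
  have e₁ : Set.EqOn g₁ g (Set.Ioc 0 δ) := fun h hh => by simp only [hg, if_pos hh.2]
  have e₂ : Set.EqOn g₂ g (Set.Ioi δ) := fun h hh => by simp only [hg, if_neg (not_le.2 (Set.mem_Ioi.1 hh))]
  have j₁ := i₁.congr_fun e₁ measurableSet_Ioc
  have j₂ := i₂.congr_fun e₂ measurableSet_Ioi
  refine ⟨g, ?_, ?_, ?_, ?_⟩
  · rw [hU]; exact j₁.union j₂
  · intro h hh
    simp only [hg]
    split_ifs
    · positivity
    · positivity
  · intro h hh
    simp only [hg]
    split_ifs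
    · exact b₁ h hh
    · exact b₂ h hh
  · rw [hU, setIntegral_union hdisj measurableSet_Ioi j₁ j₂,
      ← setIntegral_congr_fun measurableSet_Ioc e₁, ← setIntegral_congr_fun measurableSet_Ioi e₂]
    have v₁ : ∫ h in Set.Ioc 0 δ, g₁ h = 8 * B := by
      rw [← intervalIntegral.integral_of_le hδ0.le, intervalIntegral.integral_const_mul,
        integral_rpow (Or.inl (by norm_num)), Real.zero_rpow (by norm_num)]
      have : δ ^ (-(1 / 2) + 1 : ℝ) = B⁻¹ := by
        rw [show (-(1 / 2) + 1 : ℝ) = 1 / 2 by norm_num, ← Real.sqrt_eq_rpow, hδ, Real.sqrt_inv,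
          Real.sqrt_sq hB0.le]
      rw [this]; field_simp; ring
    have v₂ : ∫ h in Set.Ioi δ, g₂ h = 24 * A ^ 2 * B := by
      rw [integral_const_mul, integral_Ioi_rpow_of_lt (by norm_num) hδ0]
      have : δ ^ (-(5 / 4) + 1 : ℝ) = B ^ (1 / 2 : ℝ) := by
        rw [hδ, Real.inv_rpow (by positivity), ← Real.rpow_natCast, ← Real.rpow_mul hB0.le,
          ← Real.rpow_neg hB0.le]
        norm_num
      have h3 : B ^ (1 / 2 : ℝ) * B ^ (1 / 2 : ℝ) = B := by
        rw [← Real.sqrt_eq_rpow, Real.mul_self_sqrt hB0.le]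
      rw [this]
      linear_combination (24 * A ^ 2) * h3
    rw [v₁, v₂]
    have : B ≤ A ^ 2 * B := le_mul_of_one_le_left hB0.le (one_le_pow₀ hA1)
    linarith

/-! ### `|D|` as a superposition of differences -/

/-- The symbol of the truncation of `|D|` to differences with step at least `ε`. -/
def kerSymbol (ε ξ : ℝ) : ℝ := ∫ h in Set.Ioi ε, ‖diffSymbol h ξ‖ ^ 2 / h ^ 2

theorem continuous_diffSymbol_uncurry : Continuous fun p : ℝ × ℝ => diffSymbol p.1 p.2 := by
  unfold diffSymbol transSymbol; fun_prop

theorem measurable_ker : Measurable fun p : ℝ × ℝ => ‖diffSymbol p.1 p.2‖ ^ 2 / p.1 ^ 2 :=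
  (continuous_diffSymbol_uncurry.norm.pow 2).measurable.div (measurable_fst.pow_const 2)

theorem integrableOn_inv_sq {ε : ℝ} (hε : 0 < ε) :
    IntegrableOn (fun h : ℝ => (h ^ 2)⁻¹) (Set.Ioi ε) := by
  have := integrableOn_Ioi_rpow_of_lt (a := -2) (by norm_num) hε
  refine this.congr_fun (fun h hh => ?_) measurableSet_Ioi
  have h0 : (0 : ℝ) < h := hε.trans hh
  simp only
  rw [Real.rpow_neg h0.le]; norm_num

theorem integral_inv_sq {ε : ℝ} (hε : 0 < ε) : ∫ h in Set.Ioi ε, (h ^ 2)⁻¹ = ε⁻¹ := by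
  have := integral_Ioi_rpow_of_lt (a := -2) (by norm_num) hε
  have h2 : ∫ h in Set.Ioi ε, h ^ (-2 : ℝ) = ∫ h in Set.Ioi ε, (h ^ 2)⁻¹ := by
    refine setIntegral_congr_fun measurableSet_Ioi fun h hh => ?_
    have h0 : (0 : ℝ) < h := hε.trans hh
    rw [Real.rpow_neg h0.le]; norm_num
  rw [← h2, this]
  norm_num [Real.rpow_neg_one]

theorem ker_le (h ξ : ℝ) : ‖diffSymbol h ξ‖ ^ 2 / h ^ 2 ≤ 4 * (h ^ 2)⁻¹ := by
  rw [div_eq_mul_inv]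
  have := norm_diffSymbol_le_two h ξ
  gcongr
  nlinarith [norm_nonneg (diffSymbol h ξ)]

theorem integrableOn_ker (ξ : ℝ) :
    IntegrableOn (fun h => ‖diffSymbol h ξ‖ ^ 2 / h ^ 2) (Set.Ioi 0) := by
  have hm : AEStronglyMeasurable (fun h => ‖diffSymbol h ξ‖ ^ 2 / h ^ 2) volume :=
    (measurable_ker.comp (measurable_id.prodMk measurable_const)).aestronglyMeasurable
  rw [← Set.Ioc_union_Ioi_eq_Ioi (zero_le_one' ℝ)]
  refine IntegrableOn.union ?_ ?_
  · refine Measure.integrableOn_of_bounded (M := (2 * Real.pi * |ξ|) ^ 2) (by simp) hm ?_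
    refine (ae_restrict_iff' measurableSet_Ioc).2 (Eventually.of_forall fun h hh => ?_)
    have h0 : 0 < h := hh.1
    rw [Real.norm_of_nonneg (by positivity), div_le_iff₀ (by positivity), ← mul_pow]
    refine pow_le_pow_left₀ (norm_nonneg _) ((norm_diffSymbol_le h ξ).trans_eq ?_) 2
    rw [abs_of_pos h0]; ring
  · refine Integrable.mono' ((integrableOn_inv_sq one_pos).const_mul 4) hm.restrict ?_
    refine Eventually.of_forall fun h => ?_
    rw [Real.norm_of_nonneg (by positivity)]
    exact ker_le h ξ

theorem kerSymbol_nonneg (ε ξ : ℝ) : 0 ≤ kerSymbol ε ξ :=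
  integral_nonneg fun _ => by positivity

theorem kerSymbol_le {ε : ℝ} (hε : 0 < ε) (ξ : ℝ) : kerSymbol ε ξ ≤ 4 * ε⁻¹ := by
  rw [← integral_inv_sq hε, ← integral_const_mul]
  exact setIntegral_mono ((integrableOn_ker ξ).mono_set (Set.Ioi_subset_Ioi hε.le))
    ((integrableOn_inv_sq hε).const_mul 4) fun h => ker_le h ξ

theorem kerSymbol_le_zero {ε : ℝ} (hε : 0 ≤ ε) (ξ : ℝ) : kerSymbol ε ξ ≤ kerSymbol 0 ξ :=
  setIntegral_mono_set (integrableOn_ker ξ) (Eventually.of_forall fun _ => by positivity)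
    (Set.Ioi_subset_Ioi hε).eventuallyLE

theorem measurable_kerSymbol (ε : ℝ) : Measurable (kerSymbol ε) := by
  have h1 : StronglyMeasurable fun p : ℝ × ℝ => ‖diffSymbol p.1 p.2‖ ^ 2 / p.1 ^ 2 :=
    measurable_ker.stronglyMeasurable
  exact (h1.integral_prod_left' (μ := volume.restrict (Set.Ioi ε))).measurable

theorem aesm_kerSymbol (ε : ℝ) :
    AEStronglyMeasurable (fun ξ => (kerSymbol ε ξ : ℂ)) (volume : Measure ℝ) :=
  (Complex.measurable_ofReal.comp (measurable_kerSymbol ε)).aestronglyMeasurable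

/-- The integrand depends on `h|ξ|` apart from the weight `h⁻²`, so the substitution `h ↦ |ξ|h`
gives homogeneity of degree one: the full kernel is a multiple of `|D|`. -/
theorem kerSymbol_zero_eq (ξ : ℝ) : kerSymbol 0 ξ = |ξ| * kerSymbol 0 1 := by
  have hs (h : ℝ) : ‖diffSymbol h ξ‖ ^ 2 = ‖diffSymbol h |ξ|‖ ^ 2 := by
    rw [norm_diffSymbol_sq, norm_diffSymbol_sq]
    rcases abs_cases ξ with ⟨e, _⟩ | ⟨e, _⟩
    · rw [e]
    · rw [e, mul_neg, mul_neg, Real.cos_neg]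
  rcases eq_or_ne ξ 0 with rfl | hξ
  · simp [kerSymbol, diffSymbol, transSymbol]
  · have hp : 0 < |ξ| := abs_pos.2 hξ
    have := integral_comp_mul_left_Ioi (fun h => ‖diffSymbol h 1‖ ^ 2 / h ^ 2) 0 hp
    rw [mul_zero, smul_eq_mul] at this
    have h2 : ∫ h in Set.Ioi (0 : ℝ), ‖diffSymbol (|ξ| * h) 1‖ ^ 2 / (|ξ| * h) ^ 2 =
        (|ξ| ^ 2)⁻¹ * kerSymbol 0 ξ := by
      rw [kerSymbol, ← integral_const_mul]
      refine integral_congr_ae (Eventually.of_forall fun h => ?_)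
      simp only [hs h, norm_diffSymbol_sq, mul_pow, mul_one, mul_comm |ξ| h]
      rw [div_eq_mul_inv, mul_inv]; ring
    rw [h2] at this
    change _ = |ξ|⁻¹ * kerSymbol 0 1 at this
    field_simp at this
    linarith

theorem kerSymbol_zero_one_pos : 0 < kerSymbol 0 1 := by
  refine (setIntegral_pos_iff_support_of_nonneg_ae (Eventually.of_forall fun _ => by positivity)
    (integrableOn_ker 1)).2 ?_
  -- On `(1/4, 1/2)` the cosine of `2πh` is nonpositive, so the squared modulus of the symbol is at
  -- least `2` there.
  refine lt_of_lt_of_le (b := volume (Set.Ioo (1 / 4 : ℝ) (1 / 2))) (by simp; norm_num)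
    (measure_mono fun h hh => ⟨?_, ?_⟩)
  · have h0 : 0 < h := by linarith [hh.1]
    rw [Function.mem_support]
    have hc : Real.cos (2 * Real.pi * (h * 1)) ≤ 0 := by
      have := Real.pi_pos
      refine Real.cos_nonpos_of_pi_div_two_le_of_le ?_ ?_ <;> nlinarith [hh.1, hh.2]
    have : 0 < ‖diffSymbol h 1‖ ^ 2 := by rw [norm_diffSymbol_sq]; linarith
    positivity
  · exact Set.mem_Ioi.2 (by linarith [hh.1])

theorem tendsto_kerSymbol (ξ : ℝ) :
    Tendsto (fun n : ℕ => kerSymbol (1 / ((n : ℝ) + 1)) ξ) atTop (𝓝 (kerSymbol 0 ξ)) := by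
  have hU : (⋃ n : ℕ, Set.Ioi (1 / ((n : ℝ) + 1))) = Set.Ioi 0 := by
    ext h
    simp only [Set.mem_iUnion, Set.mem_Ioi]
    exact ⟨fun ⟨n, hn⟩ => lt_trans (by positivity) hn, fun hh => exists_nat_one_div_lt hh⟩
  have := tendsto_setIntegral_of_monotone (μ := volume)
    (s := fun n : ℕ => Set.Ioi (1 / ((n : ℝ) + 1))) (fun _ => measurableSet_Ioi)
    (fun n m hnm => Set.Ioi_subset_Ioi (one_div_le_one_div_of_le (by positivity)
      (by have : (n : ℝ) ≤ m := by exact_mod_cast hnm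
          linarith)))
    (f := fun h => ‖diffSymbol h ξ‖ ^ 2 / h ^ 2) (by rw [hU]; exact integrableOn_ker ξ)
  rwa [hU] at this

/-- The bilinear form of the truncated operator in terms of differences. -/
theorem inner_fmul_kerSymbol {ε : ℝ} (hε : 0 < ε) (f g : L2R) :
    IntegrableOn (fun h => (((h ^ 2)⁻¹ : ℝ) : ℂ) * inner ℂ (diff h f) (diff h g)) (Set.Ioi ε) ∧
    inner ℂ f (fmul (fun ξ => (kerSymbol ε ξ : ℂ)) g) =
      ∫ h in Set.Ioi ε, (((h ^ 2)⁻¹ : ℝ) : ℂ) * inner ℂ (diff h f) (diff h g) := by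
  set P : ℝ → ℂ := fun ξ => (starRingEnd ℂ) ((𝓕 f : L2R) ξ) * (𝓕 g : L2R) ξ with hP
  have hPi : Integrable P := by
    have := L2.integrable_inner (𝕜 := ℂ) (𝓕 f : L2R) (𝓕 g : L2R)
    refine this.congr (Eventually.of_forall fun ξ => ?_)
    simp only [hP, RCLike.inner_apply]; ring
  set F : ℝ × ℝ → ℂ := fun p => ((‖diffSymbol p.1 p.2‖ ^ 2 / p.1 ^ 2 : ℝ) : ℂ) * P p.2 with hF
  -- Fubini is justified by the majorant `4h⁻²|P(ξ)|`, integrable because the steps stay away from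
  -- `0`. This is where the truncation at `ε` is used.
  have hFi : Integrable F ((volume.restrict (Set.Ioi ε)).prod volume) := by
    have h1 : Integrable (fun p : ℝ × ℝ => ((4 * (p.1 ^ 2)⁻¹ : ℝ) : ℂ) * P p.2)
        ((volume.restrict (Set.Ioi ε)).prod volume) :=
      Integrable.mul_prod (f := fun h : ℝ => ((4 * (h ^ 2)⁻¹ : ℝ) : ℂ))
        (((integrableOn_inv_sq hε).const_mul 4).ofReal) hPi
    refine h1.mono ?_ (Eventually.of_forall fun p => ?_)
    · exact (Complex.measurable_ofReal.comp measurable_ker).aestronglyMeasurable.mul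
        hPi.1.comp_snd
    · rw [hF, norm_mul, norm_mul _ (P p.2), Complex.norm_real, Complex.norm_real,
        Real.norm_of_nonneg (by positivity), Real.norm_of_nonneg (by positivity)]
      exact mul_le_mul_of_nonneg_right (ker_le _ _) (norm_nonneg _)
  have hin (h : ℝ) : (((h ^ 2)⁻¹ : ℝ) : ℂ) * inner ℂ (diff h f) (diff h g) = ∫ ξ, F (h, ξ) := by
    rw [inner_eq_integral_fourier, ← integral_const_mul]
    refine integral_congr_ae ?_
    filter_upwards [fourier_fmul (memMul_diffSymbol h f), fourier_fmul (memMul_diffSymbol h g)]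
      with ξ h1 h2
    rw [diff_eq_fmul, diff_eq_fmul, h1, h2]
    simp only [hF, hP]
    have : ((‖diffSymbol h ξ‖ ^ 2 : ℝ) : ℂ) = (starRingEnd ℂ) (diffSymbol h ξ) * diffSymbol h ξ := by
      rw [mul_comm, Complex.mul_conj, Complex.normSq_eq_norm_sq]
    rw [div_eq_mul_inv, Complex.ofReal_mul, this, map_mul]; ring
  simp only [hin]
  refine ⟨hFi.integral_prod_left, ?_⟩
  have hk : MemMul (fun ξ => (kerSymbol ε ξ : ℂ)) g :=
    (MemMul.of_bounded (C := 4 * ε⁻¹) (aesm_kerSymbol ε) (fun ξ => by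
      rw [Complex.norm_real, Real.norm_of_nonneg (kerSymbol_nonneg ε ξ)]
      exact kerSymbol_le hε ξ) g).1
  rw [inner_eq_integral_fourier, integral_integral_swap hFi]
  refine integral_congr_ae ?_
  filter_upwards [fourier_fmul hk] with ξ h1
  simp only [h1, hF]
  rw [integral_mul_const, integral_complex_ofReal, ← kerSymbol]
  simp only [hP]; ring

/-! ### Superposition operators with `C^{1,1}` nonlinearities -/

/-- Quantitative local `C^{1,1}` regularity of a map `F : ℂ → ℂ` with real differential `G`. -/
structure IsC11 (F : ℂ → ℂ) (G : ℂ → ℂ → ℂ) (K : ℝ → ℝ) : Prop where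
  cont : Continuous F
  cont' : Continuous fun p : ℂ × ℂ => G p.1 p.2
  zero : F 0 = 0
  lip : ∀ {R : ℝ} {a b : ℂ}, ‖a‖ ≤ R → ‖b‖ ≤ R → ‖F a - F b‖ ≤ K R * ‖a - b‖
  bound : ∀ {R : ℝ} {a : ℂ} (z : ℂ), ‖a‖ ≤ R → ‖G a z‖ ≤ K R * ‖z‖
  map_add : ∀ a z w : ℂ, G a (z + w) = G a z + G a w
  map_smul : ∀ (a : ℂ) (r : ℝ) (z : ℂ), G a (r * z) = r * G a z
  lip' : ∀ {R : ℝ} {a b : ℂ} (z : ℂ), ‖a‖ ≤ R → ‖b‖ ≤ R → ‖G a z - G b z‖ ≤ K R * ‖a - b‖ * ‖z‖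
  taylor : ∀ {R : ℝ} {a b : ℂ}, ‖a‖ ≤ R → ‖b‖ ≤ R →
    ‖F a - F b - G b (a - b)‖ ≤ K R * ‖a - b‖ ^ 2
  nonneg : ∀ {R : ℝ}, 0 ≤ R → 0 ≤ K R

theorem IsC11.map_sub {F : ℂ → ℂ} {G : ℂ → ℂ → ℂ} {K : ℝ → ℝ} (hF : IsC11 F G K) (a z w : ℂ) :
    G a (z - w) = G a z - G a w := by
  rw [eq_sub_iff_add_eq, ← hF.map_add, sub_add_cancel]

/-- `|z|²`. -/
def sqAbs (z : ℂ) : ℂ := ((‖z‖ ^ 2 : ℝ) : ℂ)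
/-- The differential of `|z|²`. -/
def sqAbs' (a z : ℂ) : ℂ := ((2 * ((starRingEnd ℂ) a * z).re : ℝ) : ℂ)
/-- `|z|³`. -/
def cubeAbs (z : ℂ) : ℂ := ((‖z‖ ^ 3 : ℝ) : ℂ)
/-- The differential of `|z|³`. -/
def cubeAbs' (a z : ℂ) : ℂ := ((3 * ‖a‖ * ((starRingEnd ℂ) a * z).re : ℝ) : ℂ)
/-- `z|z|³`. -/
def quartic (z : ℂ) : ℂ := z * (‖z‖ : ℂ) ^ 3
/-- The differential of `z|z|³`. -/
def quartic' (a z : ℂ) : ℂ := cubeAbs a * z + cubeAbs' a z * a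

theorem quartic_eq (z : ℂ) : quartic z = cubeAbs z * z := by
  rw [quartic, cubeAbs]; push_cast; ring

theorem abs_re_conj_mul_le (a z : ℂ) : |((starRingEnd ℂ) a * z).re| ≤ ‖a‖ * ‖z‖ := by
  refine (Complex.abs_re_le_norm _).trans_eq ?_
  rw [norm_mul, RCLike.norm_conj]

/-- Polarization. It makes the second-order Taylor expansion of `|z|²` exact and, multiplied by a
power of the modulus, reduces that of `|z|³` to real algebra. -/
theorem two_re_conj_mul_sub (a b : ℂ) :
    2 * ((starRingEnd ℂ) b * (a - b)).re = ‖a‖ ^ 2 - ‖b‖ ^ 2 - ‖a - b‖ ^ 2 := by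
  rw [← Complex.normSq_eq_norm_sq, ← Complex.normSq_eq_norm_sq, ← Complex.normSq_eq_norm_sq,
    Complex.normSq_apply, Complex.normSq_apply, Complex.normSq_apply]
  simp; ring

theorem norm_sqAbs'_le (a z : ℂ) : ‖sqAbs' a z‖ ≤ 2 * ‖a‖ * ‖z‖ := by
  rw [sqAbs', Complex.norm_real, Real.norm_eq_abs, abs_mul, abs_two, mul_assoc]
  exact mul_le_mul_of_nonneg_left (abs_re_conj_mul_le a z) zero_le_two

theorem norm_cubeAbs'_le (a z : ℂ) : ‖cubeAbs' a z‖ ≤ 3 * ‖a‖ ^ 2 * ‖z‖ := by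
  rw [cubeAbs', Complex.norm_real, Real.norm_eq_abs, abs_mul, abs_of_nonneg (by positivity)]
  calc _ ≤ 3 * ‖a‖ * (‖a‖ * ‖z‖) :=
        mul_le_mul_of_nonneg_left (abs_re_conj_mul_le a z) (by positivity)
    _ = _ := by ring

theorem norm_cubeAbs (a : ℂ) : ‖cubeAbs a‖ = ‖a‖ ^ 3 := by
  rw [cubeAbs, Complex.norm_real, Real.norm_of_nonneg (by positivity)]

theorem norm_cubeAbs_sub_le {R : ℝ} {a b : ℂ} (ha : ‖a‖ ≤ R) (hb : ‖b‖ ≤ R) :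
    ‖cubeAbs a - cubeAbs b‖ ≤ 3 * R ^ 2 * ‖a - b‖ := by
  have hR : 0 ≤ R := (norm_nonneg a).trans ha
  rw [cubeAbs, cubeAbs, ← Complex.ofReal_sub, Complex.norm_real, Real.norm_eq_abs,
    show ‖a‖ ^ 3 - ‖b‖ ^ 3 = (‖a‖ ^ 2 + ‖a‖ * ‖b‖ + ‖b‖ ^ 2) * (‖a‖ - ‖b‖) by ring, abs_mul,
    abs_of_nonneg (by positivity)]
  refine mul_le_mul ?_ (abs_norm_sub_norm_le a b) (abs_nonneg _) (by positivity)
  have h1 : ‖a‖ ^ 2 ≤ R ^ 2 := by gcongr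
  have h2 : ‖b‖ ^ 2 ≤ R ^ 2 := by gcongr
  have h3 : ‖a‖ * ‖b‖ ≤ R ^ 2 := by rw [sq]; gcongr
  linarith

theorem norm_cubeAbs'_sub_le {R : ℝ} {a b : ℂ} (z : ℂ) (ha : ‖a‖ ≤ R) (hb : ‖b‖ ≤ R) :
    ‖cubeAbs' a z - cubeAbs' b z‖ ≤ 6 * R * ‖a - b‖ * ‖z‖ := by
  have hR : 0 ≤ R := (norm_nonneg a).trans ha
  have h : 3 * ‖a‖ * ((starRingEnd ℂ) a * z).re - 3 * ‖b‖ * ((starRingEnd ℂ) b * z).re =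
      3 * (‖a‖ - ‖b‖) * ((starRingEnd ℂ) a * z).re +
        3 * ‖b‖ * ((starRingEnd ℂ) (a - b) * z).re := by
    rw [map_sub, sub_mul, Complex.sub_re]; ring
  rw [cubeAbs', cubeAbs', ← Complex.ofReal_sub, Complex.norm_real, h]
  refine (norm_add_le _ _).trans ?_
  rw [Real.norm_eq_abs, Real.norm_eq_abs, abs_mul, abs_mul, abs_mul, abs_mul, abs_norm]
  have h1 := mul_le_mul (abs_norm_sub_norm_le a b) ((abs_re_conj_mul_le a z).trans
    (mul_le_mul_of_nonneg_right ha (norm_nonneg z))) (abs_nonneg _) (norm_nonneg _)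
  have h2 := mul_le_mul hb (abs_re_conj_mul_le (a - b) z) (abs_nonneg _) hR
  have h3 : |(3 : ℝ)| = 3 := abs_of_pos three_pos
  rw [h3]; nlinarith

theorem norm_cubeAbs_taylor_le {R : ℝ} {a b : ℂ} (ha : ‖a‖ ≤ R) (hb : ‖b‖ ≤ R) :
    ‖cubeAbs a - cubeAbs b - cubeAbs' b (a - b)‖ ≤ 3 * R * ‖a - b‖ ^ 2 := by
  -- The Taylor remainder is a sum of two nonnegative terms, each visibly quadratic in `a - b`; no
  -- second derivative at `0` is involved.
  have h : ‖a‖ ^ 3 - ‖b‖ ^ 3 - 3 * ‖b‖ * ((starRingEnd ℂ) b * (a - b)).re =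
      (‖a‖ - ‖b‖) ^ 2 * (‖a‖ + ‖b‖ / 2) + 3 / 2 * ‖b‖ * ‖a - b‖ ^ 2 := by
    linear_combination (-3 / 2 * ‖b‖) * two_re_conj_mul_sub a b
  rw [cubeAbs, cubeAbs, cubeAbs', ← Complex.ofReal_sub, ← Complex.ofReal_sub, Complex.norm_real,
    h, Real.norm_of_nonneg (by positivity)]
  have h1 : (‖a‖ - ‖b‖) ^ 2 ≤ ‖a - b‖ ^ 2 := by
    rw [← sq_abs]; gcongr; exact abs_norm_sub_norm_le a b
  calc _ ≤ ‖a - b‖ ^ 2 * (R + R / 2) + 3 / 2 * R * ‖a - b‖ ^ 2 := by gcongr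
    _ = _ := by ring

theorem isC11_sqAbs : IsC11 sqAbs sqAbs' fun R => 2 * R + 2 where
  cont := by unfold sqAbs; fun_prop
  cont' := by unfold sqAbs'; fun_prop
  zero := by simp [sqAbs]
  lip {R a b} ha hb := by
    have hR : 0 ≤ R := (norm_nonneg a).trans ha
    rw [sqAbs, sqAbs, ← Complex.ofReal_sub, Complex.norm_real, Real.norm_eq_abs,
      show ‖a‖ ^ 2 - ‖b‖ ^ 2 = (‖a‖ + ‖b‖) * (‖a‖ - ‖b‖) by ring, abs_mul,
      abs_of_nonneg (by positivity)]
    exact mul_le_mul (by linarith) (abs_norm_sub_norm_le a b) (abs_nonneg _) (by positivity)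
  bound {R a} z ha := (norm_sqAbs'_le a z).trans (by gcongr; linarith)
  map_add a z w := by simp only [sqAbs', mul_add, Complex.add_re]; push_cast; ring
  map_smul a r z := by
    simp only [sqAbs', ← mul_assoc, mul_comm _ (r : ℂ)]
    rw [mul_assoc (r : ℂ), Complex.re_ofReal_mul]; push_cast; ring
  lip' {R a b} z ha hb := by
    have hR : 0 ≤ R := (norm_nonneg a).trans ha
    have : sqAbs' a z - sqAbs' b z = sqAbs' (a - b) z := by
      simp only [sqAbs', map_sub, sub_mul, Complex.sub_re]; push_cast; ring
    rw [this]
    refine (norm_sqAbs'_le _ z).trans ?_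
    gcongr; linarith
  taylor {R a b} ha hb := by
    have hR : 0 ≤ R := (norm_nonneg a).trans ha
    rw [sqAbs, sqAbs, sqAbs', two_re_conj_mul_sub, ← Complex.ofReal_sub, ← Complex.ofReal_sub,
      Complex.norm_real, sub_sub_cancel, Real.norm_of_nonneg (by positivity)]
    nlinarith [sq_nonneg ‖a - b‖]
  nonneg hR := by positivity

theorem isC11_cubeAbs : IsC11 cubeAbs cubeAbs' fun R => 3 * R ^ 2 + 6 * R where
  cont := by unfold cubeAbs; fun_prop
  cont' := by unfold cubeAbs'; fun_prop
  zero := by simp [cubeAbs]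
  lip {R a b} ha hb := (norm_cubeAbs_sub_le ha hb).trans (by
    have hR : 0 ≤ R := (norm_nonneg a).trans ha
    gcongr; linarith)
  bound {R a} z ha := (norm_cubeAbs'_le a z).trans (by
    have hR : 0 ≤ R := (norm_nonneg a).trans ha
    have : ‖a‖ ^ 2 ≤ R ^ 2 := by gcongr
    gcongr; linarith)
  map_add a z w := by simp only [cubeAbs', mul_add, Complex.add_re]; push_cast; ring
  map_smul a r z := by
    simp only [cubeAbs', ← mul_assoc, mul_comm _ (r : ℂ)]
    rw [mul_assoc (r : ℂ), Complex.re_ofReal_mul]; push_cast; ring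
  lip' {R a b} z ha hb := (norm_cubeAbs'_sub_le z ha hb).trans (by
    have hR : 0 ≤ R := (norm_nonneg a).trans ha
    gcongr; nlinarith)
  taylor {R a b} ha hb := (norm_cubeAbs_taylor_le ha hb).trans (by
    have hR : 0 ≤ R := (norm_nonneg a).trans ha
    gcongr; nlinarith)
  nonneg hR := by positivity

theorem isC11_quartic : IsC11 quartic quartic' fun R => 4 * R ^ 3 + 12 * R ^ 2 where
  cont := by unfold quartic; fun_prop
  cont' := by unfold quartic' cubeAbs cubeAbs'; fun_prop
  zero := by simp [quartic]
  lip {R a b} ha hb := by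
    have hR : 0 ≤ R := (norm_nonneg a).trans ha
    have : quartic a - quartic b = cubeAbs a * (a - b) + (cubeAbs a - cubeAbs b) * b := by
      rw [quartic_eq, quartic_eq]; ring
    rw [this]
    refine (norm_add_le _ _).trans ?_
    rw [norm_mul, norm_mul, norm_cubeAbs]
    calc _ ≤ R ^ 3 * ‖a - b‖ + 3 * R ^ 2 * ‖a - b‖ * R := by
          gcongr; exact norm_cubeAbs_sub_le ha hb
      _ = 4 * R ^ 3 * ‖a - b‖ := by ring
      _ ≤ _ := by gcongr; nlinarith [sq_nonneg R]
  bound {R a} z ha := by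
    have hR : 0 ≤ R := (norm_nonneg a).trans ha
    refine (norm_add_le _ _).trans ?_
    rw [norm_mul, norm_mul, norm_cubeAbs]
    calc _ ≤ ‖a‖ ^ 3 * ‖z‖ + 3 * ‖a‖ ^ 2 * ‖z‖ * ‖a‖ := by
          gcongr; exact norm_cubeAbs'_le a z
      _ ≤ R ^ 3 * ‖z‖ + 3 * R ^ 2 * ‖z‖ * R := by gcongr
      _ = 4 * R ^ 3 * ‖z‖ := by ring
      _ ≤ _ := by gcongr; nlinarith [sq_nonneg R]
  map_add a z w := by
    simp only [quartic', isC11_cubeAbs.map_add]; ring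
  map_smul a r z := by
    simp only [quartic', isC11_cubeAbs.map_smul]; ring
  lip' {R a b} z ha hb := by
    have hR : 0 ≤ R := (norm_nonneg a).trans ha
    have : quartic' a z - quartic' b z = (cubeAbs a - cubeAbs b) * z + cubeAbs' a z * (a - b) +
        (cubeAbs' a z - cubeAbs' b z) * b := by
      simp only [quartic']; ring
    rw [this]
    refine (norm_add₃_le).trans ?_
    rw [norm_mul, norm_mul, norm_mul]
    have h1 := norm_cubeAbs_sub_le ha hb
    have h2 := norm_cubeAbs'_le a z
    have h3 := norm_cubeAbs'_sub_le z ha hb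
    calc _ ≤ 3 * R ^ 2 * ‖a - b‖ * ‖z‖ + 3 * ‖a‖ ^ 2 * ‖z‖ * ‖a - b‖ +
          6 * R * ‖a - b‖ * ‖z‖ * R := by gcongr
      _ ≤ 3 * R ^ 2 * ‖a - b‖ * ‖z‖ + 3 * R ^ 2 * ‖z‖ * ‖a - b‖ +
          6 * R * ‖a - b‖ * ‖z‖ * R := by gcongr
      _ = 12 * R ^ 2 * ‖a - b‖ * ‖z‖ := by ring
      _ ≤ _ := by gcongr; nlinarith [pow_nonneg hR 3]
  taylor {R a b} ha hb := by
    have hR : 0 ≤ R := (norm_nonneg a).trans ha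
    have : quartic a - quartic b - quartic' b (a - b) =
        (cubeAbs a - cubeAbs b - cubeAbs' b (a - b)) * b + (cubeAbs a - cubeAbs b) * (a - b) := by
      rw [quartic_eq, quartic_eq, quartic']; ring
    rw [this]
    refine (norm_add_le _ _).trans ?_
    rw [norm_mul, norm_mul]
    have h1 := norm_cubeAbs_sub_le ha hb
    have h2 := norm_cubeAbs_taylor_le ha hb
    calc _ ≤ 3 * R * ‖a - b‖ ^ 2 * R + 3 * R ^ 2 * ‖a - b‖ * ‖a - b‖ := by gcongr
      _ = 6 * R ^ 2 * ‖a - b‖ ^ 2 := by ring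
      _ ≤ _ := by gcongr; nlinarith [pow_nonneg hR 3, sq_nonneg R]
  nonneg hR := by positivity

open Classical in
/-- The `L²` function `F(u)`, or `0` if it is not square integrable. -/
def nl (F : ℂ → ℂ) (u : L2R) : L2R :=
  if h : MemLp (fun x => F (u x)) 2 volume then h.toLp else 0

open Classical in
/-- The `L²` function `G(u, v)`, or `0` if it is not square integrable. -/
def nl₂ (G : ℂ → ℂ → ℂ) (u v : L2R) : L2R :=
  if h : MemLp (fun x => G (u x) (v x)) 2 volume then h.toLp else 0

/-- `|u| ≤ R` almost everywhere. -/
def AEBound (u : L2R) (R : ℝ) : Prop := ∀ᵐ x, ‖u x‖ ≤ R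

theorem AEBound.mono {u : L2R} {R R' : ℝ} (h : AEBound u R) (hR : R ≤ R') : AEBound u R' :=
  Eventually.mono h fun _ hx => hx.trans hR

theorem AEBound.nonneg {u : L2R} {R : ℝ} (h : AEBound u R) : 0 ≤ R := by
  obtain ⟨x, hx⟩ := Eventually.exists h
  exact (norm_nonneg _).trans hx

section
variable {F : ℂ → ℂ} {G : ℂ → ℂ → ℂ} {K : ℝ → ℝ}

theorem IsC11.nl_ae (hF : IsC11 F G K) {u : L2R} {R : ℝ} (hu : AEBound u R) :
    (nl F u : ℝ → ℂ) =ᵐ[volume] fun x => F (u x) := by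
  have h : MemLp (fun x => F (u x)) 2 volume := by
    refine MemLp.of_le_mul (c := K R) (Lp.memLp u)
      (hF.cont.comp_aestronglyMeasurable (Lp.aestronglyMeasurable u)) ?_
    filter_upwards [hu] with x hx
    have := hF.lip (b := 0) hx (by simpa using hu.nonneg)
    rwa [hF.zero, sub_zero, sub_zero] at this
  rw [nl, dif_pos h]; exact h.coeFn_toLp

theorem IsC11.nl₂_ae (hF : IsC11 F G K) {u : L2R} {R : ℝ} (hu : AEBound u R) (v : L2R) :
    (nl₂ G u v : ℝ → ℂ) =ᵐ[volume] fun x => G (u x) (v x) := by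
  have h : MemLp (fun x => G (u x) (v x)) 2 volume := by
    refine MemLp.of_le_mul (c := K R) (Lp.memLp v)
      (hF.cont'.comp_aestronglyMeasurable
        ((Lp.aestronglyMeasurable u).prodMk (Lp.aestronglyMeasurable v))) ?_
    filter_upwards [hu] with x hx
    exact hF.bound _ hx
  rw [nl₂, dif_pos h]; exact h.coeFn_toLp

theorem IsC11.norm_nl_sub_le (hF : IsC11 F G K) {u w : L2R} {R : ℝ} (hu : AEBound u R)
    (hw : AEBound w R) : ‖nl F u - nl F w‖ ≤ K R * ‖u - w‖ := by
  refine Lp.norm_le_mul_norm_of_ae_le_mul ?_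
  filter_upwards [Lp.coeFn_sub (nl F u) (nl F w), Lp.coeFn_sub u w, hF.nl_ae hu, hF.nl_ae hw, hu,
    hw] with x h1 h2 h3 h4 h5 h6
  rw [h1, h2, Pi.sub_apply, Pi.sub_apply, h3, h4]
  exact hF.lip h5 h6

theorem IsC11.nl_zero (hF : IsC11 F G K) : nl F 0 = 0 := by
  have h0 : AEBound (0 : L2R) 0 := by
    filter_upwards [Lp.coeFn_zero ℂ 2 (volume : Measure ℝ)] with x hx
    rw [hx]; simp
  refine Lp.ext ?_
  filter_upwards [hF.nl_ae h0, Lp.coeFn_zero ℂ 2 (volume : Measure ℝ)] with x h1 h2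
  rw [h1, h2]; exact hF.zero

theorem IsC11.norm_nl_le (hF : IsC11 F G K) {u : L2R} {R : ℝ} (hu : AEBound u R) :
    ‖nl F u‖ ≤ K R * ‖u‖ := by
  have h0 : AEBound (0 : L2R) R := by
    filter_upwards [Lp.coeFn_zero ℂ 2 (volume : Measure ℝ)] with x hx
    rw [hx]; simpa using hu.nonneg
  simpa [hF.nl_zero] using hF.norm_nl_sub_le hu h0

theorem IsC11.norm_nl₂_sub_right_le (hF : IsC11 F G K) {u : L2R} {R : ℝ} (hu : AEBound u R)
    (v w : L2R) : ‖nl₂ G u v - nl₂ G u w‖ ≤ K R * ‖v - w‖ := by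
  refine Lp.norm_le_mul_norm_of_ae_le_mul ?_
  filter_upwards [Lp.coeFn_sub (nl₂ G u v) (nl₂ G u w), Lp.coeFn_sub v w, hF.nl₂_ae hu v,
    hF.nl₂_ae hu w, hu] with x h1 h2 h3 h4 h5
  rw [h1, h2, Pi.sub_apply, Pi.sub_apply, h3, h4, ← hF.map_sub]
  exact hF.bound _ h5

theorem IsC11.norm_nl₂_sub_left_le (hF : IsC11 F G K) {u w : L2R} {R S : ℝ} (hu : AEBound u R)
    (hw : AEBound w R) (hS : AEBound (u - w) S) (v : L2R) :
    ‖nl₂ G u v - nl₂ G w v‖ ≤ K R * S * ‖v‖ := by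
  refine Lp.norm_le_mul_norm_of_ae_le_mul ?_
  filter_upwards [Lp.coeFn_sub (nl₂ G u v) (nl₂ G w v), Lp.coeFn_sub u w, hF.nl₂_ae hu v,
    hF.nl₂_ae hw v, hu, hw, hS] with x h1 h2 h3 h4 h5 h6 h7
  rw [h1, Pi.sub_apply, h3, h4]
  rw [h2, Pi.sub_apply] at h7
  refine (hF.lip' _ h5 h6).trans ?_
  have := hF.nonneg hu.nonneg
  gcongr

theorem IsC11.norm_taylor_le (hF : IsC11 F G K) {u w : L2R} {R S : ℝ} (hu : AEBound u R)
    (hw : AEBound w R) (hS : AEBound (u - w) S) :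
    ‖nl F u - nl F w - nl₂ G w (u - w)‖ ≤ K R * S * ‖u - w‖ := by
  refine Lp.norm_le_mul_norm_of_ae_le_mul ?_
  filter_upwards [Lp.coeFn_sub (nl F u - nl F w) (nl₂ G w (u - w)),
    Lp.coeFn_sub (nl F u) (nl F w), Lp.coeFn_sub u w, hF.nl_ae hu, hF.nl_ae hw,
    hF.nl₂_ae hw (u - w), hu, hw, hS] with x h1 h2 h3 h4 h5 h6 h7 h8 h9
  rw [h1, Pi.sub_apply, h2, Pi.sub_apply, h4, h5, h6]
  rw [h3, Pi.sub_apply] at h9 ⊢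
  refine (hF.taylor h7 h8).trans ?_
  have := hF.nonneg hu.nonneg
  rw [sq, ← mul_assoc]
  gcongr

theorem IsC11.nl₂_smul (hF : IsC11 F G K) {u : L2R} {R : ℝ} (hu : AEBound u R) (r : ℝ) (v : L2R) :
    nl₂ G u (r • v) = r • nl₂ G u v := by
  refine Lp.ext ?_
  filter_upwards [hF.nl₂_ae hu v, hF.nl₂_ae hu (r • v), Lp.coeFn_smul r v,
    Lp.coeFn_smul r (nl₂ G u v)] with x h1 h2 h3 h4
  rw [h2, h3, h4, Pi.smul_apply, Pi.smul_apply, h1, Complex.real_smul, Complex.real_smul,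
    hF.map_smul]

/-- The path `u` is continuous at `t` in the sup norm, locally bounded. -/
structure SupContAt (u : ℝ → L2R) (t R : ℝ) (S : ℝ → ℝ) : Prop where
  bound : ∀ᶠ s in 𝓝 t, AEBound (u s) R
  diff : ∀ᶠ s in 𝓝 t, AEBound (u s - u t) (S s)
  tendsto : Tendsto S (𝓝 t) (𝓝 0)

/-- Small `L²` increments alone do not make the Taylor remainder small in `L²`. Continuity of the
path in sup norm supplies the missing factor: the remainder is at most `K R * S s * ‖u s - u t‖`
with `S s → 0`, hence `o(s - t)`. -/
theorem IsC11.hasDerivAt_nl (hF : IsC11 F G K) {u : ℝ → L2R} {t R : ℝ} {S : ℝ → ℝ} {v : L2R}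
    (hu : SupContAt u t R S) (hd : HasDerivAt u v t) :
    HasDerivAt (fun s => nl F (u s)) (nl₂ G (u t) v) t := by
  have hb : AEBound (u t) R := hu.bound.self_of_nhds
  rw [hasDerivAt_iff_isLittleO] at hd ⊢
  have hO : (fun s => u s - u t) =O[𝓝 t] fun s => s - t := by
    have h1 : (fun s => (s - t) • v) =O[𝓝 t] fun s => s - t := by
      refine Asymptotics.IsBigO.of_bound ‖v‖ (Eventually.of_forall fun s => ?_)
      rw [norm_smul, mul_comm]
    have := hd.isBigO.add h1
    simpa using this
  have e1 : (fun s => nl F (u s) - nl F (u t) - nl₂ G (u t) (u s - u t)) =o[𝓝 t]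
      fun s => s - t := by
    have hS : (fun s => K R * S s * ‖u s - u t‖) =o[𝓝 t] fun s => s - t := by
      have h0 : (fun s => K R * S s) =o[𝓝 t] fun _ => (1 : ℝ) := by
        rw [Asymptotics.isLittleO_one_iff]
        simpa using hu.tendsto.const_mul (K R)
      simpa using h0.mul_isBigO hO.norm_left
    refine Asymptotics.IsBigO.trans_isLittleO (Asymptotics.IsBigO.of_bound 1 ?_) hS
    filter_upwards [hu.bound, hu.diff] with s h1 h2
    rw [one_mul]
    exact (hF.norm_taylor_le h1 hb h2).trans (le_abs_self _)
  have e2 : (fun s => nl₂ G (u t) (u s - u t) - (s - t) • nl₂ G (u t) v) =o[𝓝 t]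
      fun s => s - t := by
    refine Asymptotics.IsBigO.trans_isLittleO (Asymptotics.IsBigO.of_bound (K R) ?_) hd
    refine Eventually.of_forall fun s => ?_
    rw [← hF.nl₂_smul hb]
    exact hF.norm_nl₂_sub_right_le hb _ _
  refine (e1.add e2).congr_left fun s => ?_
  abel

theorem IsC11.continuousAt_nl₂ (hF : IsC11 F G K) {u v : ℝ → L2R} {t R : ℝ} {S : ℝ → ℝ}
    (hu : SupContAt u t R S) (hv : ContinuousAt v t) :
    ContinuousAt (fun s => nl₂ G (u s) (v s)) t := by
  have hb : AEBound (u t) R := hu.bound.self_of_nhds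
  rw [ContinuousAt, tendsto_iff_norm_sub_tendsto_zero]
  have h1 : Tendsto (fun s => K R * ‖v s - v t‖ + K R * S s * ‖v t‖) (𝓝 t) (𝓝 0) := by
    have := ((tendsto_iff_norm_sub_tendsto_zero.1 hv).const_mul (K R)).add
      ((hu.tendsto.const_mul (K R)).mul_const ‖v t‖)
    simpa using this
  refine squeeze_zero' (Eventually.of_forall fun s => norm_nonneg _) ?_ h1
  filter_upwards [hu.bound, hu.diff] with s h2 h3
  have : nl₂ G (u s) (v s) - nl₂ G (u t) (v t) = (nl₂ G (u s) (v s) - nl₂ G (u s) (v t)) +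
      (nl₂ G (u s) (v t) - nl₂ G (u t) (v t)) := by abel
  rw [this]
  exact (norm_add_le _ _).trans (add_le_add (hF.norm_nl₂_sub_right_le h2 _ _)
    (hF.norm_nl₂_sub_left_le h2 hb h3 _))

end

/-! ### Algebra of the modified energy at a fixed step -/

theorem integral_norm_mul_norm_le (p q : L2R) :
    Integrable (fun x => ‖p x‖ * ‖q x‖) ∧ ∫ x, ‖p x‖ * ‖q x‖ ≤ ‖p‖ * ‖q‖ := by
  refine ⟨MemLp.integrable_mul (Lp.memLp p).norm (Lp.memLp q).norm, ?_⟩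
  have h1 := integral_mul_le_Lp_mul_Lq_of_nonneg (μ := (volume : Measure ℝ)) (p := 2) (q := 2)
    Real.HolderConjugate.two_two (Eventually.of_forall fun x => norm_nonneg (p x))
    (Eventually.of_forall fun x => norm_nonneg (q x))
    (by simpa using (Lp.memLp p).norm) (by simpa using (Lp.memLp q).norm)
  refine h1.trans_eq ?_
  simp only [Real.rpow_ofNat]
  rw [← norm_sq_eq_integral, ← norm_sq_eq_integral, ← Real.sqrt_eq_rpow, ← Real.sqrt_eq_rpow,
    Real.sqrt_sq (norm_nonneg _), Real.sqrt_sq (norm_nonneg _)]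

theorem re_inner_eq_integral (a b : L2R) :
    Integrable (fun x => ((starRingEnd ℂ) (a x) * b x).re) ∧
      (inner ℂ a b).re = ∫ x, ((starRingEnd ℂ) (a x) * b x).re := by
  have hi : Integrable fun x => (starRingEnd ℂ) (a x) * b x := by
    refine (L2.integrable_inner (𝕜 := ℂ) a b).congr (Eventually.of_forall fun x => ?_)
    simp only [RCLike.inner_apply]; ring
  refine ⟨hi.re, ?_⟩
  have : inner ℂ a b = ∫ x, (starRingEnd ℂ) (a x) * b x := by
    rw [L2.inner_def]; congr 1; ext x; rw [RCLike.inner_apply]; ring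
  rw [this]
  exact (integral_re hi).symm

/-- Passage from pointwise commutator bounds to pairings. The shape of the right-hand side
anticipates a translate and the function itself as `p` and `q`, and the difference of `u` as `r`. -/
theorem abs_re_inner_sub_le {a b c d p q r : L2R} {k K : ℝ}
    (h : ∀ᵐ x, |((starRingEnd ℂ) (a x) * b x).re - k * ((starRingEnd ℂ) (c x) * d x).re| ≤
      K * ((‖p x‖ + ‖q x‖) * ‖r x‖)) (hK : 0 ≤ K) :
    |(inner ℂ a b).re - k * (inner ℂ c d).re| ≤ K * ((‖p‖ + ‖q‖) * ‖r‖) := by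
  have h1 := re_inner_eq_integral a b
  have h2 := re_inner_eq_integral c d
  have hp := integral_norm_mul_norm_le p r
  have hq := integral_norm_mul_norm_le q r
  rw [h1.2, h2.2, ← integral_const_mul, ← integral_sub h1.1 (h2.1.const_mul k)]
  calc _ ≤ ∫ x, K * (‖p x‖ * ‖r x‖ + ‖q x‖ * ‖r x‖) := by
        rw [← Real.norm_eq_abs]
        refine norm_integral_le_of_norm_le ((hp.1.add hq.1).const_mul K) ?_
        filter_upwards [h] with x hx
        rw [Real.norm_eq_abs]
        exact hx.trans_eq (by ring)
    _ = K * ((∫ x, ‖p x‖ * ‖r x‖) + ∫ x, ‖q x‖ * ‖r x‖) := by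
        rw [integral_const_mul, integral_add hp.1 hq.1]
    _ ≤ K * (‖p‖ * ‖r‖ + ‖q‖ * ‖r‖) := by gcongr; exacts [hp.2, hq.2]
    _ = _ := by ring

/-- The function `u ∂ₜ|u|³` for `∂ₜu = v`. -/
def uCube (a z : ℂ) : ℂ := cubeAbs' a z * a

theorem nl₂_uCube_ae {u : L2R} {R : ℝ} (hu : AEBound u R) (v : L2R) :
    ((nl₂ uCube u v : ℝ → ℂ) =ᵐ[volume] fun x => uCube (u x) (v x)) ∧
      ‖nl₂ uCube u v‖ ≤ 3 * R ^ 3 * ‖v‖ := by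
  have hb : ∀ᵐ x, ‖uCube (u x) (v x)‖ ≤ 3 * R ^ 3 * ‖v x‖ := by
    filter_upwards [hu] with x hx
    have hR := hu.nonneg
    rw [uCube, norm_mul]
    calc _ ≤ 3 * ‖u x‖ ^ 2 * ‖v x‖ * ‖u x‖ := by gcongr; exact norm_cubeAbs'_le _ _
      _ ≤ 3 * R ^ 2 * ‖v x‖ * R := by gcongr
      _ = _ := by ring
  have h : MemLp (fun x => uCube (u x) (v x)) 2 volume := by
    refine MemLp.of_le_mul (c := 3 * R ^ 3) (Lp.memLp v) ?_ hb
    exact (isC11_cubeAbs.cont'.comp_aestronglyMeasurable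
        ((Lp.aestronglyMeasurable u).prodMk (Lp.aestronglyMeasurable v))).mul
        (Lp.aestronglyMeasurable u)
  have he : (nl₂ uCube u v : ℝ → ℂ) =ᵐ[volume] fun x => uCube (u x) (v x) := by
    rw [nl₂, dif_pos h]; exact h.coeFn_toLp
  refine ⟨he, Lp.norm_le_mul_norm_of_ae_le_mul ?_⟩
  filter_upwards [he, hb] with x h1 h2
  rw [h1]; exact h2

theorem norm_nl₂_cubeAbs'_le {u : L2R} {R : ℝ} (hu : AEBound u R) (v : L2R) :
    ‖nl₂ cubeAbs' u v‖ ≤ 3 * R ^ 2 * ‖v‖ := by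
  refine Lp.norm_le_mul_norm_of_ae_le_mul ?_
  filter_upwards [isC11_cubeAbs.nl₂_ae hu v, hu] with x h1 h2
  rw [h1]; exact (norm_cubeAbs'_le _ _).trans (by gcongr)

theorem norm_nl₂_sqAbs'_le {u : L2R} {R : ℝ} (hu : AEBound u R) (v : L2R) :
    ‖nl₂ sqAbs' u v‖ ≤ 2 * R * ‖v‖ := by
  refine Lp.norm_le_mul_norm_of_ae_le_mul ?_
  filter_upwards [isC11_sqAbs.nl₂_ae hu v, hu] with x h1 h2
  rw [h1]; exact (norm_sqAbs'_le _ _).trans (by gcongr)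

theorem norm_nl_quartic_le {u : L2R} {R : ℝ} (hu : AEBound u R) :
    ‖nl quartic u‖ ≤ R ^ 3 * ‖u‖ := by
  refine Lp.norm_le_mul_norm_of_ae_le_mul ?_
  filter_upwards [isC11_quartic.nl_ae hu, hu] with x h1 h2
  rw [h1, quartic_eq, norm_mul, norm_cubeAbs]; gcongr

/-- The algebra behind the modified energy. Here `r` and `s` are the values of `∂ₜ|u|³` at two
points: the main term sees `u` only through `|u|²`, and the rest is quadratic in `a - b` without any
difference of `r` and `s`. -/
theorem re_conj_diff_uCube (a b : ℂ) (r s : ℝ) :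
    ((starRingEnd ℂ) (r * a - s * b) * (a - b)).re =
      1 / 2 * ((r - s) * (‖a‖ ^ 2 - ‖b‖ ^ 2)) + 1 / 2 * (r + s) * ‖a - b‖ ^ 2 := by
  rw [← Complex.normSq_eq_norm_sq, ← Complex.normSq_eq_norm_sq, ← Complex.normSq_eq_norm_sq,
    Complex.normSq_apply, Complex.normSq_apply, Complex.normSq_apply]
  simp; ring

/-- Pointwise bound of the first remainder of the modified energy. -/
theorem abs_re_diff_uCube_sub_le {a b y z : ℂ} {S : ℝ} (hS : ‖a - b‖ ≤ S) :
    |((starRingEnd ℂ) (uCube a y - uCube b z) * (a - b)).re - 1 / 2 *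
      ((starRingEnd ℂ) (cubeAbs' a y - cubeAbs' b z) * (sqAbs a - sqAbs b)).re| ≤
      1 / 2 * S * ((‖cubeAbs' a y‖ + ‖cubeAbs' b z‖) * ‖a - b‖) := by
  obtain ⟨r, hr⟩ : ∃ r : ℝ, cubeAbs' a y = r := ⟨_, rfl⟩
  obtain ⟨s, hs⟩ : ∃ s : ℝ, cubeAbs' b z = s := ⟨_, rfl⟩
  rw [uCube, uCube, hr, hs, re_conj_diff_uCube, sqAbs, sqAbs, ← Complex.ofReal_sub,
    ← Complex.ofReal_sub, Complex.conj_ofReal, ← Complex.ofReal_mul, Complex.ofReal_re,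
    Complex.norm_real, Complex.norm_real, add_sub_cancel_left, abs_mul, abs_mul,
    abs_of_nonneg (show (0 : ℝ) ≤ 1 / 2 by norm_num), abs_of_nonneg (sq_nonneg ‖a - b‖)]
  have h1 : |r + s| ≤ ‖r‖ + ‖s‖ := abs_add_le r s
  calc 1 / 2 * |r + s| * ‖a - b‖ ^ 2 ≤ 1 / 2 * (‖r‖ + ‖s‖) * (S * ‖a - b‖) := by
        rw [sq]; gcongr
    _ = _ := by ring

/-- Pointwise bound of the second remainder of the modified energy. -/
theorem abs_re_diff_cube_sub_le {a b y z : ℂ} {R S : ℝ} (ha : ‖a‖ ≤ R) (hb : ‖b‖ ≤ R)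
    (hS : ‖a - b‖ ≤ S) :
    |((starRingEnd ℂ) (cubeAbs' a y - cubeAbs' b z) * (sqAbs a - sqAbs b)).re - 1 *
      ((starRingEnd ℂ) (cubeAbs a - cubeAbs b) * (sqAbs' a y - sqAbs' b z)).re| ≤
      3 / 2 * R * S * ((‖sqAbs' a y‖ + ‖sqAbs' b z‖) * ‖a - b‖) := by
  have hR : 0 ≤ R := (norm_nonneg a).trans ha
  obtain ⟨r, hr⟩ : ∃ r : ℝ, r = ((starRingEnd ℂ) a * y).re := ⟨_, rfl⟩
  obtain ⟨s, hs⟩ : ∃ s : ℝ, s = ((starRingEnd ℂ) b * z).re := ⟨_, rfl⟩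
  simp only [cubeAbs', sqAbs', cubeAbs, sqAbs, ← hr, ← hs]
  simp only [← Complex.ofReal_sub, Complex.conj_ofReal, ← Complex.ofReal_mul, Complex.ofReal_re,
    Complex.norm_real]
  -- Exchanging the time derivative between `|u|³` and `|u|²` leaves an expression divisible by
  -- `(‖a‖ - ‖b‖)²`, hence quadratic in the difference of `u`.
  have h : (3 * ‖a‖ * r - 3 * ‖b‖ * s) * (‖a‖ ^ 2 - ‖b‖ ^ 2) -
      1 * ((‖a‖ ^ 3 - ‖b‖ ^ 3) * (2 * r - 2 * s)) =
      (‖a‖ - ‖b‖) ^ 2 * (r * (‖a‖ + 2 * ‖b‖) + s * (‖b‖ + 2 * ‖a‖)) := by ring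
  rw [h, abs_mul, abs_of_nonneg (sq_nonneg _), Real.norm_eq_abs, Real.norm_eq_abs, abs_mul, abs_mul,
    abs_two]
  have h1 : |r * (‖a‖ + 2 * ‖b‖) + s * (‖b‖ + 2 * ‖a‖)| ≤ 3 * R * (|r| + |s|) := by
    refine (abs_add_le _ _).trans ?_
    rw [abs_mul, abs_mul, abs_of_nonneg (show 0 ≤ ‖a‖ + 2 * ‖b‖ by positivity),
      abs_of_nonneg (show 0 ≤ ‖b‖ + 2 * ‖a‖ by positivity)]
    have h2 : ‖a‖ + 2 * ‖b‖ ≤ 3 * R := by linarith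
    have h3 : ‖b‖ + 2 * ‖a‖ ≤ 3 * R := by linarith
    calc _ ≤ |r| * (3 * R) + |s| * (3 * R) := by gcongr
      _ = _ := by ring
  have h2 : (‖a‖ - ‖b‖) ^ 2 ≤ S * ‖a - b‖ := by
    rw [← sq_abs, sq]
    exact mul_le_mul ((abs_norm_sub_norm_le a b).trans hS) (abs_norm_sub_norm_le a b)
      (abs_nonneg _) ((norm_nonneg _).trans hS)
  calc _ ≤ (S * ‖a - b‖) * (3 * R * (|r| + |s|)) := by
        refine mul_le_mul h2 h1 (abs_nonneg _) ?_
        exact mul_nonneg ((norm_nonneg _).trans hS) (norm_nonneg _)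
    _ = _ := by ring

theorem norm_shiftL_eq (h : ℝ) (f : L2R) : ‖shiftL h f‖ = ‖f‖ := (shiftL h).norm_map f

/-- The modified energy remainders at a fixed step `h`. -/
theorem abs_re_inner_diff_le {u v : L2R} {R : ℝ} (hu : AEBound u R) (hu1 : InH 1 u) (h : ℝ) :
    |(inner ℂ (diff h (nl₂ uCube u v)) (diff h u)).re - 1 / 4 *
      ((inner ℂ (diff h (nl₂ cubeAbs' u v)) (diff h (nl sqAbs u))).re +
       (inner ℂ (diff h (nl cubeAbs u)) (diff h (nl₂ sqAbs' u v))).re)| ≤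
      5 * R ^ 2 * ‖v‖ * (wiener (diff h u) * ‖diff h u‖) := by
  set φ := nl₂ cubeAbs' u v
  set ψ := nl₂ sqAbs' u v
  have hR := hu.nonneg
  have hS0 := wiener_nonneg (diff h u)
  have hS : ∀ᵐ x, ‖u (x + h) - u x‖ ≤ wiener (diff h u) := by
    filter_upwards [ae_norm_le_wiener (hu1.diff h).1, diff_ae h u] with x h1 h2
    rwa [h2] at h1
  have e1 := (nl₂_uCube_ae hu v).1
  have e2 := isC11_cubeAbs.nl₂_ae hu v
  have e3 := isC11_sqAbs.nl₂_ae hu v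
  have e4 := isC11_sqAbs.nl_ae hu
  have e5 := isC11_cubeAbs.nl_ae hu
  -- Denote by `X` and `Y` the pairings in which the time derivative falls on `|u|³` and on `|u|²`.
  -- This compares the left pairing with `X/2`, and `b2` compares `X` with `Y`. Since `X/2 = (X +
  -- Y)/4 + (X - Y)/4`, the errors add up to `3 + 6/4 ≤ 5`, and `X + Y` is a time derivative.
  have b1 : |(inner ℂ (diff h (nl₂ uCube u v)) (diff h u)).re - 1 / 2 *
      (inner ℂ (diff h φ) (diff h (nl sqAbs u))).re| ≤
      1 / 2 * wiener (diff h u) * ((‖shiftL h φ‖ + ‖φ‖) * ‖diff h u‖) := by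
    refine abs_re_inner_sub_le ?_ (by positivity)
    filter_upwards [diff_ae h (nl₂ uCube u v), diff_ae h u, diff_ae h φ, diff_ae h (nl sqAbs u),
      shiftL_ae h φ, e1, e2, e4, ae_shiftL h e1, ae_shiftL h e2, ae_shiftL h e4, hS]
      with x d1 d2 d3 d4 d5 f1 f2 f4 g1 g2 g4 hs
    rw [d1, d2, d3, d4, d5, f1, f2, f4, g1, g2, g4]
    exact abs_re_diff_uCube_sub_le hs
  have b2 : |(inner ℂ (diff h φ) (diff h (nl sqAbs u))).re - 1 *
      (inner ℂ (diff h (nl cubeAbs u)) (diff h ψ)).re| ≤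
      3 / 2 * R * wiener (diff h u) * ((‖shiftL h ψ‖ + ‖ψ‖) * ‖diff h u‖) := by
    refine abs_re_inner_sub_le ?_ (by positivity)
    filter_upwards [diff_ae h φ, diff_ae h (nl sqAbs u), diff_ae h (nl cubeAbs u), diff_ae h ψ,
      diff_ae h u, shiftL_ae h ψ, e2, e3, e4, e5, ae_shiftL h e2, ae_shiftL h e3, ae_shiftL h e4,
      ae_shiftL h e5, hS, hu, ae_shiftL h hu]
      with x d1 d2 d3 d4 d5 d6 f2 f3 f4 f5 g2 g3 g4 g5 hs k1 k2
    rw [d1, d2, d3, d4, d5, d6, f2, f3, f4, f5, g2, g3, g4, g5]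
    exact abs_re_diff_cube_sub_le k2 k1 hs
  rw [norm_shiftL_eq] at b1 b2
  have hφ := norm_nl₂_cubeAbs'_le hu v
  have hψ := norm_nl₂_sqAbs'_le hu v
  set W := wiener (diff h u) * ‖diff h u‖ with hW
  have hW0 : 0 ≤ W := by positivity
  have b1' : 1 / 2 * wiener (diff h u) * ((‖φ‖ + ‖φ‖) * ‖diff h u‖) ≤ 3 * R ^ 2 * ‖v‖ * W := by
    calc _ = ‖φ‖ * W := by rw [hW]; ring
      _ ≤ _ := by gcongr
  have b2' : 3 / 2 * R * wiener (diff h u) * ((‖ψ‖ + ‖ψ‖) * ‖diff h u‖) ≤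
      6 * R ^ 2 * ‖v‖ * W := by
    calc _ = 3 * R * ‖ψ‖ * W := by rw [hW]; ring
      _ ≤ 3 * R * (2 * R * ‖v‖) * W := by gcongr
      _ = _ := by ring
  have b0 : 0 ≤ R ^ 2 * ‖v‖ * W := by positivity
  rw [abs_le] at b1 b2 ⊢
  constructor <;> linarith [b1.1, b1.2, b2.1, b2.2]

/-! ### The modified energy inequality at a fixed time -/

/-- The constant relating the truncated operators to `|D|`. -/
def kerConst : ℝ := 2 * Real.pi / kerSymbol 0 1

theorem kerConst_pos : 0 < kerConst := div_pos (by positivity) kerSymbol_zero_one_pos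

theorem kerConst_mul (ξ : ℝ) : kerConst * kerSymbol 0 ξ = 2 * Real.pi * |ξ| := by
  have := kerSymbol_zero_one_pos
  rw [kerSymbol_zero_eq, kerConst]; field_simp

/-- The truncated operator, for positive truncation parameter. -/
def kerOp (ε : ℝ) (hε : 0 < ε) : L2R →L[ℂ] L2R :=
  bmul (fun ξ => (kerSymbol ε ξ : ℂ)) (aesm_kerSymbol ε) (4 * ε⁻¹) fun ξ => by
    rw [Complex.norm_real, Real.norm_of_nonneg (kerSymbol_nonneg ε ξ)]
    exact kerSymbol_le hε ξ

/-- The truncated symbols increase to a multiple of `|ξ|` as `ε` decreases. The bound is therefore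
uniform in `ε`, as the passage to the limit requires. -/
theorem memMul_kerSymbol {ε : ℝ} (hε : 0 ≤ ε) {u : L2R} (hu : InH 1 u) :
    MemMul (fun ξ => (kerSymbol ε ξ : ℂ)) u ∧
      ‖fmul (fun ξ => (kerSymbol ε ξ : ℂ)) u‖ ≤ kerSymbol 0 1 * hNorm 1 u := by
  refine MemMul.mono hu (aesm_kerSymbol ε) fun ξ => ?_
  rw [Complex.norm_real, Real.norm_of_nonneg (kerSymbol_nonneg ε ξ), norm_wt, Real.rpow_one]
  refine (kerSymbol_le_zero hε ξ).trans ?_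
  rw [kerSymbol_zero_eq, mul_comm]
  refine mul_le_mul_of_nonneg_left ?_ kerSymbol_zero_one_pos.le
  exact le_trans (by nlinarith [abs_nonneg ξ, Real.pi_gt_three]) (abs_le_bracket ξ)

theorem re_inner_comm (a b : L2R) : (inner ℂ a b).re = (inner ℂ b a).re := by
  rw [← inner_conj_symm, Complex.conj_re]

theorem abs_re_inner_le (a b : L2R) : |(inner ℂ a b).re| ≤ ‖a‖ * ‖b‖ :=
  (Complex.abs_re_le_norm _).trans (norm_inner_le_norm a b)

/-- The modified energy inequality at a fixed time. -/
theorem energy_inequality {u v : L2R} {R A B ε : ℝ} (hε : 0 < ε) (hu : AEBound u R)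
    (hu1 : InH 1 u) (hv : Complex.I • v = fmul (wt 1) u - nl quartic u) (hA1 : 1 ≤ A)
    (hB1 : 1 ≤ B) (hA : hNorm (1 / 2) u ≤ A) (hB : hNorm 1 u ≤ B) :
    |2 * (inner ℂ v (Complex.I • nl₂ quartic' u v)).re + kerConst / 2 *
      ((inner ℂ (nl₂ cubeAbs' u v) (kerOp ε hε (nl sqAbs u))).re +
       (inner ℂ (nl cubeAbs u) (kerOp ε hε (nl₂ sqAbs' u v))).re)| ≤
      320 * kerConst * R ^ 2 * A ^ 2 * B * ‖v‖ + 6 * R ^ 3 * ‖v‖ * ‖u‖ * (1 + R ^ 3) +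
      6 * R ^ 3 * ‖v‖ * kerConst *
        ‖fmul (fun ξ => (kerSymbol 0 ξ : ℂ)) u - fmul (fun ξ => (kerSymbol ε ξ : ℂ)) u‖ := by
  set p := nl₂ uCube u v with hp
  have hR := hu.nonneg
  have hpn := (nl₂_uCube_ae hu v).2
  have hκ := kerConst_pos
  obtain ⟨g, gi, g0, gb, gI⟩ := exists_majorant_diff hu1 hA1 hB1 hA hB
  have k1 := inner_fmul_kerSymbol hε p u
  have k2 := inner_fmul_kerSymbol hε (nl₂ cubeAbs' u v) (nl sqAbs u)
  have k3 := inner_fmul_kerSymbol hε (nl cubeAbs u) (nl₂ sqAbs' u v)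
  have r (f g : L2R) (k : IntegrableOn
      (fun h => (((h ^ 2)⁻¹ : ℝ) : ℂ) * inner ℂ (diff h f) (diff h g)) (Set.Ioi ε) ∧
      inner ℂ f (fmul (fun ξ => (kerSymbol ε ξ : ℂ)) g) =
      ∫ h in Set.Ioi ε, (((h ^ 2)⁻¹ : ℝ) : ℂ) * inner ℂ (diff h f) (diff h g)) :
      IntegrableOn (fun h => (h ^ 2)⁻¹ * (inner ℂ (diff h f) (diff h g)).re) (Set.Ioi ε) ∧
      (inner ℂ f (fmul (fun ξ => (kerSymbol ε ξ : ℂ)) g)).re =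
      ∫ h in Set.Ioi ε, (h ^ 2)⁻¹ * (inner ℂ (diff h f) (diff h g)).re := by
    have h1 := k.1.re
    have h2 := integral_re k.1
    simp only [RCLike.re_to_complex, Complex.re_ofReal_mul] at h1 h2
    exact ⟨h1, by rw [k.2]; exact h2.symm⟩
  have r1 := r _ _ k1
  have r2 := r _ _ k2
  have r3 := r _ _ k3
  -- The fixed-step comparison is integrated against `h⁻²`; the constant is `5 · 32`, the second
  -- factor from the majorant of the square function. Working with the majorant avoids any
  -- measurability question for the sup bound as a function of `h`.
  have main : |(inner ℂ p (fmul (fun ξ => (kerSymbol ε ξ : ℂ)) u)).re - 1 / 4 *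
      ((inner ℂ (nl₂ cubeAbs' u v) (kerOp ε hε (nl sqAbs u))).re +
       (inner ℂ (nl cubeAbs u) (kerOp ε hε (nl₂ sqAbs' u v))).re)| ≤
      160 * R ^ 2 * A ^ 2 * B * ‖v‖ := by
    have i23 : IntegrableOn (fun h => 1 / 4 *
        ((h ^ 2)⁻¹ * (inner ℂ (diff h (nl₂ cubeAbs' u v)) (diff h (nl sqAbs u))).re +
         (h ^ 2)⁻¹ * (inner ℂ (diff h (nl cubeAbs u)) (diff h (nl₂ sqAbs' u v))).re))
        (Set.Ioi ε) := (r2.1.add r3.1).const_mul _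
    rw [kerOp, bmul_apply, bmul_apply, r1.2, r2.2, r3.2, ← integral_add r2.1 r3.1,
      ← integral_const_mul, ← integral_sub r1.1 i23]
    have hi : IntegrableOn (fun h => 5 * R ^ 2 * ‖v‖ * g h) (Set.Ioi ε) :=
      (gi.mono_set (Set.Ioi_subset_Ioi hε.le)).const_mul _
    calc _ ≤ ∫ h in Set.Ioi ε, 5 * R ^ 2 * ‖v‖ * g h := by
          rw [← Real.norm_eq_abs]
          refine norm_integral_le_of_norm_le hi ?_
          refine (ae_restrict_iff' measurableSet_Ioi).2 (Eventually.of_forall fun h hh => ?_)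
          have h0 : 0 < h := hε.trans hh
          have hb := abs_re_inner_diff_le (v := v) hu hu1 h
          rw [Real.norm_eq_abs]
          calc _ = (h ^ 2)⁻¹ * |(inner ℂ (diff h p) (diff h u)).re - 1 / 4 *
                ((inner ℂ (diff h (nl₂ cubeAbs' u v)) (diff h (nl sqAbs u))).re +
                (inner ℂ (diff h (nl cubeAbs u)) (diff h (nl₂ sqAbs' u v))).re)| := by
                rw [← abs_of_pos (show 0 < (h ^ 2)⁻¹ by positivity), ← abs_mul,
                  abs_of_pos (show 0 < (h ^ 2)⁻¹ by positivity)]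
                congr 1; ring
            _ ≤ (h ^ 2)⁻¹ * (5 * R ^ 2 * ‖v‖ * (wiener (diff h u) * ‖diff h u‖)) := by gcongr
            _ = 5 * R ^ 2 * ‖v‖ * (wiener (diff h u) * ‖diff h u‖ / h ^ 2) := by ring
            _ ≤ _ := by gcongr; exact gb h h0
      _ = 5 * R ^ 2 * ‖v‖ * ∫ h in Set.Ioi ε, g h := integral_const_mul _ _
      _ ≤ 5 * R ^ 2 * ‖v‖ * ∫ h in Set.Ioi 0, g h := by
          refine mul_le_mul_of_nonneg_left ?_ (by positivity)
          refine setIntegral_mono_set gi ?_ (Set.Ioi_subset_Ioi hε.le).eventuallyLE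
          exact (ae_restrict_iff' measurableSet_Ioi).2 (Eventually.of_forall g0)
      _ ≤ 5 * R ^ 2 * ‖v‖ * (32 * A ^ 2 * B) := by gcongr
      _ = _ := by ring
  -- The part `|u|³v` of the differentiated nonlinearity contributes `i|u|³|v|²`, which has no real
  -- part. In what remains, `i` is moved onto `v` and the equation is used to replace `iv`.
  have hN : (inner ℂ v (Complex.I • nl₂ quartic' u v)).re =
      -(inner ℂ (fmul (wt 1) u) p).re + (inner ℂ (nl quartic u) p).re := by
    have s1 : (inner ℂ v (Complex.I • nl₂ quartic' u v)).re =
        (inner ℂ v (Complex.I • p)).re := by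
      rw [(re_inner_eq_integral _ _).2, (re_inner_eq_integral _ _).2]
      refine integral_congr_ae ?_
      filter_upwards [Lp.coeFn_smul Complex.I (nl₂ quartic' u v), Lp.coeFn_smul Complex.I p,
        isC11_quartic.nl₂_ae hu v, (nl₂_uCube_ae hu v).1] with x h1 h2 h3 h4
      rw [h1, h2, Pi.smul_apply, Pi.smul_apply, h3, h4, quartic', uCube, smul_eq_mul, smul_eq_mul,
        mul_add, mul_add, Complex.add_re]
      have : ((starRingEnd ℂ) (v x) * (Complex.I * (cubeAbs (u x) * v x))).re = 0 := by
        obtain ⟨c, hc⟩ : ∃ c : ℝ, cubeAbs (u x) = c := ⟨_, rfl⟩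
        rw [hc]; simp; ring
      rw [this, zero_add]
    have s2 : inner ℂ v (Complex.I • p) = -inner ℂ (Complex.I • v) p := by
      rw [inner_smul_left, inner_smul_right, Complex.conj_I]; ring
    rw [s1, s2, hv, inner_sub_left, Complex.neg_re, Complex.sub_re]; ring
  have hr : |(inner ℂ (fmul (wt 1) u) p).re - kerConst *
      (inner ℂ p (fmul (fun ξ => (kerSymbol ε ξ : ℂ)) u)).re| ≤ ‖p‖ * ‖u‖ + ‖p‖ * (kerConst *
      ‖fmul (fun ξ => (kerSymbol 0 ξ : ℂ)) u - fmul (fun ξ => (kerSymbol ε ξ : ℂ)) u‖) := by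
    have hk0 := (memMul_kerSymbol le_rfl hu1).1
    have hks := hk0.smul (kerConst : ℂ)
    -- `√(1-Δ)` and `|D|` differ by an operator of norm at most one, because `0 ≤ bracket ξ - 2π|ξ|
    -- ≤ 1`.
    have h1 : ‖fmul (wt 1) u - (kerConst : ℂ) • fmul (fun ξ => (kerSymbol 0 ξ : ℂ)) u‖ ≤ ‖u‖ := by
      have : MemMul (fun ξ => wt 1 ξ - kerConst * kerSymbol 0 ξ) u ∧
          fmul (wt 1) u - (kerConst : ℂ) • fmul (fun ξ => (kerSymbol 0 ξ : ℂ)) u =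
          fmul (fun ξ => wt 1 ξ - kerConst * kerSymbol 0 ξ) u := by
        refine MemMul.eq_fmul ?_
        filter_upwards [fourier_sub_ae (fmul (wt 1) u)
            ((kerConst : ℂ) • fmul (fun ξ => (kerSymbol 0 ξ : ℂ)) u), fourier_fmul hu1,
          fourier_smul_ae (kerConst : ℂ) (fmul (fun ξ => (kerSymbol 0 ξ : ℂ)) u),
          fourier_fmul hk0] with ξ h1 h2 h3 h4
        rw [h1, h2, h3, h4]; ring
      rw [this.2]
      have hb := (MemMul.of_bounded (C := 1)
        ((aesm_wt 1).sub ((aesm_kerSymbol 0).const_mul (kerConst : ℂ))) (fun ξ => ?_) u).2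
      · rwa [one_mul] at hb
      · simp only [Pi.sub_apply]
        rw [wt_one, ← Complex.ofReal_mul, kerConst_mul, ← Complex.ofReal_sub, Complex.norm_real,
          Real.norm_eq_abs, abs_le]
        constructor <;> linarith [bracket_le ξ, abs_le_bracket ξ]
    have h2 : (inner ℂ (fmul (wt 1) u) p).re - kerConst *
        (inner ℂ p (fmul (fun ξ => (kerSymbol ε ξ : ℂ)) u)).re =
        (inner ℂ p (fmul (wt 1) u - (kerConst : ℂ) • fmul (fun ξ => (kerSymbol 0 ξ : ℂ)) u)).re +
        (inner ℂ p ((kerConst : ℂ) • (fmul (fun ξ => (kerSymbol 0 ξ : ℂ)) u -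
          fmul (fun ξ => (kerSymbol ε ξ : ℂ)) u))).re := by
      rw [re_inner_comm (fmul (wt 1) u), inner_sub_right, inner_smul_right, inner_smul_right,
        inner_sub_right, Complex.sub_re, Complex.re_ofReal_mul, Complex.re_ofReal_mul,
        Complex.sub_re]; ring
    rw [h2]
    refine (abs_add_le _ _).trans (add_le_add ((abs_re_inner_le _ _).trans (by gcongr))
      ((abs_re_inner_le _ _).trans_eq ?_))
    rw [norm_smul, Complex.norm_real, Real.norm_of_nonneg hκ.le]
  have hq : |(inner ℂ (nl quartic u) p).re| ≤ R ^ 3 * ‖u‖ * ‖p‖ :=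
    (abs_re_inner_le _ _).trans (by gcongr; exact norm_nl_quartic_le hu)
  set err := ‖fmul (fun ξ => (kerSymbol 0 ξ : ℂ)) u - fmul (fun ξ => (kerSymbol ε ξ : ℂ)) u‖
  have hmain := mul_le_mul_of_nonneg_left main hκ.le
  rw [← abs_of_pos hκ, ← abs_mul, abs_of_pos hκ] at hmain
  have t1 : ‖p‖ * ‖u‖ + ‖p‖ * (kerConst * err) + R ^ 3 * ‖u‖ * ‖p‖ ≤
      3 * R ^ 3 * ‖v‖ * (‖u‖ + kerConst * err + R ^ 3 * ‖u‖) := by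
    calc _ = ‖p‖ * (‖u‖ + kerConst * err + R ^ 3 * ‖u‖) := by ring
      _ ≤ _ := by gcongr
  rw [hN]
  rw [abs_le] at hr hq hmain ⊢
  constructor <;> nlinarith [hr.1, hr.2, hq.1, hq.2, hmain.1, hmain.2]

/-! ### Osgood's lemma and absorption of logarithms -/

/-- The right-hand side `(1 + z)(1 + log(1 + z))` of the differential inequality of the modified
energy. -/
def osgood (z : ℝ) : ℝ := (1 + z) * (1 + Real.log (1 + z))

theorem osgood_mono {x y : ℝ} (hx : 0 ≤ x) (hxy : x ≤ y) : osgood x ≤ osgood y := by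
  have h1 : Real.log (1 + x) ≤ Real.log (1 + y) := Real.log_le_log (by linarith) (by linarith)
  have h2 : 0 ≤ Real.log (1 + x) := Real.log_nonneg (by linarith)
  unfold osgood
  exact mul_le_mul (by linarith) (by linarith) (by linarith) (by linarith)

theorem osgood_pos {x : ℝ} (hx : 0 ≤ x) : 0 < osgood x := by
  have h2 : 0 ≤ Real.log (1 + x) := Real.log_nonneg (by linarith)
  unfold osgood; positivity

theorem continuousOn_osgood {y : ℝ → ℝ} {J : Set ℝ} (hy : ContinuousOn y J)
    (h0 : ∀ t ∈ J, 0 ≤ y t) : ContinuousOn (fun t => osgood (y t)) J := by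
  unfold osgood
  refine (continuousOn_const.add hy).mul (continuousOn_const.add
    ((continuousOn_const.add hy).log fun t ht => ?_))
  have := h0 t ht
  change 1 + y t ≠ 0
  linarith

/-- Osgood's lemma for `osgood`. -/
theorem bounded_of_osgood {y : ℝ → ℝ} {T C E : ℝ} (hC : 0 ≤ C)
    (hy : ContinuousOn y (Set.Ico 0 T)) (h0 : ∀ t ∈ Set.Ico 0 T, 0 ≤ y t)
    (h : ∀ t ∈ Set.Ico 0 T, y t ≤ E + ∫ s in (0 : ℝ)..t, C * osgood (y s)) :
    ∃ Y : ℝ, ∀ t ∈ Set.Ico 0 T, y t ≤ Y := by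
  set F : ℝ → ℝ := fun t => E + ∫ s in (0 : ℝ)..t, C * osgood (y s) with hF
  -- The double logarithm is a primitive of `1/osgood`. As `y ≤ F` and `osgood` is monotone, `L`
  -- grows at rate at most `C`, so `F` is at most a double exponential.
  set L : ℝ → ℝ := fun t => Real.log (1 + Real.log (1 + F t)) with hL
  refine ⟨Real.exp (Real.exp (L 0 + C * T)), fun b hb => ?_⟩
  have hT : 0 < T := hb.1.trans_lt hb.2
  have hO : ContinuousOn (fun s => C * osgood (y s)) (Set.Ico 0 T) :=
    continuousOn_const.mul (continuousOn_osgood hy h0)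
  have hF0 (t : ℝ) (ht : t ∈ Set.Ico 0 T) : 0 ≤ F t := (h0 t ht).trans (h t ht)
  have hFd (t : ℝ) (ht : t ∈ Set.Ioo 0 T) : HasDerivAt F (C * osgood (y t)) t := by
    have hct : ContinuousAt (fun s => C * osgood (y s)) t :=
      hO.continuousAt (Ico_mem_nhds ht.1 ht.2)
    have hi : IntervalIntegrable (fun s => C * osgood (y s)) volume 0 t := by
      refine (hO.mono ?_).intervalIntegrable
      rw [Set.uIcc_of_le ht.1.le]; exact fun s hs => ⟨hs.1, hs.2.trans_lt ht.2⟩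
    refine (intervalIntegral.integral_hasDerivAt_right hi ?_ hct).const_add E
    exact (hO.mono Set.Ioo_subset_Ico_self).stronglyMeasurableAtFilter isOpen_Ioo t ht
  have hFc : ContinuousOn F (Set.Icc 0 b) := by
    refine continuousOn_const.add ?_
    have hi : IntegrableOn (fun s => C * osgood (y s)) (Set.uIcc 0 b) := by
      rw [Set.uIcc_of_le hb.1]
      exact (hO.mono fun s hs => ⟨hs.1, hs.2.trans_lt hb.2⟩).integrableOn_Icc
    have := intervalIntegral.continuousOn_primitive_interval hi
    rwa [Set.uIcc_of_le hb.1] at this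
  have hl (t : ℝ) (ht : t ∈ Set.Ico 0 T) : 0 ≤ Real.log (1 + F t) :=
    Real.log_nonneg (by linarith [hF0 t ht])
  have hLd (t : ℝ) (ht : t ∈ Set.Ioo 0 b) : HasDerivAt L
      (C * osgood (y t) / (1 + F t) / (1 + Real.log (1 + F t))) t := by
    have ht' : t ∈ Set.Ioo 0 T := ⟨ht.1, ht.2.trans hb.2⟩
    have h1 := hF0 t ⟨ht.1.le, ht'.2⟩
    have h2 := hl t ⟨ht.1.le, ht'.2⟩
    exact ((((hFd t ht').const_add 1).log (by linarith)).const_add 1).log (by linarith)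
  have hsub {t : ℝ} (ht : t ∈ Set.Icc 0 b) : t ∈ Set.Ico 0 T := ⟨ht.1, ht.2.trans_lt hb.2⟩
  have hLc : ContinuousOn L (Set.Icc 0 b) := by
    refine (continuousOn_const.add ((continuousOn_const.add hFc).log fun t ht => ?_)).log
      fun t ht => ?_
    · have := hF0 t (hsub ht)
      change 1 + F t ≠ 0
      linarith
    · have := hl t (hsub ht)
      change 1 + Real.log (1 + F t) ≠ 0
      linarith
  have hle : L b ≤ L 0 + C * T := by
    have hcv : Convex ℝ (Set.Icc 0 b) := convex_Icc 0 b
    have := hcv.image_sub_le_mul_sub_of_deriv_le hLc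
      (fun t ht => ((hLd t (by simpa using ht)).differentiableAt).differentiableWithinAt)
      (C := C) (fun t ht => ?_) 0 ⟨le_rfl, hb.1⟩ b ⟨hb.1, le_rfl⟩ hb.1
    · have : C * b ≤ C * T := by gcongr; exact hb.2.le
      linarith
    · have ht : t ∈ Set.Ioo 0 b := by simpa using ht
      rw [(hLd t ht).deriv]
      have ht' : t ∈ Set.Ico 0 T := ⟨ht.1.le, ht.2.trans hb.2⟩
      have h1 := hF0 t ht'
      have h2 := hl t ht'
      rw [div_div, div_le_iff₀ (by positivity)]
      exact mul_le_mul_of_nonneg_left (osgood_mono (h0 t ht') (h t ht')) hC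
  have h1 := hF0 b hb
  have h2 := hl b hb
  have h3 : 1 + Real.log (1 + F b) ≤ Real.exp (L 0 + C * T) := by
    rw [← Real.log_le_iff_le_exp (by positivity)]; exact hle
  have h4 : 1 + F b ≤ Real.exp (Real.exp (L 0 + C * T)) := by
    rw [← Real.log_le_iff_le_exp (by positivity)]; linarith
  linarith [h b hb]

/-- Absorption of the logarithmic losses into `osgood`. -/
theorem exists_osgood_const {A : ℝ} (hA : 1 ≤ A) : ∃ C : ℝ, 0 ≤ C ∧ ∀ R w V : ℝ, 0 ≤ R → 0 ≤ w →
    0 ≤ V → R ^ 2 ≤ 16 * (A ^ 2 + 1) * (1 + Real.log (1 + w)) → w ≤ V + R ^ 3 * A →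
    w ≤ 2 * V + C ∧ 320 * kerConst * R ^ 2 * A ^ 2 * (1 + w) * V +
      6 * R ^ 3 * V * A * (1 + R ^ 3) ≤ C * osgood (V ^ 2) := by
  set c₁ : ℝ := (48 * (A ^ 2 + 1)) ^ 3 with hc₁
  set c₂ : ℝ := 2 + A ^ 2 * c₁ with hc₂
  have hA0 : 0 < A := by linarith
  have h1 : 0 < c₁ := by positivity
  have h2 : 2 ≤ c₂ := by have : 0 ≤ A ^ 2 * c₁ := by positivity
                         linarith
  have hκ := kerConst_pos
  have hlog2 : 0 ≤ Real.log c₂ := Real.log_nonneg (by linarith)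
  set D₁ : ℝ := 320 * kerConst * (16 * (A ^ 2 + 1) * (2 + Real.log c₂)) * A ^ 2 * (2 * c₂)
  set D₂ : ℝ := 24 * A * (1 + c₁) * c₂
  have hD₁ : 0 ≤ D₁ := by positivity
  have hD₂ : 0 ≤ D₂ := by positivity
  refine ⟨c₂ + D₁ + D₂, by positivity, fun R w V hR hw hV hRw hwV => ?_⟩
  have hlw : 0 ≤ Real.log (1 + w) := Real.log_nonneg (by linarith)
  have hR6 : (R ^ 3) ^ 2 ≤ c₁ * (1 + w) := by
    -- A cube root beats the logarithm, so the Brezis–Gallouët bound makes `R⁶` at most linear in `1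
    -- + w`.
    have hx : 1 + Real.log (1 + w) ≤ 3 * (1 + w) ^ (1 / 3 : ℝ) := by
      have h3 : Real.log (1 + w) = 3 * Real.log ((1 + w) ^ (1 / 3 : ℝ)) := by
        rw [Real.log_rpow (by linarith)]; ring
      have h4 := Real.log_le_sub_one_of_pos (show 0 < (1 + w) ^ (1 / 3 : ℝ) by positivity)
      linarith
    have h5 : ((1 + w) ^ (1 / 3 : ℝ)) ^ 3 = 1 + w := by
      rw [← Real.rpow_natCast, ← Real.rpow_mul (by linarith)]; norm_num
    calc (R ^ 3) ^ 2 = (R ^ 2) ^ 3 := by ring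
      _ ≤ (16 * (A ^ 2 + 1) * (3 * (1 + w) ^ (1 / 3 : ℝ))) ^ 3 := by
          refine pow_le_pow_left₀ (sq_nonneg R) (hRw.trans ?_) 3
          gcongr
      _ = (48 * (A ^ 2 + 1)) ^ 3 * ((1 + w) ^ (1 / 3 : ℝ)) ^ 3 := by ring
      _ = _ := by rw [h5]
  have hw2 : w ≤ 2 * V + (c₂ - 1) := by
    -- By the arithmetic–geometric mean inequality; half of `w` is then absorbed on the left of `w ≤
    -- V + R³A`, giving `w ≤ 2V` plus a constant.
    have : R ^ 3 * A ≤ 1 / 2 * (1 + w) + 1 / 2 * (A ^ 2 * c₁) := by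
      have h3 : (R ^ 3 * A) ^ 2 ≤ (1 / 2 * (1 + w) + 1 / 2 * (A ^ 2 * c₁)) ^ 2 := by
        calc (R ^ 3 * A) ^ 2 = (R ^ 3) ^ 2 * A ^ 2 := by ring
          _ ≤ (c₁ * (1 + w)) * A ^ 2 := by gcongr
          _ ≤ _ := by nlinarith [sq_nonneg ((1 + w) - A ^ 2 * c₁)]
      exact le_of_sq_le_sq h3 (by positivity)
    linarith
  have hw3 : 1 + w ≤ c₂ * (1 + V) := by nlinarith
  have hz : (1 + V) ^ 2 ≤ 2 * (1 + V ^ 2) := by nlinarith [sq_nonneg (V - 1)]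
  have hlz : 0 ≤ Real.log (1 + V ^ 2) := Real.log_nonneg (by nlinarith)
  have hlw2 : 1 + Real.log (1 + w) ≤ (2 + Real.log c₂) * (1 + Real.log (1 + V ^ 2)) := by
    have h3 : Real.log (1 + w) ≤ Real.log c₂ + Real.log (1 + V) := by
      rw [← Real.log_mul (by positivity) (by positivity)]
      exact Real.log_le_log (by linarith) hw3
    have h4 : Real.log (1 + V) ≤ 1 + Real.log (1 + V ^ 2) := by
      have h5 : (1 : ℝ) + Real.log (1 + V ^ 2) = Real.log (Real.exp 1 * (1 + V ^ 2)) := by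
        rw [Real.log_mul (Real.exp_pos _).ne' (by positivity), Real.log_exp]
      rw [h5]
      refine Real.log_le_log (by positivity) ?_
      have : (2 : ℝ) ≤ Real.exp 1 := by have := Real.add_one_le_exp (1 : ℝ); linarith
      nlinarith [sq_nonneg (V - 1), sq_nonneg V]
    nlinarith [mul_nonneg hlog2 hlz]
  refine ⟨by linarith, ?_⟩
  have hO : osgood (V ^ 2) = (1 + V ^ 2) * (1 + Real.log (1 + V ^ 2)) := rfl
  have hO1 : 1 + V ^ 2 ≤ osgood (V ^ 2) := by
    rw [hO]; exact le_mul_of_one_le_right (by positivity) (by linarith)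
  have hV1 : (1 + w) * V ≤ 2 * c₂ * (1 + V ^ 2) := by
    calc (1 + w) * V ≤ (c₂ * (1 + V)) * (1 + V) := by gcongr; linarith
      _ = c₂ * (1 + V) ^ 2 := by ring
      _ ≤ c₂ * (2 * (1 + V ^ 2)) := by gcongr
      _ = _ := by ring
  have t₁ : 320 * kerConst * R ^ 2 * A ^ 2 * (1 + w) * V ≤ D₁ * osgood (V ^ 2) := by
    calc 320 * kerConst * R ^ 2 * A ^ 2 * (1 + w) * V
        = 320 * kerConst * R ^ 2 * A ^ 2 * ((1 + w) * V) := by ring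
      _ ≤ 320 * kerConst * (16 * (A ^ 2 + 1) * ((2 + Real.log c₂) *
          (1 + Real.log (1 + V ^ 2)))) * A ^ 2 * (2 * c₂ * (1 + V ^ 2)) := by
          gcongr
          exact hRw.trans (by gcongr)
      _ = _ := by rw [hO]; ring
  have t₂ : 6 * R ^ 3 * V * A * (1 + R ^ 3) ≤ D₂ * osgood (V ^ 2) := by
    have h3 : R ^ 3 * (1 + R ^ 3) ≤ 2 * (1 + c₁) * (1 + w) := by
      have h4 : 0 ≤ R ^ 3 := by positivity
      nlinarith [sq_nonneg (R ^ 3 - 1)]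
    calc 6 * R ^ 3 * V * A * (1 + R ^ 3) = 6 * A * V * (R ^ 3 * (1 + R ^ 3)) := by ring
      _ ≤ 6 * A * V * (2 * (1 + c₁) * (1 + w)) := by gcongr
      _ = 12 * A * (1 + c₁) * ((1 + w) * V) := by ring
      _ ≤ 12 * A * (1 + c₁) * (2 * c₂ * (1 + V ^ 2)) := by gcongr
      _ = D₂ * (1 + V ^ 2) := by ring
      _ ≤ _ := by gcongr
  have := osgood_pos (sq_nonneg V)
  have h6 : 0 ≤ c₂ * osgood (V ^ 2) := by positivity
  linarith

/-! ### Energy identities along solutions -/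

theorem hasDerivAt_re_inner {f g : ℝ → L2R} {f' g' : L2R} {t : ℝ} (hf : HasDerivAt f f' t)
    (hg : HasDerivAt g g' t) : HasDerivAt (fun s => (inner ℂ (f s) (g s)).re)
      ((inner ℂ (f t) g').re + (inner ℂ f' (g t)).re) t := by
  have := Complex.reCLM.hasFDerivAt.comp_hasDerivAt t (HasDerivAt.inner ℂ hf hg)
  exact this

theorem continuousAt_re_inner {f g : ℝ → L2R} {t : ℝ} (hf : ContinuousAt f t)
    (hg : ContinuousAt g t) : ContinuousAt (fun s => (inner ℂ (f s) (g s)).re) t :=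
  Complex.continuous_re.continuousAt.comp (hf.inner hg)

theorem norm_sq_eq_re_inner_L2 (f : L2R) : ‖f‖ ^ 2 = (inner ℂ f f).re := by
  rw [inner_self_eq_norm_sq_to_K]; norm_cast

theorem hasDerivAt_norm_sq_L2 {f : ℝ → L2R} {f' : L2R} {t : ℝ} (hf : HasDerivAt f f' t) :
    HasDerivAt (fun s => ‖f s‖ ^ 2) (2 * (inner ℂ (f t) f').re) t := by
  simp only [norm_sq_eq_re_inner_L2]
  have := hasDerivAt_re_inner hf hf
  rwa [re_inner_comm f', ← two_mul] at this

theorem hasDerivAt_clm_L2 (L : L2R →L[ℂ] L2R) {f : ℝ → L2R} {f' : L2R} {t : ℝ}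
    (hf : HasDerivAt f f' t) : HasDerivAt (fun s => L (f s)) (L f') t :=
  (L.restrictScalars ℝ).hasFDerivAt.comp_hasDerivAt t hf

/-- Real symbols give a real integrand against `|𝓕 f|²`. This is the conservation mechanism: the
linear part of the equation carries a factor `i` and drops out of every `L²` energy. -/
theorem inner_fmul_fmul_im {m₁ m₂ : ℝ → ℝ} {f : L2R} (h₁ : MemMul (fun ξ => (m₁ ξ : ℂ)) f)
    (h₂ : MemMul (fun ξ => (m₂ ξ : ℂ)) f) :
    (inner ℂ (fmul (fun ξ => (m₁ ξ : ℂ)) f) (fmul (fun ξ => (m₂ ξ : ℂ)) f)).im = 0 := by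
  rw [inner_eq_integral_fourier]
  have : ∫ ξ, (starRingEnd ℂ) ((𝓕 (fmul (fun ξ => (m₁ ξ : ℂ)) f) : L2R) ξ) *
      (𝓕 (fmul (fun ξ => (m₂ ξ : ℂ)) f) : L2R) ξ =
      ∫ ξ, ((m₁ ξ * m₂ ξ * ‖(𝓕 f : L2R) ξ‖ ^ 2 : ℝ) : ℂ) := by
    refine integral_congr_ae ?_
    filter_upwards [fourier_fmul h₁, fourier_fmul h₂] with ξ e1 e2
    rw [e1, e2, map_mul, Complex.conj_ofReal]
    push_cast
    rw [← Complex.conj_mul']; ring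
  rw [this, integral_complex_ofReal, Complex.ofReal_im]

/-- The equation in `L²`-energy form: derivative of `‖Λ z‖²` for a Fourier multiplier `Λ` with
real symbol and `i ∂ₜ z = √(1 - Δ) z - g`. -/
theorem hasDerivAt_norm_sq_multiplier {m : ℝ → ℝ} {L : L2R →L[ℂ] L2R}
    (hL : ∀ f, MemMul (fun ξ => (m ξ : ℂ)) f ∧ L f = fmul (fun ξ => (m ξ : ℂ)) f)
    {z : ℝ → L2R} {z' g : L2R} {t : ℝ} (hz : HasDerivAt z z' t) (h1 : InH 1 (z t))
    (he : Complex.I • z' = fmul (wt 1) (z t) - g) :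
    HasDerivAt (fun s => ‖L (z s)‖ ^ 2) (2 * (inner ℂ (L (z t)) (Complex.I • L g)).re) t := by
  have hd := hasDerivAt_norm_sq_L2 (hasDerivAt_clm_L2 L hz)
  convert hd using 2
  have hz' : z' = Complex.I • g - Complex.I • fmul (wt 1) (z t) := by
    rw [← smul_sub, ← neg_sub, ← he, smul_neg, smul_smul, Complex.I_mul_I]; simp
  have h2 := (MemMul.comp_iff h1).1 (hL (fmul (wt 1) (z t))).1
  have h3 := (MemMul.comp h1 h2).2
  have h4 : (inner ℂ (L (z t)) (L (fmul (wt 1) (z t)))).im = 0 := by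
    rw [(hL _).2, (hL _).2, h3]
    have he : (fun ξ => (m ξ : ℂ) * wt 1 ξ) = fun ξ => ((m ξ * bracket ξ ^ (1 : ℝ) : ℝ) : ℂ) := by
      ext ξ; rw [wt]; push_cast; ring
    rw [he] at h2 ⊢
    exact inner_fmul_fmul_im (hL _).1 h2
  rw [hz', map_sub, map_smul, map_smul, inner_sub_right, inner_smul_right _ (L (fmul _ _)),
    Complex.sub_re, Complex.mul_re (Complex.I) (inner ℂ _ (L (fmul _ _))), h4]
  simp

/-- A solution of the equation on the open set `J`, with time derivative `v`. -/
structure IsPath (u v : ℝ → L2R) (J : Set ℝ) : Prop where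
  isOpen : IsOpen J
  mem : ∀ t ∈ J, InH (3 / 2) (u t)
  cont : ∀ t ∈ J, Tendsto (fun s => hNorm (3 / 2) (u s - u t)) (𝓝 t) (𝓝 0)
  deriv : ∀ t ∈ J, HasDerivAt u (v t) t
  eq : ∀ t ∈ J, Complex.I • v t = fmul (wt 1) (u t) - nl quartic (u t)

theorem aeBound_hNorm {f : L2R} (hf : InH 1 f) : AEBound f (3 * hNorm 1 f) := by
  filter_upwards [ae_norm_le_wiener hf] with x hx
  exact hx.trans (wiener_le_three hf)

theorem hNorm_le_add {s : ℝ} {f g : L2R} (hf : InH s f) (hg : InH s g) :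
    hNorm s f ≤ hNorm s g + hNorm s (f - g) := by
  have h1 := (hf.sub hg).2
  rw [hNorm, hNorm, hNorm, h1]
  have : fmul (wt s) f = fmul (wt s) g + (fmul (wt s) f - fmul (wt s) g) := by abel
  calc ‖fmul (wt s) f‖ = ‖fmul (wt s) g + (fmul (wt s) f - fmul (wt s) g)‖ := by rw [← this]
    _ ≤ _ := norm_add_le _ _

namespace IsPath
variable {u v : ℝ → L2R} {J : Set ℝ}

theorem mem_nhds (h : IsPath u v J) {t : ℝ} (ht : t ∈ J) : ∀ᶠ s in 𝓝 t, s ∈ J :=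
  h.isOpen.mem_nhds ht

theorem inH_one (h : IsPath u v J) {t : ℝ} (ht : t ∈ J) : InH 1 (u t) :=
  (InH.mono (by norm_num) (h.mem t ht)).1

theorem continuousAt_fmul (h : IsPath u v J) {t C : ℝ} (ht : t ∈ J) {m : ℝ → ℂ}
    (hm : AEStronglyMeasurable m) (hb : ∀ ξ, ‖m ξ‖ ≤ C * ‖wt (3 / 2) ξ‖) :
    ContinuousAt (fun s => fmul m (u s)) t := by
  rw [ContinuousAt, tendsto_iff_norm_sub_tendsto_zero]
  have h0 : Tendsto (fun s => C * hNorm (3 / 2) (u s - u t)) (𝓝 t) (𝓝 0) := by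
    simpa using (h.cont t ht).const_mul C
  refine squeeze_zero' (Eventually.of_forall fun s => norm_nonneg _) ?_ h0
  filter_upwards [h.mem_nhds ht] with s hs
  have m1 := (MemMul.mono (h.mem s hs) hm hb).1
  have m2 := (MemMul.mono (h.mem t ht) hm hb).1
  rw [← (m1.sub m2).2]
  exact (MemMul.mono ((h.mem s hs).sub (h.mem t ht)).1 hm hb).2

theorem continuousAt_hNorm (h : IsPath u v J) {t : ℝ} (ht : t ∈ J) {s : ℝ} (hs : s ≤ 3 / 2) :
    ContinuousAt (fun τ => fmul (wt s) (u τ)) t :=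
  h.continuousAt_fmul (C := 1) ht (aesm_wt s) (by simpa using norm_wt_mono hs)

theorem tendsto_hNorm_one (h : IsPath u v J) {t : ℝ} (ht : t ∈ J) :
    Tendsto (fun s => hNorm 1 (u s - u t)) (𝓝 t) (𝓝 0) := by
  refine squeeze_zero' (Eventually.of_forall fun s => norm_nonneg _) ?_ (h.cont t ht)
  filter_upwards [h.mem_nhds ht] with s hs
  exact (InH.mono (by norm_num) ((h.mem s hs).sub (h.mem t ht)).1).2

theorem supContAt (h : IsPath u v J) {t : ℝ} (ht : t ∈ J) :
    SupContAt u t (3 * (hNorm 1 (u t) + 1)) fun s => 3 * hNorm 1 (u s - u t) where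
  bound := by
    filter_upwards [h.mem_nhds ht, (h.tendsto_hNorm_one ht).eventually_lt_const one_pos]
      with s hs h1
    refine (aeBound_hNorm (h.inH_one hs)).mono ?_
    have := hNorm_le_add (h.inH_one hs) (h.inH_one ht)
    linarith
  diff := by
    filter_upwards [h.mem_nhds ht] with s hs
    exact aeBound_hNorm ((h.inH_one hs).sub (h.inH_one ht)).1
  tendsto := by simpa using (h.tendsto_hNorm_one ht).const_mul 3

theorem eq' (h : IsPath u v J) {t : ℝ} (ht : t ∈ J) :
    v t = -(Complex.I • (fmul (wt 1) (u t) - nl quartic (u t))) := by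
  rw [← h.eq t ht, smul_smul, Complex.I_mul_I]; simp

theorem hasDerivAt_nl (h : IsPath u v J) {t : ℝ} (ht : t ∈ J) {F : ℂ → ℂ} {G : ℂ → ℂ → ℂ}
    {K : ℝ → ℝ} (hF : IsC11 F G K) :
    HasDerivAt (fun s => nl F (u s)) (nl₂ G (u t) (v t)) t :=
  hF.hasDerivAt_nl (h.supContAt ht) (h.deriv t ht)

theorem continuousAt_v (h : IsPath u v J) {t : ℝ} (ht : t ∈ J) : ContinuousAt v t := by
  have h1 : ContinuousAt (fun s => -(Complex.I • (fmul (wt 1) (u s) - nl quartic (u s)))) t := by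
    have e1 : ContinuousAt (fun s => fmul (wt 1) (u s)) t := h.continuousAt_hNorm ht (by norm_num)
    have e2 : ContinuousAt (fun s => nl quartic (u s)) t :=
      (h.hasDerivAt_nl ht isC11_quartic).continuousAt
    have e3 : ContinuousAt (fun s => fmul (wt 1) (u s) - nl quartic (u s)) t := e1.sub e2
    exact (e3.const_smul Complex.I).neg
  refine h1.congr ?_
  filter_upwards [h.mem_nhds ht] with s hs
  exact (h.eq' hs).symm

theorem continuousAt_nl₂ (h : IsPath u v J) {t : ℝ} (ht : t ∈ J) {F : ℂ → ℂ} {G : ℂ → ℂ → ℂ}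
    {K : ℝ → ℝ} (hF : IsC11 F G K) : ContinuousAt (fun s => nl₂ G (u s) (v s)) t :=
  hF.continuousAt_nl₂ (h.supContAt ht) (h.continuousAt_v ht)

/-- Frequency truncation symbol. -/
def _root_.truncSymbol (n : ℕ) (ξ : ℝ) : ℝ := (n + 1) / (n + 1 + bracket ξ)

theorem _root_.truncSymbol_nonneg (n : ℕ) (ξ : ℝ) : 0 ≤ truncSymbol n ξ := by
  have := bracket_pos ξ
  unfold truncSymbol; positivity

theorem _root_.truncSymbol_le_one (n : ℕ) (ξ : ℝ) : truncSymbol n ξ ≤ 1 := by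
  have := bracket_pos ξ
  unfold truncSymbol
  rw [div_le_one (by positivity)]; linarith

theorem _root_.truncSymbol_mul_le (n : ℕ) (ξ : ℝ) : truncSymbol n ξ * bracket ξ ≤ n + 1 := by
  have := bracket_pos ξ
  unfold truncSymbol
  rw [div_mul_eq_mul_div, div_le_iff₀ (by positivity)]
  have : (0 : ℝ) ≤ n := Nat.cast_nonneg n
  nlinarith

theorem _root_.continuous_truncSymbol (n : ℕ) : Continuous (truncSymbol n) := by
  unfold truncSymbol
  refine continuous_const.div (continuous_const.add continuous_bracket) fun ξ => ?_
  have := bracket_pos ξ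
  positivity

theorem _root_.tendsto_truncSymbol (ξ : ℝ) :
    Tendsto (fun n => truncSymbol n ξ) atTop (𝓝 1) := by
  have h1 : Tendsto (fun n : ℕ => (n : ℝ) + 1) atTop atTop :=
    tendsto_atTop_add_const_right _ _ tendsto_natCast_atTop_atTop
  have h2 : Tendsto (fun n : ℕ => 1 - bracket ξ / ((n : ℝ) + 1 + bracket ξ)) atTop (𝓝 (1 - 0)) :=
    (tendsto_const_nhds.div_atTop (tendsto_atTop_add_const_right _ _ h1)).const_sub 1
  rw [sub_zero] at h2
  refine h2.congr fun n => ?_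
  have := bracket_pos ξ
  have h3 : (n : ℝ) + 1 + bracket ξ ≠ 0 := by positivity
  rw [truncSymbol]; field_simp; ring

theorem _root_.aesm_truncSymbol (n : ℕ) :
    AEStronglyMeasurable (fun ξ => (truncSymbol n ξ : ℂ)) (volume : Measure ℝ) :=
  (Complex.continuous_ofReal.comp (continuous_truncSymbol n)).aestronglyMeasurable

theorem _root_.norm_truncSymbol_le (n : ℕ) (ξ : ℝ) : ‖(truncSymbol n ξ : ℂ)‖ ≤ 1 := by
  rw [Complex.norm_real, Real.norm_of_nonneg (truncSymbol_nonneg n ξ)]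
  exact truncSymbol_le_one n ξ

/-- Frequency truncation. -/
def _root_.trunc (n : ℕ) : L2R →L[ℂ] L2R :=
  bmul (fun ξ => (truncSymbol n ξ : ℂ)) (aesm_truncSymbol n) 1 (norm_truncSymbol_le n)

theorem _root_.memMul_truncSymbol (n : ℕ) (f : L2R) : MemMul (fun ξ => (truncSymbol n ξ : ℂ)) f :=
  (MemMul.of_bounded (aesm_truncSymbol n) (norm_truncSymbol_le n) f).1

theorem _root_.norm_trunc_le (n : ℕ) (f : L2R) : ‖trunc n f‖ ≤ ‖f‖ := by
  have := (MemMul.of_bounded (aesm_truncSymbol n) (norm_truncSymbol_le n) f).2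
  rwa [one_mul] at this

theorem _root_.tendsto_trunc (f : L2R) : Tendsto (fun n => trunc n f) atTop (𝓝 f) := by
  have := tendsto_fmul (l := atTop) (m := fun n ξ => (truncSymbol n ξ : ℂ)) (m₀ := fun _ => 1)
    (G := fun _ => 1) (f := f) (fmul_one f).1 aesm_truncSymbol aestronglyMeasurable_const
    (Eventually.of_forall fun n ξ => by simpa using norm_truncSymbol_le n ξ) (fun _ => le_rfl)
    fun ξ => by
      have := (Complex.continuous_ofReal.tendsto 1).comp (tendsto_truncSymbol ξ)
      rwa [Complex.ofReal_one] at this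
  rwa [(fmul_one f).2] at this

/-- The truncation of `√(1 - Δ)`. -/
def _root_.truncD (n : ℕ) : L2R →L[ℂ] L2R :=
  bmul (fun ξ => (truncSymbol n ξ : ℂ) * wt 1 ξ) ((aesm_truncSymbol n).mul (aesm_wt 1)) (n + 1)
    fun ξ => by
      rw [norm_mul, norm_wt, Complex.norm_real, Real.norm_of_nonneg (truncSymbol_nonneg n ξ),
        Real.rpow_one]
      exact truncSymbol_mul_le n ξ

theorem _root_.truncD_apply {f : L2R} (hf : InH 1 f) (n : ℕ) :
    trunc n (fmul (wt 1) f) = truncD n f :=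
  (MemMul.comp hf ((MemMul.comp_iff hf).1 (memMul_truncSymbol n _))).2

/-- Differentiating `v` formally produces `√(1-Δ)v`, which need not lie in `L²`. After truncation
this term is the bounded operator `truncD n` applied to `v`, and its contribution vanishes because
the symbols are real. -/
theorem hasDerivAt_norm_sq_trunc (h : IsPath u v J) {t : ℝ} (ht : t ∈ J) (n : ℕ) :
    HasDerivAt (fun s => ‖trunc n (v s)‖ ^ 2) (2 * (inner ℂ (trunc n (v t))
      (Complex.I • trunc n (nl₂ quartic' (u t) (v t)))).re) t := by
  have h1 : HasDerivAt (fun s => -(Complex.I • (truncD n (u s) - trunc n (nl quartic (u s)))))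
      (-(Complex.I • (truncD n (v t) - trunc n (nl₂ quartic' (u t) (v t))))) t :=
    (((hasDerivAt_clm_L2 (truncD n) (h.deriv t ht)).sub
      (hasDerivAt_clm_L2 (trunc n) (h.hasDerivAt_nl ht isC11_quartic))).const_smul Complex.I).neg
  have h2 : HasDerivAt (fun s => trunc n (v s))
      (-(Complex.I • (truncD n (v t) - trunc n (nl₂ quartic' (u t) (v t))))) t := by
    refine h1.congr_of_eventuallyEq ?_
    filter_upwards [h.mem_nhds ht] with s hs
    rw [h.eq' hs, map_neg, map_smul, map_sub, truncD_apply (h.inH_one hs)]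
  convert hasDerivAt_norm_sq_L2 h2 using 2
  have h4 : (inner ℂ (trunc n (v t)) (truncD n (v t))).im = 0 := by
    have he : (fun ξ => (truncSymbol n ξ : ℂ) * wt 1 ξ) =
        fun ξ => ((truncSymbol n ξ * bracket ξ ^ (1 : ℝ) : ℝ) : ℂ) := by
      ext ξ; rw [wt]; push_cast; ring
    have hm : MemMul (fun ξ => (truncSymbol n ξ : ℂ) * wt 1 ξ) (v t) :=
      (MemMul.of_bounded (C := n + 1) ((aesm_truncSymbol n).mul (aesm_wt 1)) (fun ξ => by
        rw [Pi.mul_apply, norm_mul, norm_wt, Complex.norm_real,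
          Real.norm_of_nonneg (truncSymbol_nonneg n ξ), Real.rpow_one]
        exact truncSymbol_mul_le n ξ) _).1
    rw [trunc, truncD, bmul_apply, bmul_apply]
    rw [he] at hm ⊢
    exact inner_fmul_fmul_im (memMul_truncSymbol n _) hm
  rw [smul_sub, neg_sub, inner_sub_right, inner_smul_right _ (truncD n (v t)), Complex.sub_re,
    Complex.mul_re (Complex.I) (inner ℂ _ (truncD n (v t))), h4]
  simp

/-- Evolution of `‖∂ₜu‖²`. -/
theorem norm_sq_sub (h : IsPath u v J) {a b : ℝ} (hab : Set.uIcc a b ⊆ J) :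
    ‖v b‖ ^ 2 - ‖v a‖ ^ 2 =
      ∫ s in a..b, 2 * (inner ℂ (v s) (Complex.I • nl₂ quartic' (u s) (v s))).re := by
  have hc (n : ℕ) (s : ℝ) (hs : s ∈ J) : ContinuousAt (fun s => 2 * (inner ℂ (trunc n (v s))
      (Complex.I • trunc n (nl₂ quartic' (u s) (v s)))).re) s := by
    have e1 : ContinuousAt (fun s => trunc n (v s)) s :=
      (trunc n).continuous.continuousAt.comp (h.continuousAt_v hs)
    have e2 : ContinuousAt (fun s => trunc n (nl₂ quartic' (u s) (v s))) s :=
      (trunc n).continuous.continuousAt.comp (h.continuousAt_nl₂ hs isC11_quartic)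
    exact (continuousAt_re_inner e1 (e2.const_smul Complex.I)).const_mul 2
  have hn (n : ℕ) : ‖trunc n (v b)‖ ^ 2 - ‖trunc n (v a)‖ ^ 2 = ∫ s in a..b,
      2 * (inner ℂ (trunc n (v s)) (Complex.I • trunc n (nl₂ quartic' (u s) (v s)))).re := by
    refine (intervalIntegral.integral_eq_sub_of_hasDerivAt
      (fun s hs => h.hasDerivAt_norm_sq_trunc (hab hs) n) ?_).symm
    exact ContinuousOn.intervalIntegrable fun s hs => (hc n s (hab hs)).continuousWithinAt
  have l1 : Tendsto (fun n => ‖trunc n (v b)‖ ^ 2 - ‖trunc n (v a)‖ ^ 2) atTop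
      (𝓝 (‖v b‖ ^ 2 - ‖v a‖ ^ 2)) :=
    ((tendsto_trunc _).norm.pow 2).sub ((tendsto_trunc _).norm.pow 2)
  refine tendsto_nhds_unique l1 ?_
  simp only [hn]
  -- The truncations are contractions converging strongly to the identity, so the limit `n → ∞`
  -- removes the cutoff.
  refine intervalIntegral.tendsto_integral_filter_of_dominated_convergence
    (fun s => 2 * (‖v s‖ * ‖nl₂ quartic' (u s) (v s)‖)) ?_ ?_ ?_ ?_
  · refine Eventually.of_forall fun n => ?_
    have : ContinuousOn (fun s => 2 * (inner ℂ (trunc n (v s))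
      (Complex.I • trunc n (nl₂ quartic' (u s) (v s)))).re) (Set.uIoc a b) := fun s hs =>
        (hc n s (hab (Set.uIoc_subset_uIcc hs))).continuousWithinAt
    exact this.aestronglyMeasurable measurableSet_uIoc
  · refine Eventually.of_forall fun n => Eventually.of_forall fun s _ => ?_
    rw [norm_mul, Real.norm_eq_abs, Real.norm_eq_abs, abs_two]
    refine mul_le_mul_of_nonneg_left ((abs_re_inner_le _ _).trans ?_) zero_le_two
    rw [norm_smul, Complex.norm_I, one_mul]
    exact mul_le_mul (norm_trunc_le _ _) (norm_trunc_le _ _) (norm_nonneg _) (norm_nonneg _)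
  · refine ContinuousOn.intervalIntegrable fun s hs => ContinuousAt.continuousWithinAt ?_
    exact ((h.continuousAt_v (hab hs)).norm.mul
      (h.continuousAt_nl₂ (hab hs) isC11_quartic).norm).const_mul 2
  · refine Eventually.of_forall fun s _ => ?_
    have := Complex.continuous_re.continuousAt.tendsto.comp
      ((tendsto_trunc (v s)).inner (𝕜 := ℂ) ((tendsto_trunc (nl₂ quartic' (u s) (v s))).const_smul
        Complex.I))
    exact this.const_mul 2

end IsPath

/-! ### The modified energy along a solution -/

/-- The potential part of the modified energy. -/
def potential (ε : ℝ) (hε : 0 < ε) (u : L2R) : ℝ :=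
  (inner ℂ (nl cubeAbs u) (kerOp ε hε (nl sqAbs u))).re

/-- `|u|³` and `|u|²` are both increasing functions of `|u|`, so the product of their differences is
nonnegative; it is at most `6R³` times the squared difference of `u`. -/
theorem re_inner_diff_cube_sq {u : L2R} {R : ℝ} (hu : AEBound u R) (h : ℝ) :
    0 ≤ (inner ℂ (diff h (nl cubeAbs u)) (diff h (nl sqAbs u))).re ∧
      (inner ℂ (diff h (nl cubeAbs u)) (diff h (nl sqAbs u))).re ≤
        6 * R ^ 3 * (inner ℂ (diff h u) (diff h u)).re := by
  have e4 := isC11_sqAbs.nl_ae hu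
  have e5 := isC11_cubeAbs.nl_ae hu
  have key : ∀ᵐ x, 0 ≤ ((starRingEnd ℂ) (diff h (nl cubeAbs u) x) * diff h (nl sqAbs u) x).re ∧
      ((starRingEnd ℂ) (diff h (nl cubeAbs u) x) * diff h (nl sqAbs u) x).re ≤
        6 * R ^ 3 * ((starRingEnd ℂ) (diff h u x) * diff h u x).re := by
    filter_upwards [diff_ae h (nl sqAbs u), diff_ae h (nl cubeAbs u), diff_ae h u, e4, e5,
      ae_shiftL h e4, ae_shiftL h e5, hu, ae_shiftL h hu] with x d1 d2 d3 f4 f5 g4 g5 k1 k2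
    rw [d1, d2, d3, f4, f5, g4, g5]
    generalize (u (x + h) : ℂ) = a at *
    generalize (u x : ℂ) = b at *
    rw [mul_comm ((starRingEnd ℂ) (a - b)), Complex.mul_conj, Complex.normSq_eq_norm_sq]
    simp only [cubeAbs, sqAbs, ← Complex.ofReal_sub, Complex.conj_ofReal, ← Complex.ofReal_mul,
      Complex.ofReal_re]
    have hR : 0 ≤ R := (norm_nonneg _).trans k1
    have h0 : (‖a‖ ^ 3 - ‖b‖ ^ 3) * (‖a‖ ^ 2 - ‖b‖ ^ 2) =
      ((‖a‖ ^ 2 + ‖a‖ * ‖b‖ + ‖b‖ ^ 2) * (‖a‖ + ‖b‖)) * |‖a‖ - ‖b‖| ^ 2 := by rw [sq_abs]; ring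
    rw [h0]
    refine ⟨by positivity, ?_⟩
    have h1 : (‖a‖ ^ 2 + ‖a‖ * ‖b‖ + ‖b‖ ^ 2) * (‖a‖ + ‖b‖) ≤
        (R ^ 2 + R * R + R ^ 2) * (R + R) := by gcongr
    calc _ ≤ ((R ^ 2 + R * R + R ^ 2) * (R + R)) * ‖a - b‖ ^ 2 := by
          gcongr
          exact abs_norm_sub_norm_le a b
      _ = _ := by ring
  obtain ⟨i1, j1⟩ := re_inner_eq_integral (diff h (nl cubeAbs u)) (diff h (nl sqAbs u))
  obtain ⟨i2, j2⟩ := re_inner_eq_integral (diff h u) (diff h u)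
  rw [j1, j2, ← integral_const_mul]
  exact ⟨integral_nonneg_of_ae (key.mono fun x hx => hx.1),
    integral_mono_ae i1 (i2.const_mul _) (key.mono fun x hx => hx.2)⟩

theorem re_inner_kerSymbol {ε : ℝ} (hε : 0 < ε) (f g : L2R) :
    IntegrableOn (fun h => (h ^ 2)⁻¹ * (inner ℂ (diff h f) (diff h g)).re) (Set.Ioi ε) ∧
      (inner ℂ f (fmul (fun ξ => (kerSymbol ε ξ : ℂ)) g)).re =
        ∫ h in Set.Ioi ε, (h ^ 2)⁻¹ * (inner ℂ (diff h f) (diff h g)).re := by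
  obtain ⟨i, j⟩ := inner_fmul_kerSymbol hε f g
  have i' := i.re
  have e : (fun h => RCLike.re (((h ^ 2)⁻¹ : ℝ) * inner ℂ (diff h f) (diff h g) : ℂ)) =
      fun h => (h ^ 2)⁻¹ * (inner ℂ (diff h f) (diff h g)).re := by
    ext h; exact Complex.re_ofReal_mul _ _
  have j' := integral_re i
  rw [e] at i' j'
  refine ⟨i', ?_⟩
  rw [j, j']; rfl

/-- Nonnegativity lets the modified energy control `‖∂ₜu‖²` at the final time; the upper bound,
uniform in `ε`, is used only at the initial time. -/
theorem potential_bounds {u : L2R} {R ε : ℝ} (hε : 0 < ε) (hu : AEBound u R) (hu1 : InH 1 u) :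
    0 ≤ potential ε hε u ∧
      potential ε hε u ≤ 6 * R ^ 3 * (‖u‖ * (kerSymbol 0 1 * hNorm 1 u)) := by
  obtain ⟨i1, j1⟩ := re_inner_kerSymbol hε (nl cubeAbs u) (nl sqAbs u)
  obtain ⟨i2, j2⟩ := re_inner_kerSymbol hε u u
  have hR := hu.nonneg
  rw [potential, kerOp, bmul_apply, j1]
  constructor
  · exact setIntegral_nonneg measurableSet_Ioi fun h _ =>
      mul_nonneg (by positivity) (re_inner_diff_cube_sq hu h).1
  · calc _ ≤ ∫ h in Set.Ioi ε, 6 * R ^ 3 * ((h ^ 2)⁻¹ * (inner ℂ (diff h u) (diff h u)).re) := by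
          refine integral_mono i1 (i2.const_mul _) fun h => ?_
          have := mul_le_mul_of_nonneg_left (re_inner_diff_cube_sq hu h).2
            (show 0 ≤ (h ^ 2)⁻¹ by positivity)
          calc _ ≤ _ := this
            _ = _ := by ring
      _ = 6 * R ^ 3 * (inner ℂ u (fmul (fun ξ => (kerSymbol ε ξ : ℂ)) u)).re := by
          rw [integral_const_mul, j2]
      _ ≤ _ := by
          refine mul_le_mul_of_nonneg_left ?_ (by positivity)
          refine (le_abs_self _).trans ((abs_re_inner_le _ _).trans ?_)
          exact mul_le_mul_of_nonneg_left (memMul_kerSymbol hε.le hu1).2 (norm_nonneg _)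

namespace IsPath
variable {u v : ℝ → L2R} {J : Set ℝ}

/-- The derivative of the potential energy along a path. -/
def _root_.potential' (ε : ℝ) (hε : 0 < ε) (u v : L2R) : ℝ :=
  (inner ℂ (nl₂ cubeAbs' u v) (kerOp ε hε (nl sqAbs u))).re +
    (inner ℂ (nl cubeAbs u) (kerOp ε hε (nl₂ sqAbs' u v))).re

theorem hasDerivAt_potential (h : IsPath u v J) {ε t : ℝ} (hε : 0 < ε) (ht : t ∈ J) :
    HasDerivAt (fun s => potential ε hε (u s)) (potential' ε hε (u t) (v t)) t := by
  have := hasDerivAt_re_inner (h.hasDerivAt_nl ht isC11_cubeAbs)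
    (hasDerivAt_clm_L2 (kerOp ε hε) (h.hasDerivAt_nl ht isC11_sqAbs))
  rw [add_comm] at this
  exact this

theorem continuousAt_potential' (h : IsPath u v J) {ε t : ℝ} (hε : 0 < ε) (ht : t ∈ J) :
    ContinuousAt (fun s => potential' ε hε (u s) (v s)) t := by
  have e1 : ContinuousAt (fun s => kerOp ε hε (nl sqAbs (u s))) t :=
    (kerOp ε hε).continuous.continuousAt.comp (h.hasDerivAt_nl ht isC11_sqAbs).continuousAt
  have e2 : ContinuousAt (fun s => kerOp ε hε (nl₂ sqAbs' (u s) (v s))) t :=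
    (kerOp ε hε).continuous.continuousAt.comp (h.continuousAt_nl₂ ht isC11_sqAbs)
  exact (continuousAt_re_inner (h.continuousAt_nl₂ ht isC11_cubeAbs) e1).add
    (continuousAt_re_inner (h.hasDerivAt_nl ht isC11_cubeAbs).continuousAt e2)

theorem continuousAt_kin (h : IsPath u v J) {t : ℝ} (ht : t ∈ J) : ContinuousAt
    (fun s => 2 * (inner ℂ (v s) (Complex.I • nl₂ quartic' (u s) (v s))).re) t :=
  (continuousAt_re_inner (h.continuousAt_v ht)
    ((h.continuousAt_nl₂ ht isC11_quartic).const_smul Complex.I)).const_mul 2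

theorem energy_sub (h : IsPath u v J) {ε a b : ℝ} (hε : 0 < ε) (hab : Set.uIcc a b ⊆ J) :
    (‖v b‖ ^ 2 + kerConst / 2 * potential ε hε (u b)) -
        (‖v a‖ ^ 2 + kerConst / 2 * potential ε hε (u a)) =
      ∫ s in a..b, (2 * (inner ℂ (v s) (Complex.I • nl₂ quartic' (u s) (v s))).re +
        kerConst / 2 * potential' ε hε (u s) (v s)) := by
  have c1 : ContinuousOn (fun s => 2 * (inner ℂ (v s) (Complex.I • nl₂ quartic' (u s) (v s))).re)
    (Set.uIcc a b) := fun s hs => (h.continuousAt_kin (hab hs)).continuousWithinAt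
  have c2 : ContinuousOn (fun s => potential' ε hε (u s) (v s)) (Set.uIcc a b) :=
    fun s hs => (h.continuousAt_potential' hε (hab hs)).continuousWithinAt
  rw [intervalIntegral.integral_add c1.intervalIntegrable (c2.intervalIntegrable.const_mul _),
    intervalIntegral.integral_const_mul (kerConst / 2), ← h.norm_sq_sub hab,
    intervalIntegral.integral_eq_sub_of_hasDerivAt
      (fun s hs => h.hasDerivAt_potential hε (hab hs)) c2.intervalIntegrable]
  ring

/-- The size of the part of `|D|u` missed by the truncated operator. -/
def _root_.kerErr (ε : ℝ) (u : L2R) : ℝ :=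
  ‖fmul (fun ξ => (kerSymbol 0 ξ : ℂ)) u - fmul (fun ξ => (kerSymbol ε ξ : ℂ)) u‖

theorem _root_.kerErr_le {ε : ℝ} (hε : 0 ≤ ε) {u : L2R} (hu : InH 1 u) :
    kerErr ε u ≤ 2 * (kerSymbol 0 1 * hNorm 1 u) := by
  refine (norm_sub_le _ _).trans ?_
  linarith [(memMul_kerSymbol le_rfl hu).2, (memMul_kerSymbol hε hu).2]

theorem _root_.tendsto_kerErr {u : L2R} (hu : InH 1 u) :
    Tendsto (fun n : ℕ => kerErr (1 / (n + 1)) u) atTop (𝓝 0) := by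
  have h0 (ε : ℝ) (ξ : ℝ) : ‖(kerSymbol ε ξ : ℂ)‖ = kerSymbol ε ξ := by
    rw [Complex.norm_real, Real.norm_of_nonneg (kerSymbol_nonneg ε ξ)]
  have := tendsto_fmul (l := atTop) (m := fun (n : ℕ) ξ => (kerSymbol (1 / (n + 1)) ξ : ℂ))
    (m₀ := fun ξ => (kerSymbol 0 ξ : ℂ)) (G := fun ξ => (kerSymbol 0 ξ : ℂ)) (f := u)
    (memMul_kerSymbol le_rfl hu).1 (fun n => aesm_kerSymbol _) (aesm_kerSymbol 0)
    (Eventually.of_forall fun n ξ => by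
      rw [h0, h0]; exact kerSymbol_le_zero (by positivity) ξ) (fun _ => le_rfl)
    fun ξ => (Complex.continuous_ofReal.tendsto _).comp (tendsto_kerSymbol ξ)
  have h1 := (this.const_sub (fmul (fun ξ => (kerSymbol 0 ξ : ℂ)) u)).norm
  rwa [sub_self, norm_zero] at h1

theorem continuousAt_kerErr (h : IsPath u v J) {ε t : ℝ} (hε : 0 ≤ ε) (ht : t ∈ J) :
    ContinuousAt (fun s => kerErr ε (u s)) t := by
  have key {ε : ℝ} (hε : 0 ≤ ε) : ∀ ξ, ‖(kerSymbol ε ξ : ℂ)‖ ≤ kerSymbol 0 1 * ‖wt (3 / 2) ξ‖ := by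
    intro ξ
    rw [Complex.norm_real, Real.norm_of_nonneg (kerSymbol_nonneg ε ξ)]
    refine (kerSymbol_le_zero hε ξ).trans ?_
    rw [kerSymbol_zero_eq, mul_comm]
    refine mul_le_mul_of_nonneg_left ?_ kerSymbol_zero_one_pos.le
    refine le_trans ?_ (norm_wt_mono (show (1 : ℝ) ≤ 3 / 2 by norm_num) ξ)
    rw [norm_wt, Real.rpow_one]
    exact le_trans (by nlinarith [abs_nonneg ξ, Real.pi_gt_three]) (abs_le_bracket ξ)
  exact ((h.continuousAt_fmul ht (aesm_kerSymbol 0) (key le_rfl)).sub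
    (h.continuousAt_fmul ht (aesm_kerSymbol ε) (key hε))).norm

theorem continuousAt_hNorm_one (h : IsPath u v J) {t : ℝ} (ht : t ∈ J) :
    ContinuousAt (fun s => hNorm 1 (u s)) t :=
  (h.continuousAt_hNorm ht (by norm_num)).norm

/-- At a fixed time, the energy inequality in terms of `‖∂ₜu‖` alone. -/
theorem exists_energy_bound (h : IsPath u v J) {A : ℝ} (hA1 : 1 ≤ A)
    (hA : ∀ t ∈ J, hNorm (1 / 2) (u t) ≤ A) :
    ∃ C, 0 ≤ C ∧ ∀ t ∈ J, hNorm 1 (u t) ≤ 2 * ‖v t‖ + C ∧ ∀ (ε : ℝ) (hε : 0 < ε),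
      |2 * (inner ℂ (v t) (Complex.I • nl₂ quartic' (u t) (v t))).re +
        kerConst / 2 * potential' ε hε (u t) (v t)| ≤ C * osgood (‖v t‖ ^ 2) +
        6 * (3 * hNorm 1 (u t)) ^ 3 * ‖v t‖ * kerConst * kerErr ε (u t) := by
  obtain ⟨C, hC, H⟩ := exists_osgood_const hA1
  refine ⟨C, hC, fun t ht => ?_⟩
  have h1 := h.inH_one ht
  have hR : AEBound (u t) (wiener (u t)) := ae_norm_le_wiener h1
  have hR0 := wiener_nonneg (u t)
  have hw0 : 0 ≤ hNorm 1 (u t) := norm_nonneg _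
  have huA : ‖u t‖ ≤ A :=
    (norm_le_hNorm (by norm_num) (InH.mono (by norm_num) h1).1).trans (hA t ht)
  -- The equation is solved for `√(1-Δ)u`, so that the time derivative controls the space
  -- derivative.
  have hw : hNorm 1 (u t) ≤ ‖v t‖ + wiener (u t) ^ 3 * A := by
    have e : fmul (wt 1) (u t) = Complex.I • v t + nl quartic (u t) := by
      rw [h.eq t ht]; abel
    rw [hNorm, e]
    refine (norm_add_le _ _).trans ?_
    rw [norm_smul, Complex.norm_I, one_mul]
    have := (norm_nl_quartic_le hR).trans (mul_le_mul_of_nonneg_left huA (by positivity))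
    linarith
  obtain ⟨c1, c2⟩ := H _ _ ‖v t‖ hR0 hw0 (norm_nonneg _)
    (brezis_gallouet h1 (hA t ht) le_rfl) hw
  refine ⟨c1, fun ε hε => ?_⟩
  refine (energy_inequality hε hR h1 (h.eq t ht) hA1 (B := 1 + hNorm 1 (u t)) (by linarith)
    (hA t ht) (by linarith)).trans ?_
  have d1 : 6 * wiener (u t) ^ 3 * ‖v t‖ * ‖u t‖ * (1 + wiener (u t) ^ 3) ≤
      6 * wiener (u t) ^ 3 * ‖v t‖ * A * (1 + wiener (u t) ^ 3) := by gcongr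
  have d2 : 6 * wiener (u t) ^ 3 * ‖v t‖ * kerConst * kerErr ε (u t) ≤
      6 * (3 * hNorm 1 (u t)) ^ 3 * ‖v t‖ * kerConst * kerErr ε (u t) := by
    have := kerConst_pos
    have := wiener_le_three h1
    have : 0 ≤ kerErr ε (u t) := norm_nonneg _
    gcongr
  rw [kerErr] at d2 ⊢
  linarith

/-- The integral inequality for `‖∂ₜu‖²`. -/
theorem exists_integral_inequality (h : IsPath u v J) {A a : ℝ} (hA1 : 1 ≤ A)
    (hA : ∀ t ∈ J, hNorm (1 / 2) (u t) ≤ A) (ha : a ∈ J) :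
    ∃ C E, 0 ≤ C ∧ 0 ≤ E ∧ (∀ t ∈ J, hNorm 1 (u t) ≤ 2 * ‖v t‖ + C) ∧
      ∀ b, Set.uIcc a b ⊆ J →
        ‖v b‖ ^ 2 ≤ E + |∫ s in a..b, C * osgood (‖v s‖ ^ 2)| := by
  obtain ⟨C, hC, H⟩ := h.exists_energy_bound hA1 hA
  have hκ := kerConst_pos
  set E := ‖v a‖ ^ 2 + kerConst / 2 *
    (6 * (3 * hNorm 1 (u a)) ^ 3 * (‖u a‖ * (kerSymbol 0 1 * hNorm 1 (u a)))) with hE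
  have hE0 : 0 ≤ E := by
    have := kerSymbol_zero_one_pos
    have : 0 ≤ hNorm 1 (u a) := norm_nonneg _
    positivity
  refine ⟨C, E, hC, hE0, fun t ht => (H t ht).1, fun b hab => ?_⟩
  set Q : ℝ → ℝ := fun s => 6 * (3 * hNorm 1 (u s)) ^ 3 * ‖v s‖ * kerConst with hQ
  have hQ0 (s : ℝ) : 0 ≤ Q s := by
    have : 0 ≤ hNorm 1 (u s) := norm_nonneg _
    positivity
  have cv : ContinuousOn v (Set.uIcc a b) := fun s hs =>
    (h.continuousAt_v (hab hs)).continuousWithinAt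
  have ch : ContinuousOn (fun s => hNorm 1 (u s)) (Set.uIcc a b) := fun s hs =>
    (h.continuousAt_hNorm_one (hab hs)).continuousWithinAt
  have cQ : ContinuousOn Q (Set.uIcc a b) :=
    ((((ch.const_mul 3).pow 3).const_mul 6).mul cv.norm).mul_const _
  have co : ContinuousOn (fun s => C * osgood (‖v s‖ ^ 2)) (Set.uIcc a b) :=
    (continuousOn_osgood (cv.norm.pow 2) fun s _ => sq_nonneg _).const_mul C
  have ce {ε : ℝ} (hε : 0 < ε) : ContinuousOn (fun s => kerErr ε (u s)) (Set.uIcc a b) :=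
    fun s hs => (h.continuousAt_kerErr hε.le (hab hs)).continuousWithinAt
  have cQe {ε : ℝ} (hε : 0 < ε) : ContinuousOn (fun s => Q s * kerErr ε (u s)) (Set.uIcc a b) :=
    cQ.mul (ce hε)
  have hb : b ∈ J := hab Set.right_mem_uIcc
  have key {ε : ℝ} (hε : 0 < ε) : ‖v b‖ ^ 2 ≤ E + |∫ s in a..b, C * osgood (‖v s‖ ^ 2)| +
      |∫ s in a..b, Q s * kerErr ε (u s)| := by
    have e1 := h.energy_sub hε hab
    have p1 := (potential_bounds hε (aeBound_hNorm (h.inH_one hb)) (h.inH_one hb)).1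
    have p2 := (potential_bounds hε (aeBound_hNorm (h.inH_one ha)) (h.inH_one ha)).2
    have i1 : |∫ s in a..b, (2 * (inner ℂ (v s) (Complex.I • nl₂ quartic' (u s) (v s))).re +
        kerConst / 2 * potential' ε hε (u s) (v s))| ≤
        |∫ s in a..b, (C * osgood (‖v s‖ ^ 2) + Q s * kerErr ε (u s))| := by
      have ic : IntervalIntegrable (fun s => C * osgood (‖v s‖ ^ 2) + Q s * kerErr ε (u s))
        volume a b := co.intervalIntegrable.add (cQe hε).intervalIntegrable
      rw [← Real.norm_eq_abs]
      refine intervalIntegral.norm_integral_le_abs_of_norm_le ?_ ic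
      refine (ae_restrict_mem measurableSet_uIoc).mono fun s hs => ?_
      exact (H s (hab (Set.uIoc_subset_uIcc hs))).2 ε hε
    rw [intervalIntegral.integral_add co.intervalIntegrable (cQe hε).intervalIntegrable]
      at i1
    have i2 := abs_add_le (∫ s in a..b, C * osgood (‖v s‖ ^ 2)) (∫ s in a..b, Q s * kerErr ε (u s))
    have i3 := le_abs_self (∫ s in a..b, (2 * (inner ℂ (v s)
      (Complex.I • nl₂ quartic' (u s) (v s))).re + kerConst / 2 * potential' ε hε (u s) (v s)))
    have p3 := mul_nonneg (half_pos hκ).le p1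
    have p4 := mul_le_mul_of_nonneg_left p2 (half_pos hκ).le
    linarith
  -- Here `ε = 1/(n+1) → 0`: at each time the error tends to zero as `u s ∈ H^1`, and it is
  -- dominated uniformly in `n` on the compact time interval. The constant `E` does not depend on
  -- `ε`, so the error disappears in the limit.
  have lim : Tendsto (fun n : ℕ => ∫ s in a..b, Q s * kerErr (1 / ((n : ℝ) + 1)) (u s)) atTop
      (𝓝 (∫ s in a..b, Q s * 0)) := by
    refine intervalIntegral.tendsto_integral_filter_of_dominated_convergence
      (fun s => Q s * (2 * (kerSymbol 0 1 * hNorm 1 (u s)))) ?_ ?_ ?_ ?_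
    · refine Eventually.of_forall fun n => ContinuousOn.aestronglyMeasurable ?_ measurableSet_uIoc
      exact (cQ.mul (ce (by positivity))).mono Set.uIoc_subset_uIcc
    · refine Eventually.of_forall fun n => Eventually.of_forall fun s hs => ?_
      have h0 : 0 ≤ kerErr (1 / ((n : ℝ) + 1)) (u s) := norm_nonneg _
      rw [Real.norm_of_nonneg (mul_nonneg (hQ0 s) h0)]
      exact mul_le_mul_of_nonneg_left
        (kerErr_le (by positivity) (h.inH_one (hab (Set.uIoc_subset_uIcc hs)))) (hQ0 s)
    · exact (cQ.mul ((ch.const_mul _).const_mul 2)).intervalIntegrable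
    · refine Eventually.of_forall fun s hs => ?_
      exact (tendsto_kerErr (h.inH_one (hab (Set.uIoc_subset_uIcc hs)))).const_mul _
  simp only [mul_zero, intervalIntegral.integral_zero] at lim
  have lim' := lim.abs.const_add (E + |∫ s in a..b, C * osgood (‖v s‖ ^ 2)|)
  rw [abs_zero, add_zero] at lim'
  exact ge_of_tendsto lim' (Eventually.of_forall fun n => key (by positivity))

end IsPath

/-! ### Second differences and the tame estimate in `H^{3/2}` -/

theorem integrableOn_inv_pow_four : IntegrableOn (fun h : ℝ => (h ^ 4)⁻¹) (Set.Ioi 1) := by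
  have := integrableOn_Ioi_rpow_of_lt (a := -4) (by norm_num) one_pos
  refine this.congr_fun (fun h hh => ?_) measurableSet_Ioi
  have h0 : (0 : ℝ) < h := one_pos.trans hh
  simp only
  rw [Real.rpow_neg h0.le]; norm_num

theorem integral_inv_pow_four_le : ∫ h in Set.Ioi (1 : ℝ), (h ^ 4)⁻¹ ≤ 1 := by
  refine le_trans (setIntegral_mono_on integrableOn_inv_pow_four (integrableOn_inv_sq one_pos)
    measurableSet_Ioi fun h hh => ?_) (by rw [integral_inv_sq one_pos, inv_one])
  have h0 : (1 : ℝ) < h := hh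
  exact inv_anti₀ (by positivity) (pow_le_pow_right₀ h0.le (by norm_num))

theorem measurable_secKer : Measurable fun p : ℝ × ℝ => ‖diffSymbol p.1 p.2‖ ^ 4 / p.1 ^ 4 :=
  (continuous_diffSymbol_uncurry.norm.pow 4).measurable.div (measurable_fst.pow_const 4)

/-- The symbol of the square function of second differences. -/
def secSymbol (ξ : ℝ) : ℝ := ∫ h in Set.Ioi 0, ‖diffSymbol h ξ‖ ^ 4 / h ^ 4

theorem integrableOn_secKer (ξ : ℝ) :
    IntegrableOn (fun h => ‖diffSymbol h ξ‖ ^ 4 / h ^ 4) (Set.Ioi 0) := by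
  have hm : AEStronglyMeasurable (fun h => ‖diffSymbol h ξ‖ ^ 4 / h ^ 4) volume :=
    (measurable_secKer.comp (measurable_id.prodMk measurable_const)).aestronglyMeasurable
  rw [← Set.Ioc_union_Ioi_eq_Ioi (zero_le_one' ℝ)]
  refine IntegrableOn.union ?_ ?_
  · refine Measure.integrableOn_of_bounded (M := (2 * Real.pi * |ξ|) ^ 4) (by simp) hm ?_
    refine (ae_restrict_iff' measurableSet_Ioc).2 (Eventually.of_forall fun h hh => ?_)
    have h0 : 0 < h := hh.1
    rw [Real.norm_of_nonneg (by positivity), div_le_iff₀ (by positivity), ← mul_pow]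
    refine pow_le_pow_left₀ (norm_nonneg _) ((norm_diffSymbol_le h ξ).trans_eq ?_) 4
    rw [abs_of_pos h0]; ring
  · refine Integrable.mono' (integrableOn_inv_pow_four.const_mul 16) hm.restrict ?_
    refine Eventually.of_forall fun h => ?_
    rw [Real.norm_of_nonneg (by positivity), div_eq_mul_inv]
    have : ‖diffSymbol h ξ‖ ^ 4 ≤ 2 ^ 4 :=
      pow_le_pow_left₀ (norm_nonneg _) (norm_diffSymbol_le_two h ξ) 4
    gcongr
    linarith

theorem secSymbol_eq (ξ : ℝ) : secSymbol ξ = |ξ| ^ 3 * secSymbol 1 := by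
  have hs (h : ℝ) : ‖diffSymbol h ξ‖ ^ 2 = ‖diffSymbol h |ξ|‖ ^ 2 := by
    rw [norm_diffSymbol_sq, norm_diffSymbol_sq]
    rcases abs_cases ξ with ⟨e, _⟩ | ⟨e, _⟩
    · rw [e]
    · rw [e, mul_neg, mul_neg, Real.cos_neg]
  rcases eq_or_ne ξ 0 with rfl | hξ
  · simp [secSymbol, diffSymbol, transSymbol]
  · have hp : 0 < |ξ| := abs_pos.2 hξ
    have := integral_comp_mul_left_Ioi (fun h => ‖diffSymbol h 1‖ ^ 4 / h ^ 4) 0 hp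
    rw [mul_zero, smul_eq_mul] at this
    have h2 : ∫ h in Set.Ioi (0 : ℝ), ‖diffSymbol (|ξ| * h) 1‖ ^ 4 / (|ξ| * h) ^ 4 =
        (|ξ| ^ 4)⁻¹ * secSymbol ξ := by
      rw [secSymbol, ← integral_const_mul]
      refine integral_congr_ae (Eventually.of_forall fun h => ?_)
      simp only [show 4 = 2 * 2 from rfl, pow_mul, hs h, norm_diffSymbol_sq, mul_pow, mul_one,
        mul_comm |ξ| h]
      rw [div_eq_mul_inv, mul_inv]; ring
    rw [h2] at this
    change _ = |ξ|⁻¹ * secSymbol 1 at this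
    field_simp at this
    linarith

theorem secSymbol_one_pos : 0 < secSymbol 1 := by
  refine (setIntegral_pos_iff_support_of_nonneg_ae (Eventually.of_forall fun _ => by positivity)
    (integrableOn_secKer 1)).2 ?_
  refine lt_of_lt_of_le (b := volume (Set.Ioo (1 / 4 : ℝ) (1 / 2))) (by simp; norm_num)
    (measure_mono fun h hh => ⟨?_, ?_⟩)
  · have h0 : 0 < h := by linarith [hh.1]
    rw [Function.mem_support]
    have hc : Real.cos (2 * Real.pi * (h * 1)) ≤ 0 := by
      have := Real.pi_pos
      apply Real.cos_nonpos_of_pi_div_two_le_of_le <;> nlinarith [hh.1, hh.2]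
    have h1 : 0 < ‖diffSymbol h 1‖ ^ 2 := by rw [norm_diffSymbol_sq]; linarith
    have h2 : ‖diffSymbol h 1‖ ^ 4 = (‖diffSymbol h 1‖ ^ 2) ^ 2 := by ring
    rw [h2]; positivity
  · exact lt_trans (by norm_num) hh.1

/-- The square of the homogeneous `H^{3/2}` seminorm, in terms of second differences. -/
def secSemi (f : L2R) : ℝ≥0∞ :=
  ∫⁻ h in Set.Ioi (0 : ℝ), ENNReal.ofReal (h ^ 4)⁻¹ * ‖diff h (diff h f)‖ₑ ^ 2

theorem enorm_diff_diff_sq (h : ℝ) (f : L2R) :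
    ‖diff h (diff h f)‖ₑ ^ 2 = ∫⁻ ξ, ENNReal.ofReal (‖diffSymbol h ξ‖ ^ 4) * ‖(𝓕 f : L2R) ξ‖ₑ ^ 2 := by
  have h1 := memMul_diffSymbol h f
  obtain ⟨-, h2⟩ := MemMul.comp (m₁ := diffSymbol h) h1
    ((MemMul.comp_iff h1).1 (memMul_diffSymbol h _))
  rw [diff_eq_fmul h (diff h f), diff_eq_fmul h f, h2,
    enorm_fmul_sq ((MemMul.comp_iff h1).1 (memMul_diffSymbol h _))]
  refine lintegral_congr fun ξ => ?_
  congr 1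
  rw [← ofReal_norm, ← ENNReal.ofReal_pow (norm_nonneg _), norm_mul]
  congr 1; ring

/-- Tonelli and the scaling of `secSymbol`. Second differences are needed because the weight `h⁻⁴`
is too singular at `0` for first ones; in `ℝ≥0∞` the identity needs no regularity and can therefore
prove membership in `H^{3/2}`. -/
theorem secSemi_eq (f : L2R) : secSemi f = ENNReal.ofReal (secSymbol 1) *
    ∫⁻ ξ, ENNReal.ofReal (|ξ| ^ 3) * ‖(𝓕 f : L2R) ξ‖ₑ ^ 2 := by
  have hm : AEMeasurable (fun ξ => ‖(𝓕 f : L2R) ξ‖ₑ ^ 2) volume :=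
    (Lp.aestronglyMeasurable _).enorm.pow_const 2
  have e1 : secSemi f = ∫⁻ h in Set.Ioi (0 : ℝ), ∫⁻ ξ,
      ENNReal.ofReal (‖diffSymbol h ξ‖ ^ 4 / h ^ 4) * ‖(𝓕 f : L2R) ξ‖ₑ ^ 2 := by
    refine lintegral_congr fun h => ?_
    rw [enorm_diff_diff_sq, ← lintegral_const_mul' _ _ ENNReal.ofReal_ne_top]
    refine lintegral_congr fun ξ => ?_
    rw [← mul_assoc, ← ENNReal.ofReal_mul (by positivity), div_eq_mul_inv, mul_comm (h ^ 4)⁻¹]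
  have hm2 : AEMeasurable (Function.uncurry fun (h ξ : ℝ) =>
      ENNReal.ofReal (‖diffSymbol h ξ‖ ^ 4 / h ^ 4) * ‖(𝓕 f : L2R) ξ‖ₑ ^ 2)
      ((volume.restrict (Set.Ioi 0)).prod volume) :=
    (measurable_secKer.ennreal_ofReal.aemeasurable).mul
      (hm.comp_quasiMeasurePreserving Measure.quasiMeasurePreserving_snd)
  have hc : ENNReal.ofReal (secSymbol 1) ≠ ⊤ := ENNReal.ofReal_ne_top
  rw [e1, lintegral_lintegral_swap hm2, ← lintegral_const_mul' _ _ hc]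
  refine lintegral_congr fun ξ => ?_
  rw [lintegral_mul_const' _ _ (by simp), ← mul_assoc]
  congr 1
  rw [← ofReal_integral_eq_lintegral_ofReal (integrableOn_secKer ξ)
    (Eventually.of_forall fun _ => by positivity)]
  change ENNReal.ofReal (secSymbol ξ) = _
  rw [secSymbol_eq, mul_comm, ENNReal.ofReal_mul secSymbol_one_pos.le]

theorem sobolevENorm_three_half_sq (f : L2R) : sobolevENorm (3 / 2) f ^ 2 =
    ∫⁻ ξ, ENNReal.ofReal (bracket ξ ^ 3) * ‖(𝓕 f : L2R) ξ‖ₑ ^ 2 := by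
  have h := eLpNorm_nnreal_pow_eq_lintegral (p := 2) (μ := volume) (by norm_num)
    (f := fun ξ : ℝ => ((bracket ξ ^ (3 / 2 : ℝ) : ℝ) : ℂ) * (𝓕 f : L2R) ξ)
  simp only [ENNReal.coe_ofNat, NNReal.coe_ofNat, ENNReal.rpow_ofNat] at h
  rw [sobolevENorm, h]
  refine lintegral_congr fun ξ => ?_
  have hb := bracket_pos ξ
  rw [enorm_mul, mul_pow]
  congr 1
  rw [← ofReal_norm, ← ENNReal.ofReal_pow (norm_nonneg _), Complex.norm_real,
    Real.norm_of_nonneg (by positivity)]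
  congr 1
  rw [← Real.rpow_natCast, ← Real.rpow_mul hb.le]
  norm_num

theorem secSemi_le (f : L2R) :
    secSemi f ≤ ENNReal.ofReal (secSymbol 1) * sobolevENorm (3 / 2) f ^ 2 := by
  rw [secSemi_eq, sobolevENorm_three_half_sq]
  gcongr with ξ
  exact le_trans (by nlinarith [abs_nonneg ξ, Real.pi_gt_three]) (abs_le_bracket ξ)

theorem sobolevENorm_sq_le (f : L2R) : sobolevENorm (3 / 2) f ^ 2 ≤
    4 * ‖f‖ₑ ^ 2 + ENNReal.ofReal (4 * (2 * Real.pi) ^ 3 / secSymbol 1) * secSemi f := by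
  have hc := secSymbol_one_pos
  have hm : AEMeasurable (fun ξ => ‖(𝓕 f : L2R) ξ‖ₑ ^ 2) volume :=
    (Lp.aestronglyMeasurable _).enorm.pow_const 2
  have hp : 0 ≤ 4 * (2 * Real.pi) ^ 3 := by positivity
  rw [secSemi_eq, sobolevENorm_three_half_sq, ← mul_assoc, ← ENNReal.ofReal_mul (by positivity),
    div_mul_cancel₀ _ hc.ne', ← enorm_fourier f, enorm_sq_eq_lintegral,
    ← lintegral_const_mul' _ _ (by norm_num), ← lintegral_const_mul' _ _ ENNReal.ofReal_ne_top,
    ← lintegral_add_left' (hm.const_mul 4)]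
  refine lintegral_mono fun ξ => ?_
  simp only
  rw [← mul_assoc, ← add_mul, ← ENNReal.ofReal_mul hp]
  gcongr
  rw [show (4 : ℝ≥0∞) = ENNReal.ofReal 4 by norm_num,
    ← ENNReal.ofReal_add (by norm_num) (by positivity)]
  refine ENNReal.ofReal_le_ofReal ?_
  have h1 := pow_le_pow_left₀ (bracket_pos ξ).le (bracket_le ξ) 3
  refine h1.trans ?_
  set x := 2 * Real.pi * |ξ| with hx
  have hx0 : 0 ≤ x := by positivity
  have : 4 * (2 * Real.pi) ^ 3 * |ξ| ^ 3 = 4 * x ^ 3 := by rw [hx]; ring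
  rw [this]
  nlinarith [mul_nonneg (add_nonneg zero_le_one hx0) (sq_nonneg (x - 1))]

/-- Taylor expansion from the middle point in both directions: the linear parts combine into the
differential applied to the second difference of `u`, and the remainders are quadratic in first
differences. `C^{1,1}` regularity is enough. -/
theorem norm_diff_diff_nl_le {F : ℂ → ℂ} {G : ℂ → ℂ → ℂ} {K : ℝ → ℝ} (hF : IsC11 F G K) {u : L2R}
    {R S h : ℝ} (hu : AEBound u R) (hS : AEBound (diff h u) S) :
    ‖diff h (diff h (nl F u))‖ ≤ K R * (‖diff h (diff h u)‖ + 2 * (S * ‖diff h u‖)) := by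
  have hR := hu.nonneg
  have hS0 := hS.nonneg
  have hK := hF.nonneg hR
  have e := hF.nl_ae hu
  have key : ∀ᵐ x, ‖diff h (diff h (nl F u)) x‖ ≤ K R * (‖diff h (diff h u) x‖ +
      (S * ‖shiftL h (diff h u) x‖ + S * ‖diff h u x‖)) := by
    have d (f : L2R) := diff_ae h f
    filter_upwards [d (diff h (nl F u)), d (nl F u), ae_shiftL h (d (nl F u)), e, ae_shiftL h e,
      ae_shiftL h (ae_shiftL h e), d (diff h u), d u, ae_shiftL h (d u), shiftL_ae h (diff h u),
      hu, ae_shiftL h hu, ae_shiftL h (ae_shiftL h hu), hS, ae_shiftL h hS]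
      with x a1 a2 a3 a4 a5 a6 a7 a8 a9 a10 b1 b2 b3 s1 s2
    rw [a3] at a1
    rw [a9] at a7 a10 s2
    rw [a1, a2, a7, a8, a10, a4, a5, a6]
    rw [a8] at s1
    generalize (u (x + h + h) : ℂ) = a at *
    generalize (u (x + h) : ℂ) = b at *
    generalize (u x : ℂ) = c at *
    have t1 := hF.taylor b3 b2
    have t2 := hF.taylor b1 b2
    have t3 := hF.bound (a - b - (b - c)) b2
    have e1 : F a - F b - (F b - F c) = (F a - F b - G b (a - b)) + (F c - F b - G b (c - b)) +
        G b (a - b - (b - c)) := by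
      have : a - b - (b - c) = (a - b) + (c - b) := by ring
      rw [this, hF.map_add]; ring
    rw [e1]
    refine (norm_add₃_le).trans ?_
    rw [norm_sub_rev c b] at t2
    have u1 : ‖a - b‖ ^ 2 ≤ S * ‖a - b‖ := by
      rw [sq]; exact mul_le_mul_of_nonneg_right s2 (norm_nonneg _)
    have u2 : ‖b - c‖ ^ 2 ≤ S * ‖b - c‖ := by
      rw [sq]; exact mul_le_mul_of_nonneg_right s1 (norm_nonneg _)
    have v1 := mul_le_mul_of_nonneg_left u1 hK
    have v2 := mul_le_mul_of_nonneg_left u2 hK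
    linarith
  have h12 : (1 : ℝ≥0∞) ≤ 2 := by norm_num
  have hnn {g : L2R} : MemLp (fun x => ‖g x‖) 2 volume := (Lp.memLp g).norm
  have := eLpNorm_mono_ae_real (p := 2) key
  have hle : eLpNorm (fun x => K R * (‖diff h (diff h u) x‖ +
      (S * ‖shiftL h (diff h u) x‖ + S * ‖diff h u x‖))) 2 volume ≤
      ENNReal.ofReal (K R * (‖diff h (diff h u)‖ + 2 * (S * ‖diff h u‖))) := by
    have c1 (c : ℝ) (hc : 0 ≤ c) (f : ℝ → ℝ) :
        eLpNorm (fun x => c * f x) 2 volume = ENNReal.ofReal c * eLpNorm f 2 volume := by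
      have := eLpNorm_const_smul c f 2 (volume : Measure ℝ)
      rw [Real.enorm_of_nonneg hc] at this
      exact this
    have c2 (g : L2R) : eLpNorm (fun x => ‖g x‖) 2 volume = ENNReal.ofReal ‖g‖ := by
      rw [eLpNorm_norm, ofReal_norm, Lp.enorm_def]
    rw [c1 _ hK, ENNReal.ofReal_mul hK]
    gcongr
    refine (eLpNorm_add_le hnn.1 ((hnn.const_mul S).add (hnn.const_mul S)).1 h12).trans ?_
    refine (add_le_add_right (eLpNorm_add_le (hnn.const_mul S).1 (hnn.const_mul S).1 h12) _).trans ?_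
    rw [c1 _ hS0, c1 _ hS0, c2, c2, c2, norm_shiftL_eq, ← ENNReal.ofReal_mul hS0,
      ← ENNReal.ofReal_add (by positivity) (by positivity),
      ← ENNReal.ofReal_add (by positivity) (by positivity), two_mul]
  have h3 := this.trans hle
  rw [← Lp.enorm_def, ← ofReal_norm] at h3
  exact (ENNReal.ofReal_le_ofReal_iff (by positivity)).1 h3

/-- The cube of the first-order remainder, for small steps. -/
theorem wiener_diff_mul_sq_le {u : L2R} (hu : InH (3 / 2) u) {h : ℝ} (hh : 0 < h) :
    (wiener (diff h u) * ‖diff h u‖) ^ 2 ≤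
      10 * hNorm 1 u ^ 3 * hNorm (3 / 2) u * (h ^ 4 * h ^ (-(1 / 2) : ℝ)) := by
  have h1 : InH 1 u := (InH.mono (by norm_num) hu).1
  have a1 := (wiener_sq_le (h1.diff h).1).2
  have a2 := norm_diff_le_hNorm_one h1 h
  have a3 := norm_diff_le_half (s := 1) (f := u) (by norm_num; exact hu) h
  rw [show (1 : ℝ) + 1 / 2 = 3 / 2 by norm_num] at a3
  rw [abs_of_pos hh] at a2 a3
  have hB : 0 ≤ hNorm 1 u := norm_nonneg _
  have hY : 0 ≤ hNorm (3 / 2) u := norm_nonneg _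
  -- Three factors `h` come from the `H^1` norm and `h^{1/2}` from the `H^{3/2}` norm; against the
  -- weight `h⁻⁴` this leaves `h^{-1/2}`, integrable at `0`.
  have hpow : h ^ 3 * h ^ (1 / 2 : ℝ) = h ^ 4 * h ^ (-(1 / 2) : ℝ) := by
    rw [← Real.rpow_natCast, ← Real.rpow_natCast, ← Real.rpow_add hh, ← Real.rpow_add hh]
    norm_num
  have hc : 2 * Real.pi * √2 ≤ 10 := by
    have : √2 ≤ 1.42 := by rw [Real.sqrt_le_left (by norm_num)]; norm_num
    nlinarith [Real.pi_lt_d2, Real.pi_pos]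
  rw [mul_pow]
  calc wiener (diff h u) ^ 2 * ‖diff h u‖ ^ 2
      ≤ (2 * Real.pi * ‖diff h u‖ * hNorm 1 (diff h u)) * ‖diff h u‖ ^ 2 := by gcongr
    _ = 2 * Real.pi * ‖diff h u‖ ^ 3 * hNorm 1 (diff h u) := by ring
    _ ≤ 2 * Real.pi * (h * hNorm 1 u) ^ 3 * (√2 * h ^ (1 / 2 : ℝ) * hNorm (3 / 2) u) := by gcongr
    _ = (2 * Real.pi * √2) * (hNorm 1 u ^ 3 * hNorm (3 / 2) u * (h ^ 3 * h ^ (1 / 2 : ℝ))) := by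
        ring
    _ ≤ 10 * (hNorm 1 u ^ 3 * hNorm (3 / 2) u * (h ^ 3 * h ^ (1 / 2 : ℝ))) := by gcongr
    _ = _ := by rw [hpow]; ring

theorem enorm_sq_eq_ofReal (f : L2R) : ‖f‖ₑ ^ 2 = ENNReal.ofReal (‖f‖ ^ 2) := by
  rw [← ofReal_norm, ENNReal.ofReal_pow (norm_nonneg _)]

theorem lintegral_rpow_neg_half :
    ∫⁻ h in Set.Ioc (0 : ℝ) 1, ENNReal.ofReal (h ^ (-(1 / 2) : ℝ)) = ENNReal.ofReal 2 := by
  have i : IntegrableOn (fun h : ℝ => h ^ (-(1 / 2) : ℝ)) (Set.Ioc 0 1) := by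
    have := intervalIntegral.intervalIntegrable_rpow' (a := 0) (b := 1) (r := -(1 / 2))
      (by norm_num)
    rwa [intervalIntegrable_iff_integrableOn_Ioc_of_le zero_le_one] at this
  rw [← ofReal_integral_eq_lintegral_ofReal i ((ae_restrict_mem measurableSet_Ioc).mono
    fun h hh => Real.rpow_nonneg hh.1.le _), ← intervalIntegral.integral_of_le zero_le_one,
    integral_rpow (Or.inl (by norm_num))]
  norm_num

/-- Steps up to `1` use the Taylor bound on second differences, larger steps only the `L²` norm. The
quadratic remainder enters linearly in the `H^{3/2}` norm, so at fixed `H^1` norm the whole bound is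
quadratic in it and the estimate is tame. -/
theorem secSemi_nl_le {F : ℂ → ℂ} {G : ℂ → ℂ → ℂ} {K : ℝ → ℝ} (hF : IsC11 F G K) {u : L2R} {R : ℝ}
    (hu : InH (3 / 2) u) (hR : AEBound u R) :
    secSemi (nl F u) ≤ ENNReal.ofReal (2 * K R ^ 2) * secSemi u +
      ENNReal.ofReal (160 * K R ^ 2 * (hNorm 1 u ^ 3 * hNorm (3 / 2) u) + 16 * ‖nl F u‖ ^ 2) := by
  have h1 : InH 1 u := (InH.mono (by norm_num) hu).1
  have hB : 0 ≤ hNorm 1 u := norm_nonneg _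
  have hY : 0 ≤ hNorm (3 / 2) u := norm_nonneg _
  have hK := hF.nonneg hR.nonneg
  set c := 80 * K R ^ 2 * (hNorm 1 u ^ 3 * hNorm (3 / 2) u) with hc
  have hc0 : 0 ≤ c := by positivity
  have p1 : ∫⁻ h in Set.Ioc (0 : ℝ) 1, ENNReal.ofReal (h ^ 4)⁻¹ * ‖diff h (diff h (nl F u))‖ₑ ^ 2 ≤
      ENNReal.ofReal (2 * K R ^ 2) * secSemi u + ENNReal.ofReal c * ENNReal.ofReal 2 := by
    calc _ ≤ ∫⁻ h in Set.Ioc (0 : ℝ) 1, (ENNReal.ofReal (2 * K R ^ 2) *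
          (ENNReal.ofReal (h ^ 4)⁻¹ * ‖diff h (diff h u)‖ₑ ^ 2) +
          ENNReal.ofReal c * ENNReal.ofReal (h ^ (-(1 / 2) : ℝ))) := by
          refine setLIntegral_mono' measurableSet_Ioc fun h hh => ?_
          have h0 : 0 < h := hh.1
          rw [enorm_sq_eq_ofReal, enorm_sq_eq_ofReal, ← ENNReal.ofReal_mul (by positivity),
            ← ENNReal.ofReal_mul (by positivity), ← ENNReal.ofReal_mul (by positivity),
            ← ENNReal.ofReal_mul hc0, ← ENNReal.ofReal_add (by positivity) (by positivity)]
          refine ENNReal.ofReal_le_ofReal ?_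
          have a1 := norm_diff_diff_nl_le hF hR (S := wiener (diff h u)) (h := h)
            (ae_norm_le_wiener (h1.diff h).1)
          have a2 := wiener_diff_mul_sq_le hu h0
          set x := ‖diff h (diff h u)‖
          set y := wiener (diff h u) * ‖diff h u‖
          have a3 : ‖diff h (diff h (nl F u))‖ ^ 2 ≤ 2 * K R ^ 2 * x ^ 2 + 8 * K R ^ 2 * y ^ 2 := by
            calc _ ≤ (K R * (x + 2 * y)) ^ 2 := pow_le_pow_left₀ (norm_nonneg _) a1 2
              _ ≤ _ := by nlinarith [mul_nonneg (sq_nonneg (K R)) (sq_nonneg (x - 2 * y))]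
          have a4 : 8 * K R ^ 2 * y ^ 2 ≤ c * (h ^ 4 * h ^ (-(1 / 2) : ℝ)) := by
            calc _ ≤ 8 * K R ^ 2 * (10 * hNorm 1 u ^ 3 * hNorm (3 / 2) u *
                  (h ^ 4 * h ^ (-(1 / 2) : ℝ))) := by gcongr
              _ = _ := by rw [hc]; ring
          calc (h ^ 4)⁻¹ * ‖diff h (diff h (nl F u))‖ ^ 2
              ≤ (h ^ 4)⁻¹ * (2 * K R ^ 2 * x ^ 2 + c * (h ^ 4 * h ^ (-(1 / 2) : ℝ))) := by
                gcongr; linarith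
            _ = _ := by field_simp
      _ = ENNReal.ofReal (2 * K R ^ 2) * (∫⁻ h in Set.Ioc (0 : ℝ) 1,
          ENNReal.ofReal (h ^ 4)⁻¹ * ‖diff h (diff h u)‖ₑ ^ 2) + ENNReal.ofReal c * ENNReal.ofReal 2 := by
          rw [lintegral_add_right' _ (by fun_prop), lintegral_const_mul' _ _ ENNReal.ofReal_ne_top,
            lintegral_const_mul' _ _ ENNReal.ofReal_ne_top, lintegral_rpow_neg_half]
      _ ≤ _ := by
          gcongr
          exact lintegral_mono_set Set.Ioc_subset_Ioi_self
  have p2 : ∫⁻ h in Set.Ioi (1 : ℝ), ENNReal.ofReal (h ^ 4)⁻¹ * ‖diff h (diff h (nl F u))‖ₑ ^ 2 ≤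
      ENNReal.ofReal (16 * ‖nl F u‖ ^ 2) := by
    calc _ ≤ ∫⁻ h in Set.Ioi (1 : ℝ), ENNReal.ofReal (h ^ 4)⁻¹ *
          ENNReal.ofReal (16 * ‖nl F u‖ ^ 2) := by
          gcongr with h
          rw [enorm_sq_eq_ofReal]
          refine ENNReal.ofReal_le_ofReal ?_
          have a1 := norm_diff_le h (diff h (nl F u))
          have a2 := norm_diff_le h (nl F u)
          calc _ ≤ (4 * ‖nl F u‖) ^ 2 := pow_le_pow_left₀ (norm_nonneg _) (by linarith) 2
            _ = _ := by ring
      _ ≤ 1 * ENNReal.ofReal (16 * ‖nl F u‖ ^ 2) := by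
          rw [lintegral_mul_const' _ _ ENNReal.ofReal_ne_top]
          gcongr
          rw [← ofReal_integral_eq_lintegral_ofReal integrableOn_inv_pow_four
            (Eventually.of_forall fun _ => by positivity)]
          exact ENNReal.ofReal_le_one.2 integral_inv_pow_four_le
      _ = _ := one_mul _
  rw [secSemi, ← Set.Ioc_union_Ioi_eq_Ioi (zero_le_one' ℝ)]
  refine (lintegral_union_le _ _ _).trans ((add_le_add p1 p2).trans_eq ?_)
  rw [add_assoc, ← ENNReal.ofReal_mul hc0,
    ← ENNReal.ofReal_add (by positivity) (by positivity), hc]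
  congr 2; ring

/-- The tame estimate of the nonlinearity in `H^{3/2}`. -/
theorem exists_tame_bound {F : ℂ → ℂ} {G : ℂ → ℂ → ℂ} {K : ℝ → ℝ} (hF : IsC11 F G K) {B : ℝ}
    (hB0 : 0 ≤ B) : ∃ C, 0 ≤ C ∧ ∀ u : L2R, InH (3 / 2) u → hNorm 1 u ≤ B →
      InH (3 / 2) (nl F u) ∧ hNorm (3 / 2) (nl F u) ≤ C * (1 + hNorm (3 / 2) u) := by
  obtain ⟨κ, hκ⟩ : ∃ κ, K (3 * B) = κ := ⟨_, rfl⟩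
  have hκ0 : 0 ≤ κ := hκ ▸ hF.nonneg (by positivity)
  have hs := secSymbol_one_pos
  set D := 4 * (2 * Real.pi) ^ 3 / secSymbol 1 with hD
  have hD0 : 0 ≤ D := by positivity
  set C2 := 4 * (κ * B) ^ 2 + D * (2 * κ ^ 2 * secSymbol 1 + 160 * κ ^ 2 * B ^ 3 +
    16 * (κ * B) ^ 2) with hC2
  have hC20 : 0 ≤ C2 := by positivity
  refine ⟨√C2, Real.sqrt_nonneg _, fun u hu hB => ?_⟩
  have h1 : InH 1 u := (InH.mono (by norm_num) hu).1
  have hR : AEBound u (3 * B) := (aeBound_hNorm h1).mono (by linarith)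
  have hY : 0 ≤ hNorm (3 / 2) u := norm_nonneg _
  have h10 : 0 ≤ hNorm 1 u := norm_nonneg _
  have hN : ‖nl F u‖ ≤ κ * B := by
    refine (hF.norm_nl_le hR).trans ?_
    rw [hκ]
    exact mul_le_mul_of_nonneg_left ((norm_le_hNorm (by norm_num) h1).trans hB) hκ0
  set Y := hNorm (3 / 2) u with hYd
  have m1 : sobolevENorm (3 / 2) (nl F u) ^ 2 ≤ ENNReal.ofReal (C2 * (1 + Y) ^ 2) := by
    refine (sobolevENorm_sq_le _).trans ?_
    have a1 := secSemi_nl_le hF hu hR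
    have a2 := secSemi_le u
    rw [sobolevENorm_eq hu, ← ENNReal.ofReal_pow hY, ← ENNReal.ofReal_mul hs.le] at a2
    calc _ ≤ 4 * ‖nl F u‖ₑ ^ 2 + ENNReal.ofReal D * (ENNReal.ofReal (2 * K (3 * B) ^ 2) *
          ENNReal.ofReal (secSymbol 1 * Y ^ 2) + ENNReal.ofReal (160 * K (3 * B) ^ 2 *
            (hNorm 1 u ^ 3 * Y) + 16 * ‖nl F u‖ ^ 2)) := by
          gcongr
          exact a1.trans (by gcongr)
      _ = ENNReal.ofReal (4 * ‖nl F u‖ ^ 2 + D * (2 * κ ^ 2 * (secSymbol 1 * Y ^ 2) +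
          (160 * κ ^ 2 * (hNorm 1 u ^ 3 * Y) + 16 * ‖nl F u‖ ^ 2))) := by
          rw [hκ, enorm_sq_eq_ofReal, show (4 : ℝ≥0∞) = ENNReal.ofReal 4 by norm_num,
            ← ENNReal.ofReal_mul (by norm_num), ← ENNReal.ofReal_mul (by positivity),
            ← ENNReal.ofReal_add (by positivity) (by positivity), ← ENNReal.ofReal_mul hD0,
            ← ENNReal.ofReal_add (by positivity) (by positivity)]
      _ ≤ ENNReal.ofReal (4 * (κ * B) ^ 2 * (1 + Y) ^ 2 + D * (2 * κ ^ 2 * (secSymbol 1 *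
          (1 + Y) ^ 2) + (160 * κ ^ 2 * (B ^ 3 * (1 + Y) ^ 2) + 16 * (κ * B) ^ 2 *
            (1 + Y) ^ 2))) := by
          refine ENNReal.ofReal_le_ofReal ?_
          have y1 : 1 ≤ (1 + Y) ^ 2 := by nlinarith
          have y2 : Y ≤ (1 + Y) ^ 2 := by nlinarith
          have y3 : Y ^ 2 ≤ (1 + Y) ^ 2 := by nlinarith
          have n2 : ‖nl F u‖ ^ 2 ≤ (κ * B) ^ 2 * (1 + Y) ^ 2 :=
            (pow_le_pow_left₀ (norm_nonneg _) hN 2).trans (le_mul_of_one_le_right (by positivity) y1)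
          rw [mul_assoc 4, mul_assoc 16]
          gcongr
      _ = _ := by congr 1; rw [hC2]; ring
  have hfin : sobolevENorm (3 / 2) (nl F u) < ⊤ := by
    by_contra hcon
    rw [not_lt, top_le_iff] at hcon
    rw [hcon] at m1
    exact absurd m1 (by simp)
  have hIn := (inH_iff _).2 hfin
  refine ⟨hIn, ?_⟩
  rw [sobolevENorm_eq hIn, ← ENNReal.ofReal_pow (norm_nonneg _),
    ENNReal.ofReal_le_ofReal_iff (by positivity)] at m1
  have := Real.sqrt_le_sqrt m1
  rwa [Real.sqrt_sq (norm_nonneg _), Real.sqrt_mul hC20, Real.sqrt_sq (by positivity)] at this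

/-! ### Bounds in `H^1` and `H^{3/2}` on bounded time intervals -/

theorem one_add_le_osgood {z : ℝ} (hz : 0 ≤ z) : 1 + z ≤ osgood z := by
  have : 0 ≤ Real.log (1 + z) := Real.log_nonneg (by linarith)
  rw [osgood]; nlinarith

/-- The truncated symbol of `(1 - Δ)^{3/4}`. -/
def highSymbol (n : ℕ) (ξ : ℝ) : ℝ := truncSymbol n ξ ^ 2 * bracket ξ ^ (3 / 2 : ℝ)

theorem continuous_highSymbol (n : ℕ) : Continuous (highSymbol n) :=
  ((continuous_truncSymbol n).pow 2).mul
    (continuous_bracket.rpow_const fun ξ => Or.inl (bracket_pos ξ).ne')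

theorem aesm_highSymbol (n : ℕ) :
    AEStronglyMeasurable (fun ξ => (highSymbol n ξ : ℂ)) (volume : Measure ℝ) :=
  (Complex.continuous_ofReal.comp (continuous_highSymbol n)).aestronglyMeasurable

theorem norm_highSymbol (n : ℕ) (ξ : ℝ) : ‖(highSymbol n ξ : ℂ)‖ = highSymbol n ξ := by
  have := bracket_pos ξ
  have := truncSymbol_nonneg n ξ
  rw [Complex.norm_real, Real.norm_of_nonneg (by unfold highSymbol; positivity)]

theorem norm_highSymbol_le_wt (n : ℕ) (ξ : ℝ) :
    ‖(highSymbol n ξ : ℂ)‖ ≤ ‖wt (3 / 2) ξ‖ := by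
  have := bracket_pos ξ
  rw [norm_highSymbol, norm_wt, highSymbol]
  refine mul_le_of_le_one_left (by positivity) ?_
  exact pow_le_one₀ (truncSymbol_nonneg n ξ) (truncSymbol_le_one n ξ)

theorem norm_highSymbol_le (n : ℕ) (ξ : ℝ) : ‖(highSymbol n ξ : ℂ)‖ ≤ ((n : ℝ) + 1) ^ 2 := by
  have hb := one_le_bracket ξ
  have h0 := truncSymbol_nonneg n ξ
  rw [norm_highSymbol, highSymbol]
  -- Each truncation factor pays for one power of `bracket`; two of them are present since `3/2 ≤
  -- 2`.
  calc _ ≤ truncSymbol n ξ ^ 2 * bracket ξ ^ (2 : ℝ) :=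
        mul_le_mul_of_nonneg_left (Real.rpow_le_rpow_of_exponent_le hb (by norm_num))
          (by positivity)
    _ = (truncSymbol n ξ * bracket ξ) ^ 2 := by rw [Real.rpow_two]; ring
    _ ≤ _ := pow_le_pow_left₀ (by positivity) (truncSymbol_mul_le n ξ) 2

/-- Bounded approximations of `(1 - Δ)^{3/4}`. -/
def high (n : ℕ) : L2R →L[ℂ] L2R :=
  bmul (fun ξ => (highSymbol n ξ : ℂ)) (aesm_highSymbol n) (((n : ℝ) + 1) ^ 2)
    (norm_highSymbol_le n)

theorem high_spec (n : ℕ) (f : L2R) : MemMul (fun ξ => (highSymbol n ξ : ℂ)) f ∧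
    high n f = fmul (fun ξ => (highSymbol n ξ : ℂ)) f :=
  ⟨(MemMul.of_bounded (aesm_highSymbol n) (norm_highSymbol_le n) f).1, bmul_apply f⟩

theorem norm_high_le (n : ℕ) {f : L2R} (hf : InH (3 / 2) f) : ‖high n f‖ ≤ hNorm (3 / 2) f := by
  have := (MemMul.mono (C := 1) hf (aesm_highSymbol n)
    (by simpa only [one_mul] using norm_highSymbol_le_wt n)).2
  rwa [one_mul, ← (high_spec n f).2] at this

theorem tendsto_high {f : L2R} (hf : InH (3 / 2) f) :
    Tendsto (fun n => ‖high n f‖) atTop (𝓝 (hNorm (3 / 2) f)) := by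
  have := tendsto_fmul (l := atTop) (m := fun n ξ => (highSymbol n ξ : ℂ)) (m₀ := wt (3 / 2))
    (G := wt (3 / 2)) (f := f) hf aesm_highSymbol (aesm_wt _)
    (Eventually.of_forall fun n ξ => norm_highSymbol_le_wt n ξ) (fun _ => le_rfl)
    fun ξ => by
      have h1 : Tendsto (fun n => truncSymbol n ξ ^ 2 * bracket ξ ^ (3 / 2 : ℝ)) atTop
          (𝓝 (1 ^ 2 * bracket ξ ^ (3 / 2 : ℝ))) := ((tendsto_truncSymbol ξ).pow 2).mul_const _
      rw [one_pow, one_mul] at h1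
      exact (Complex.continuous_ofReal.tendsto _).comp h1
  refine this.norm.congr fun n => ?_
  rw [(high_spec n f).2]

/-- The sign `σ = ±1` encodes the direction of time, so that forward and backward bounds share one
proof. -/
theorem abs_integral_mul_sign {σ : ℝ} (hσ : σ * σ = 1) {f : ℝ → ℝ} (hf : ∀ s, 0 ≤ f s) {t : ℝ}
    (ht : 0 ≤ t) : |∫ s in 0..σ * t, f s| = ∫ s in 0..t, f (σ * s) := by
  have := intervalIntegral.mul_integral_comp_mul_left (f := f) (a := 0) (b := t) σ
  rw [mul_zero] at this
  have h0 : 0 ≤ ∫ s in 0..t, f (σ * s) :=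
    intervalIntegral.integral_nonneg ht fun s _ => hf _
  have h1 : |σ| = 1 := by
    have := abs_mul_abs_self σ
    rw [hσ] at this
    nlinarith [abs_nonneg σ]
  rw [← this, abs_mul, h1, one_mul, abs_of_nonneg h0]

theorem uIcc_mul_sign {σ t : ℝ} (hσ : σ * σ = 1) (ht : 0 ≤ t) {x : ℝ}
    (hx : x ∈ Set.uIcc 0 (σ * t)) : ∃ s ∈ Set.Icc 0 t, x = σ * s := by
  refine ⟨σ * x, ?_, by rw [← mul_assoc, hσ, one_mul]⟩
  rcases mul_self_eq_one_iff.1 hσ with rfl | rfl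
  · rw [one_mul, Set.uIcc_of_le ht] at hx
    simpa using hx
  · rw [neg_one_mul, Set.uIcc_of_ge (by linarith)] at hx
    constructor <;> linarith [hx.1, hx.2]

/-- Boundedness from an Osgood type integral inequality, in either direction of time. -/
theorem bounded_of_integral_le {J : Set ℝ} {σ T C E : ℝ} (hσ : σ * σ = 1) (hC : 0 ≤ C)
    (hJ : ∀ t ∈ Set.Ico 0 T, σ * t ∈ J) {y : ℝ → ℝ} (hy : ∀ t, 0 ≤ y t)
    (hc : ContinuousOn y J)
    (H : ∀ b, Set.uIcc 0 b ⊆ J → y b ≤ E + |∫ s in 0..b, C * osgood (y s)|) :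
    ∃ Y, ∀ t ∈ Set.Ico 0 T, y (σ * t) ≤ Y := by
  refine bounded_of_osgood (y := fun t => y (σ * t)) (E := E) hC ?_ (fun t _ => hy _) ?_
  · exact hc.comp (by fun_prop) hJ
  · intro t ht
    have := H (σ * t) fun x hx => by
      obtain ⟨s, hs, rfl⟩ := uIcc_mul_sign hσ ht.1 hx
      exact hJ s ⟨hs.1, hs.2.trans_lt ht.2⟩
    rwa [abs_integral_mul_sign hσ (fun s => mul_nonneg hC (osgood_pos (hy s)).le) ht.1] at this

namespace IsPath
variable {u v : ℝ → L2R} {J : Set ℝ}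

theorem exists_hNorm_one_bound (h : IsPath u v J) {σ T A : ℝ} (hσ : σ * σ = 1)
    (h0 : (0 : ℝ) ∈ J) (hJ : ∀ t ∈ Set.Ico 0 T, σ * t ∈ J) (hA : ∀ t ∈ J, hNorm (1 / 2) (u t) ≤ A) :
    ∃ B, 0 ≤ B ∧ ∀ t ∈ Set.Ico 0 T, hNorm 1 (u (σ * t)) ≤ B := by
  obtain ⟨C, E, hC, -, h1, h2⟩ := h.exists_integral_inequality (le_max_right A 1)
    (fun t ht => (hA t ht).trans (le_max_left A 1)) h0
  obtain ⟨Y, hY⟩ := bounded_of_integral_le hσ hC hJ (y := fun t => ‖v t‖ ^ 2)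
    (fun t => sq_nonneg _)
    (fun t ht => ((h.continuousAt_v ht).norm.pow 2).continuousWithinAt) h2
  refine ⟨2 * √Y + C, by positivity, fun t ht => ?_⟩
  have := Real.le_sqrt_of_sq_le (hY t ht)
  linarith [h1 _ (hJ t ht)]

theorem norm_sq_high_sub (h : IsPath u v J) (n : ℕ) {a b : ℝ} (hab : Set.uIcc a b ⊆ J) :
    ‖high n (u b)‖ ^ 2 - ‖high n (u a)‖ ^ 2 =
      ∫ s in a..b, 2 * (inner ℂ (high n (u s)) (Complex.I • high n (nl quartic (u s)))).re := by
  refine (intervalIntegral.integral_eq_sub_of_hasDerivAt (fun s hs =>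
    hasDerivAt_norm_sq_multiplier (high_spec n) (h.deriv s (hab hs)) (h.inH_one (hab hs))
      (h.eq s (hab hs))) ?_).symm
  refine ContinuousOn.intervalIntegrable fun s hs => ContinuousAt.continuousWithinAt ?_
  have e1 : ContinuousAt (fun s => high n (u s)) s :=
    (high n).continuous.continuousAt.comp (h.deriv s (hab hs)).continuousAt
  have e2 : ContinuousAt (fun s => high n (nl quartic (u s))) s :=
    (high n).continuous.continuousAt.comp
      (h.hasDerivAt_nl (hab hs) isC11_quartic).continuousAt
  exact (continuousAt_re_inner e1 (e2.const_smul Complex.I)).const_mul 2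

theorem restrict (h : IsPath u v J) {J' : Set ℝ} (hJ' : IsOpen J') (hs : J' ⊆ J) :
    IsPath u v J' :=
  ⟨hJ', fun t ht => h.mem t (hs ht), fun t ht => h.cont t (hs ht), fun t ht => h.deriv t (hs ht),
    fun t ht => h.eq t (hs ht)⟩

theorem exists_hNorm_bound (h : IsPath u v J) {σ T A : ℝ} (hσ : σ * σ = 1)
    (h0 : (0 : ℝ) ∈ J) (hJ : ∀ t ∈ Set.Ico 0 T, σ * t ∈ J) (hA : ∀ t ∈ J, hNorm (1 / 2) (u t) ≤ A) :
    ∃ Y, ∀ t ∈ Set.Ico 0 T, hNorm (3 / 2) (u (σ * t)) ≤ Y := by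
  obtain ⟨B, hB0, hB⟩ := h.exists_hNorm_one_bound hσ h0 hJ hA
  obtain ⟨C, hC, hN⟩ := exists_tame_bound isC11_quartic hB0
  have hy (t : ℝ) : 0 ≤ hNorm (3 / 2) (u t) := norm_nonneg _
  have hyc : ContinuousOn (fun t => hNorm (3 / 2) (u t) ^ 2) J := fun t ht =>
    ((h.continuousAt_hNorm ht le_rfl).norm.pow 2).continuousWithinAt
  have hb (t : ℝ) (ht : t ∈ Set.Ico 0 T) :
      hNorm (3 / 2) (u (σ * t)) ^ 2 ≤ hNorm (3 / 2) (u 0) ^ 2 +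
        ∫ s in 0..t, 4 * C * osgood (hNorm (3 / 2) (u (σ * s)) ^ 2) := by
    have hab : Set.uIcc 0 (σ * t) ⊆ J := fun x hx => by
      obtain ⟨s, hs, rfl⟩ := uIcc_mul_sign hσ ht.1 hx
      exact hJ s ⟨hs.1, hs.2.trans_lt ht.2⟩
    -- The energy identity is written for the bounded operators `high n`, since differentiability in
    -- time holds in `L²` only. The right-hand side is uniform in `n`; by the tame estimate it grows
    -- linearly in the squared `H^{3/2}` norm, and `osgood` merely serves as an upper bound for `1 +
    -- z`.
    have key (n : ℕ) : ‖high n (u (σ * t))‖ ^ 2 ≤ ‖high n (u 0)‖ ^ 2 +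
        |∫ s in 0..σ * t, 4 * C * osgood (hNorm (3 / 2) (u s) ^ 2)| := by
      have e1 := h.norm_sq_high_sub n hab
      have e2 : |∫ s in 0..σ * t,
          2 * (inner ℂ (high n (u s)) (Complex.I • high n (nl quartic (u s)))).re| ≤
          |∫ s in 0..σ * t, 4 * C * osgood (hNorm (3 / 2) (u s) ^ 2)| := by
        rw [← Real.norm_eq_abs]
        refine intervalIntegral.norm_integral_le_abs_of_norm_le ?_
          ((continuousOn_osgood (hyc.mono hab) fun s _ => sq_nonneg _).const_mul
            (4 * C)).intervalIntegrable
        refine (ae_restrict_mem measurableSet_uIoc).mono fun s hs => ?_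
        have hsJ := hab (Set.uIoc_subset_uIcc hs)
        obtain ⟨r, hr, rfl⟩ := uIcc_mul_sign hσ ht.1 (Set.uIoc_subset_uIcc hs)
        obtain ⟨n1, n2⟩ := hN _ (h.mem _ hsJ) (hB r ⟨hr.1, hr.2.trans_lt ht.2⟩)
        rw [norm_mul, Real.norm_eq_abs, Real.norm_eq_abs, abs_two]
        have a1 := abs_re_inner_le (high n (u (σ * r)))
          (Complex.I • high n (nl quartic (u (σ * r))))
        rw [norm_smul, Complex.norm_I, one_mul] at a1
        have a2 : ‖high n (u (σ * r))‖ * ‖high n (nl quartic (u (σ * r)))‖ ≤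
            hNorm (3 / 2) (u (σ * r)) * (C * (1 + hNorm (3 / 2) (u (σ * r)))) :=
          mul_le_mul (norm_high_le n (h.mem _ hsJ)) ((norm_high_le n n1).trans n2)
            (norm_nonneg _) (hy _)
        have a3 := one_add_le_osgood (sq_nonneg (hNorm (3 / 2) (u (σ * r))))
        set Y := hNorm (3 / 2) (u (σ * r))
        have a4 : 2 * (Y * (C * (1 + Y))) ≤ 4 * C * (1 + Y ^ 2) := by
          nlinarith [mul_nonneg hC (sq_nonneg (Y - 1)), mul_nonneg hC (sq_nonneg Y)]
        have a5 := mul_le_mul_of_nonneg_left a3 (show 0 ≤ 4 * C by positivity)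
        linarith
      have e3 := le_abs_self (∫ s in 0..σ * t,
          2 * (inner ℂ (high n (u s)) (Complex.I • high n (nl quartic (u s)))).re)
      linarith
    have h0' := h.mem 0 h0
    have l1 := (tendsto_high (h.mem _ (hJ t ht))).pow 2
    have l2 := ((tendsto_high h0').pow 2).add_const
      |∫ s in 0..σ * t, 4 * C * osgood (hNorm (3 / 2) (u s) ^ 2)|
    have l3 := le_of_tendsto_of_tendsto' l1 l2 key
    rwa [abs_integral_mul_sign hσ (fun s => mul_nonneg (by positivity)
      (osgood_pos (sq_nonneg _)).le) ht.1] at l3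
  obtain ⟨Y, hY⟩ := bounded_of_osgood (y := fun t => hNorm (3 / 2) (u (σ * t)) ^ 2)
    (T := T) (by positivity) (hyc.comp (by fun_prop) hJ) (fun t _ => sq_nonneg _) hb
  exact ⟨√Y, fun t ht => Real.le_sqrt_of_sq_le (hY t ht)⟩

end IsPath

/-! ### Projection onto balls of `H^{3/2}` -/

/-- The nearest-point projection onto a closed convex set. -/
theorem exists_convex_projection {F : Type*} [NormedAddCommGroup F] [InnerProductSpace ℝ F]
    [CompleteSpace F] {K : Set F} (hne : K.Nonempty) (hcl : IsClosed K) (hK : Convex ℝ K) :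
    ∃ P : F → F, (∀ x, P x ∈ K) ∧ (∀ x ∈ K, P x = x) ∧ ∀ x y, ‖P x - P y‖ ≤ ‖x - y‖ := by
  choose P hP hmin using exists_norm_eq_iInf_of_complete_convex hne hcl.isComplete hK
  have hv (x : F) := (norm_eq_iInf_iff_real_inner_le_zero hK (hP x)).1 (hmin x)
  refine ⟨P, hP, fun x hx => ?_, fun x y => ?_⟩
  · have := hv x x hx
    rw [real_inner_self_eq_norm_sq] at this
    have h0 : ‖x - P x‖ = 0 := by nlinarith [norm_nonneg (x - P x)]
    exact (sub_eq_zero.1 (norm_eq_zero.1 h0)).symm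
  · have h1 := hv x (P y) (hP y)
    have h2 := hv y (P x) (hP x)
    have h3 : ‖P x - P y‖ ^ 2 ≤ inner ℝ (x - y) (P x - P y) := by
      rw [← real_inner_self_eq_norm_sq]
      have e : inner ℝ (x - y) (P x - P y) - inner ℝ (P x - P y) (P x - P y) =
          -(inner ℝ (x - P x) (P y - P x) + inner ℝ (y - P y) (P x - P y)) := by
        rw [← neg_sub (P x) (P y), inner_neg_right, ← inner_sub_left, neg_add, neg_neg,
          ← sub_eq_add_neg, ← inner_sub_left]
        congr 1; abel
      linarith
    have h4 := h3.trans (real_inner_le_norm _ _)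
    rcases (norm_nonneg (P x - P y)).eq_or_lt with h5 | h5
    · rw [← h5]; exact norm_nonneg _
    · rw [sq] at h4; exact le_of_mul_le_mul_right h4 h5

/-- Fatou's lemma on the Fourier side. It makes a ball of `H^{3/2}` an intersection of sets closed
in `L²`. -/
theorem inH_of_high_le {f : L2R} {c : ℝ} (h : ∀ n, ‖high n f‖ ≤ c) :
    InH (3 / 2) f ∧ hNorm (3 / 2) f ≤ c := by
  have hc : 0 ≤ c := (norm_nonneg _).trans (h 0)
  have hm : AEMeasurable (fun ξ => ‖(𝓕 f : L2R) ξ‖ₑ ^ 2) volume :=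
    (Lp.aestronglyMeasurable _).enorm.pow_const 2
  have key : sobolevENorm (3 / 2) f ^ 2 ≤ ENNReal.ofReal (c ^ 2) := by
    have hF := lintegral_liminf_le' (u := atTop) (μ := volume)
      (f := fun (n : ℕ) ξ => ENNReal.ofReal (highSymbol n ξ ^ 2) * ‖(𝓕 f : L2R) ξ‖ₑ ^ 2)
      fun n => (((continuous_highSymbol n).pow 2).measurable.ennreal_ofReal.aemeasurable).mul hm
    have h1 : sobolevENorm (3 / 2) f ^ 2 ≤ ∫⁻ ξ, liminf (fun n : ℕ =>
        ENNReal.ofReal (highSymbol n ξ ^ 2) * ‖(𝓕 f : L2R) ξ‖ₑ ^ 2) atTop := by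
      rw [sobolevENorm_three_half_sq]
      refine lintegral_mono_ae ?_
      have hfin : ∀ᵐ ξ, ‖(𝓕 f : L2R) ξ‖ₑ ^ 2 ≠ ⊤ := Eventually.of_forall fun ξ => by simp
      filter_upwards [hfin] with ξ hξ
      have hb := bracket_pos ξ
      have l1 : Tendsto (fun n => highSymbol n ξ ^ 2) atTop (𝓝 (bracket ξ ^ 3)) := by
        have l0 : Tendsto (fun n => (truncSymbol n ξ ^ 2 * bracket ξ ^ (3 / 2 : ℝ)) ^ 2) atTop
          (𝓝 ((1 ^ 2 * bracket ξ ^ (3 / 2 : ℝ)) ^ 2)) :=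
            (((tendsto_truncSymbol ξ).pow 2).mul_const _).pow 2
        have e : (1 ^ 2 * bracket ξ ^ (3 / 2 : ℝ)) ^ 2 = bracket ξ ^ 3 := by
          rw [one_pow, one_mul, ← Real.rpow_natCast, ← Real.rpow_mul hb.le, ← Real.rpow_natCast]
          norm_num
        rwa [e] at l0
      have l2 := ENNReal.Tendsto.mul_const (b := ‖(𝓕 f : L2R) ξ‖ₑ ^ 2)
        (ENNReal.tendsto_ofReal l1) (Or.inr hξ)
      exact l2.liminf_eq.ge
    refine h1.trans (hF.trans ?_)
    refine liminf_le_of_le (by isBoundedDefault) fun b hb => ?_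
    obtain ⟨n, hn⟩ := hb.exists
    refine hn.trans ?_
    have h2 := enorm_fmul_sq (high_spec n f).1
    rw [← (high_spec n f).2, enorm_sq_eq_ofReal] at h2
    have h3 : ∫⁻ ξ, ENNReal.ofReal (highSymbol n ξ ^ 2) * ‖(𝓕 f : L2R) ξ‖ₑ ^ 2 =
        ENNReal.ofReal (‖high n f‖ ^ 2) := by
      rw [h2]
      refine lintegral_congr fun ξ => ?_
      rw [← ofReal_norm (highSymbol n ξ : ℂ), ← ENNReal.ofReal_pow (norm_nonneg _),
        norm_highSymbol]
    rw [h3]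
    exact ENNReal.ofReal_le_ofReal (pow_le_pow_left₀ (norm_nonneg _) (h n) 2)
  have hfin : sobolevENorm (3 / 2) f < ⊤ := by
    by_contra hcon
    rw [not_lt, top_le_iff] at hcon
    rw [hcon] at key
    exact absurd key (by simp)
  have hIn := (inH_iff _).2 hfin
  refine ⟨hIn, ?_⟩
  rw [sobolevENorm_eq hIn, ← ENNReal.ofReal_pow (norm_nonneg _),
    ENNReal.ofReal_le_ofReal_iff (by positivity)] at key
  exact (sq_le_sq₀ (norm_nonneg _) hc).1 key

theorem coe_smul_L2 (r : ℝ) (f : L2R) : (r : ℂ) • f = r • f := by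
  refine Lp.ext ?_
  filter_upwards [Lp.coeFn_smul (r : ℂ) f, Lp.coeFn_smul r f] with x h1 h2
  rw [h1, h2, Pi.smul_apply, Pi.smul_apply, Complex.coe_smul]

theorem map_real_smul_L2 (L : L2R →L[ℂ] L2R) (r : ℝ) (f : L2R) : L (r • f) = r • L f := by
  rw [← coe_smul_L2, map_smul, coe_smul_L2]

/-- The closed ball of `H^{3/2}`, as a subset of `L²`. -/
def hBall (M : ℝ) : Set L2R := {f | ∀ n, ‖high n f‖ ≤ M}

theorem mem_hBall {M : ℝ} {f : L2R} :
    f ∈ hBall M ↔ InH (3 / 2) f ∧ hNorm (3 / 2) f ≤ M :=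
  ⟨fun h => inH_of_high_le h, fun h n => (norm_high_le n h.1).trans h.2⟩

theorem isClosed_hBall (M : ℝ) : IsClosed (hBall M) := by
  simp only [hBall, Set.ofPred_forall]
  exact isClosed_iInter fun n => isClosed_le (high n).continuous.norm continuous_const

theorem convex_hBall (M : ℝ) : Convex ℝ (hBall M) := by
  intro f hf g hg a b ha hb hab n
  have e : high n (a • f + b • g) = a • high n f + b • high n g := by
    rw [map_add, map_real_smul_L2, map_real_smul_L2]
  rw [e]
  refine (norm_add_le _ _).trans ?_
  rw [norm_smul, norm_smul, Real.norm_of_nonneg ha, Real.norm_of_nonneg hb]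
  calc _ ≤ a * M + b * M := by
        gcongr
        · exact hf n
        · exact hg n
    _ = M := by rw [← add_mul, hab, one_mul]

/-! ### The free propagator -/

/-- The symbol of the free propagator. -/
def propSymbol (t ξ : ℝ) : ℂ := Complex.exp (((-(t * bracket ξ) : ℝ) : ℂ) * Complex.I)

theorem norm_propSymbol (t ξ : ℝ) : ‖propSymbol t ξ‖ = 1 := Complex.norm_exp_ofReal_mul_I _

theorem continuous_propSymbol (t : ℝ) : Continuous (propSymbol t) := by
  have := continuous_bracket
  unfold propSymbol
  fun_prop

theorem aesm_propSymbol (t : ℝ) : AEStronglyMeasurable (propSymbol t) volume :=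
  (continuous_propSymbol t).aestronglyMeasurable

theorem propSymbol_add (s t ξ : ℝ) : propSymbol (s + t) ξ = propSymbol s ξ * propSymbol t ξ := by
  rw [propSymbol, propSymbol, propSymbol, ← Complex.exp_add]
  congr 1; push_cast; ring

theorem propSymbol_zero (ξ : ℝ) : propSymbol 0 ξ = 1 := by simp [propSymbol]

/-- The free propagator `exp(-it√(1-Δ))`. -/
def prop (t : ℝ) : L2R →L[ℂ] L2R :=
  bmul (propSymbol t) (aesm_propSymbol t) 1 fun ξ => (norm_propSymbol t ξ).le

theorem memMul_propSymbol (t : ℝ) (f : L2R) : MemMul (propSymbol t) f :=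
  (MemMul.of_bounded (aesm_propSymbol t) (fun ξ => (norm_propSymbol t ξ).le) f).1

theorem prop_apply (t : ℝ) (f : L2R) : prop t f = fmul (propSymbol t) f := bmul_apply f

theorem norm_prop (t : ℝ) (f : L2R) : ‖prop t f‖ = ‖f‖ := by
  have h := norm_fmul_sq (memMul_propSymbol t f)
  rw [← prop_apply] at h
  have h2 : ‖prop t f‖ ^ 2 = ‖f‖ ^ 2 := by
    have h0 := norm_fmul_sq (fmul_one f).1
    rw [(fmul_one f).2] at h0
    rw [h, h0]
    simp [norm_propSymbol]
  exact (sq_eq_sq₀ (norm_nonneg _) (norm_nonneg _)).1 h2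

theorem prop_prop (s t : ℝ) (f : L2R) : prop s (prop t f) = prop (s + t) f := by
  have h1 := memMul_propSymbol t f
  obtain ⟨-, h2⟩ := MemMul.comp (m₁ := propSymbol s) h1
    ((MemMul.comp_iff h1).1 (memMul_propSymbol s _))
  rw [prop_apply s, prop_apply t, h2, prop_apply]
  congr 1
  ext ξ
  rw [propSymbol_add]

theorem prop_zero (f : L2R) : prop 0 f = f := by
  rw [prop_apply]
  have : propSymbol 0 = fun _ => 1 := funext propSymbol_zero
  rw [this, (fmul_one f).2]

theorem inH_prop {s : ℝ} {f : L2R} (hf : InH s f) (t : ℝ) :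
    InH s (prop t f) ∧ fmul (wt s) (prop t f) = prop t (fmul (wt s) f) := by
  have h1 := memMul_propSymbol t f
  have h2 : MemMul (fun ξ => propSymbol t ξ * wt s ξ) f :=
    (MemMul.comp_iff hf).1 (memMul_propSymbol t _)
  have h3 : (fun ξ => propSymbol t ξ * wt s ξ) = fun ξ => wt s ξ * propSymbol t ξ := by
    ext ξ; ring
  obtain ⟨-, h4⟩ := MemMul.comp hf h2
  rw [h3] at h2 h4
  obtain ⟨h5, h6⟩ := MemMul.comp h1 h2
  rw [prop_apply t f, prop_apply t]
  exact ⟨h5, h6.trans h4.symm⟩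

theorem hNorm_prop {s : ℝ} {f : L2R} (hf : InH s f) (t : ℝ) : hNorm s (prop t f) = hNorm s f := by
  rw [hNorm, (inH_prop hf t).2, norm_prop]

theorem continuous_propSymbol_left (ξ : ℝ) : Continuous fun t => propSymbol t ξ := by
  unfold propSymbol
  fun_prop

theorem continuous_prop (f : L2R) : Continuous fun t => prop t f := by
  refine continuous_iff_continuousAt.2 fun t => ?_
  simp only [ContinuousAt, prop_apply]
  refine tendsto_fmul (G := fun _ => 1) (fmul_one f).1 aesm_propSymbol (aesm_propSymbol t)
    (Eventually.of_forall fun s ξ => ?_) (fun ξ => ?_)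
    fun ξ => (continuous_propSymbol_left ξ).tendsto t
  · rw [norm_propSymbol, norm_one]
  · rw [norm_propSymbol, norm_one]

theorem norm_propSymbol_sub_le (s t ξ : ℝ) :
    ‖propSymbol s ξ - propSymbol t ξ‖ ≤ |s - t| * bracket ξ := by
  have hb := (bracket_pos ξ).le
  have e : propSymbol s ξ - propSymbol t ξ = propSymbol t ξ * (propSymbol (s - t) ξ - 1) := by
    rw [mul_sub, ← propSymbol_add, mul_one]; congr 2; ring
  rw [e, norm_mul, norm_propSymbol, one_mul, propSymbol, mul_comm]
  refine (Real.norm_exp_I_mul_ofReal_sub_one_le).trans_eq ?_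
  rw [Real.norm_eq_abs, abs_neg, abs_mul, abs_of_nonneg hb]

theorem hasDerivAt_propSymbol (t ξ : ℝ) :
    HasDerivAt (fun s => propSymbol s ξ) (-Complex.I * (propSymbol t ξ * wt 1 ξ)) t := by
  have h1 : HasDerivAt (fun s : ℝ => -(s * bracket ξ)) (-(1 * bracket ξ)) t :=
    ((hasDerivAt_id t).mul_const _).neg
  have h2 := (h1.ofReal_comp.mul_const Complex.I).cexp
  have e : -Complex.I * (propSymbol t ξ * wt 1 ξ) =
      Complex.exp (((-(t * bracket ξ) : ℝ) : ℂ) * Complex.I) *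
        (((-(1 * bracket ξ) : ℝ) : ℂ) * Complex.I) := by
    rw [wt_one, propSymbol]
    push_cast; ring
  rw [e]
  exact h2

/-- The free evolution solves the linear equation. -/
theorem hasDerivAt_prop {f : L2R} (hf : InH 1 f) (t : ℝ) :
    HasDerivAt (fun s => prop s f) (-Complex.I • prop t (fmul (wt 1) f)) t := by
  rw [hasDerivAt_iff_tendsto_slope]
  have h2 := MemMul.comp hf ((MemMul.comp_iff hf).1 (memMul_propSymbol t _))
  have hm : MemMul (fun ξ => -Complex.I * (propSymbol t ξ * wt 1 ξ)) f ∧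
      fmul (fun ξ => -Complex.I * (propSymbol t ξ * wt 1 ξ)) f =
        -Complex.I • prop t (fmul (wt 1) f) := by
    have h3 := (MemMul.comp_iff hf).1 (memMul_propSymbol t _)
    have h4 := MemMul.eq_fmul (m := fun ξ => -Complex.I * (propSymbol t ξ * wt 1 ξ)) (f := f)
      (g := -Complex.I • fmul (fun ξ => propSymbol t ξ * wt 1 ξ) f) (by
        filter_upwards [fourier_smul_ae (-Complex.I)
          (fmul (fun ξ => propSymbol t ξ * wt 1 ξ) f), fourier_fmul h3] with ξ e1 e2
        rw [e1, e2]; ring)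
    refine ⟨h4.1, ?_⟩
    rw [← h4.2, prop_apply, h2.2]
  have hs (s : ℝ) : slope (fun s => prop s f) t s =
      fmul (fun ξ => ((s - t)⁻¹ : ℝ) * (propSymbol s ξ - propSymbol t ξ)) f := by
    have h4 := MemMul.eq_fmul
      (m := fun ξ => ((s - t)⁻¹ : ℝ) * (propSymbol s ξ - propSymbol t ξ)) (f := f)
      (g := (((s - t)⁻¹ : ℝ) : ℂ) • (prop s f - prop t f)) (by
        filter_upwards [fourier_smul_ae (((s - t)⁻¹ : ℝ) : ℂ) (prop s f - prop t f),
          fourier_sub_ae (prop s f) (prop t f), fourier_fmul (memMul_propSymbol s f),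
          fourier_fmul (memMul_propSymbol t f)] with ξ e1 e2 e3 e4
        rw [prop_apply, prop_apply] at *
        rw [e1, e2, e3, e4]; ring)
    rw [← h4.2, slope_def_module, coe_smul_L2]
  rw [← hm.2]
  rw [show slope (fun s => prop s f) t = _ from funext hs]
  refine tendsto_fmul (G := wt 1) hf (fun s => ?_) ?_ (Eventually.of_forall fun s ξ => ?_)
    (fun ξ => ?_) fun ξ => ?_
  · exact (continuous_const.mul
      ((continuous_propSymbol s).sub (continuous_propSymbol t))).aestronglyMeasurable
  · exact (continuous_const.mul
      ((continuous_propSymbol t).mul (continuous_wt 1))).aestronglyMeasurable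
  · rw [norm_mul, Complex.norm_real, norm_wt, Real.rpow_one, norm_inv, Real.norm_eq_abs]
    rcases eq_or_ne s t with rfl | hst
    · simpa using (bracket_pos ξ).le
    · rw [inv_mul_le_iff₀ (abs_pos.2 (sub_ne_zero.2 hst))]
      exact norm_propSymbol_sub_le s t ξ
  · rw [norm_mul, norm_mul, norm_neg, Complex.norm_I, norm_propSymbol, one_mul, one_mul]
  · have := (hasDerivAt_iff_tendsto_slope.1 (hasDerivAt_propSymbol t ξ))
    refine this.congr fun s => ?_
    rw [slope_def_module]
    exact Complex.coe_smul _ _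

/-- The product rule for the free propagator. -/
theorem hasDerivAt_prop_comp {w : ℝ → L2R} {w' : L2R} {t : ℝ} (hw : HasDerivAt w w' t)
    (h1 : InH 1 (w t)) : HasDerivAt (fun s => prop s (w s))
      (-Complex.I • fmul (wt 1) (prop t (w t)) + prop t w') t := by
  have h2 : HasDerivAt (fun s => prop s (w s - w t)) (prop t w') t := by
    rw [hasDerivAt_iff_isLittleO] at hw ⊢
    have a1 : (fun s => prop s (w s - w t - (s - t) • w')) =o[𝓝 t] fun s => s - t := by
      refine hw.norm_left.congr_left (fun s => ?_) |>.of_norm_left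
      exact (norm_prop _ _).symm
    have a2 : (fun s => (s - t) • (prop s w' - prop t w')) =o[𝓝 t] fun s => s - t := by
      have hc : Tendsto (fun s => prop s w' - prop t w') (𝓝 t) (𝓝 0) := by
        have := ((continuous_prop w').tendsto t).sub_const (prop t w')
        rwa [sub_self] at this
      have := (Asymptotics.isBigO_refl (fun s : ℝ => s - t) (𝓝 t)).smul_isLittleO
        ((Asymptotics.isLittleO_one_iff ℝ).2 hc)
      simpa using this
    refine (a1.add a2).congr_left fun s => ?_
    have e : prop s ((s - t) • w') = (s - t) • prop s w' := map_real_smul_L2 _ _ _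
    rw [map_sub, e, sub_self, map_zero, smul_sub]
    abel
  have h3 := (hasDerivAt_prop h1 t).add h2
  rw [(inH_prop h1 t).2]
  refine h3.congr_of_eventuallyEq (Eventually.of_forall fun s => ?_)
  simp only [Pi.add_apply, ← map_add]
  congr 1; abel

/-! ### Local existence -/

/-- Solvability of an ordinary differential equation with a bounded, globally Lipschitz field. -/
theorem exists_hasDerivAt_of_lipschitz {E : Type*} [NormedAddCommGroup E] [NormedSpace ℝ E]
    [CompleteSpace E] {F : ℝ → E → E} {L B : ℝ≥0} (hlip : ∀ t, LipschitzWith L (F t))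
    (hcont : ∀ x, Continuous fun t => F t x) (hb : ∀ t x, ‖F t x‖ ≤ B) (x₀ : E) {δ : ℝ}
    (hδ : 0 < δ) :
    ∃ α : ℝ → E, α 0 = x₀ ∧ ∀ t ∈ Set.Ioo (-δ) δ, HasDerivAt α (F t (α t)) t := by
  have hpl : IsPicardLindelof F (tmin := -δ) (tmax := δ) ⟨0, by constructor <;> linarith⟩ x₀
      (B * δ.toNNReal) 0 B L :=
    { lipschitzOnWith := fun t _ => (hlip t).lipschitzOnWith
      continuousOn := fun x _ => (hcont x).continuousOn
      norm_le := fun t _ x _ => hb t x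
      mul_max_le := by rw [NNReal.coe_mul, Real.coe_toNNReal δ hδ.le]; simp }
  obtain ⟨α, h0, h1⟩ := hpl.exists_eq_forall_mem_Icc_hasDerivWithinAt₀
  exact ⟨α, h0, fun t ht =>
    (h1 t (Set.Ioo_subset_Icc_self ht)).hasDerivAt (Icc_mem_nhds ht.1 ht.2)⟩

theorem prop_mem_hBall {M : ℝ} {g : L2R} (hg : g ∈ hBall M) (t : ℝ) : prop t g ∈ hBall M := by
  rw [mem_hBall] at hg ⊢
  exact ⟨(inH_prop hg.1 t).1, (hNorm_prop hg.1 t).trans_le hg.2⟩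

theorem aeBound_of_mem_hBall {M : ℝ} {g : L2R} (hg : g ∈ hBall M) : AEBound g (3 * M) := by
  rw [mem_hBall] at hg
  obtain ⟨h1, h2⟩ := InH.mono (show (1 : ℝ) ≤ 3 / 2 by norm_num) hg.1
  exact (aeBound_hNorm h1).mono (by linarith [hg.2])

theorem norm_le_of_mem_hBall {M : ℝ} {g : L2R} (hg : g ∈ hBall M) : ‖g‖ ≤ M := by
  rw [mem_hBall] at hg
  exact (norm_le_hNorm (by norm_num) hg.1).trans hg.2

/-- The nonlinearity in the interaction picture, with a cutoff `P`. -/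
def interField (P : L2R → L2R) (t : ℝ) (w : L2R) : L2R :=
  Complex.I • prop (-t) (nl quartic (prop t (P w)))

/-- The cutoff confines the argument to an `H^{3/2}` ball, which the propagator preserves and on
which `u` is bounded by `3M`. The nonlinearity is thus Lipschitz in `L²`, and the interaction
picture removes the unbounded linear term. -/
theorem norm_interField_sub_le {P : L2R → L2R} {M : ℝ} (hP : ∀ x, P x ∈ hBall M)
    (hlip : ∀ x y, ‖P x - P y‖ ≤ ‖x - y‖) (t : ℝ) (x y : L2R) :
    ‖interField P t x - interField P t y‖ ≤ (4 * (3 * M) ^ 3 + 12 * (3 * M) ^ 2) * ‖x - y‖ := by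
  have hM : 0 ≤ 3 * M := (aeBound_of_mem_hBall (hP x)).nonneg
  rw [interField, interField, ← smul_sub, norm_smul, Complex.norm_I, one_mul, ← map_sub, norm_prop]
  refine (isC11_quartic.norm_nl_sub_le (aeBound_of_mem_hBall (prop_mem_hBall (hP x) t))
    (aeBound_of_mem_hBall (prop_mem_hBall (hP y) t))).trans ?_
  rw [← map_sub, norm_prop]
  exact mul_le_mul_of_nonneg_left (hlip x y) (by positivity)

theorem norm_interField_le {P : L2R → L2R} {M : ℝ} (hP : ∀ x, P x ∈ hBall M) (t : ℝ) (x : L2R) :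
    ‖interField P t x‖ ≤ (3 * M) ^ 3 * M := by
  have hM : 0 ≤ 3 * M := (aeBound_of_mem_hBall (hP x)).nonneg
  rw [interField, norm_smul, Complex.norm_I, one_mul, norm_prop]
  refine (norm_nl_quartic_le (aeBound_of_mem_hBall (prop_mem_hBall (hP x) t))).trans ?_
  rw [norm_prop]
  exact mul_le_mul_of_nonneg_left (norm_le_of_mem_hBall (hP x)) (by positivity)

theorem continuous_interField {P : L2R → L2R} {M : ℝ} (hP : ∀ x, P x ∈ hBall M) (x : L2R) :
    Continuous fun t => interField P t x := by
  have h1 : Continuous fun t => nl quartic (prop t (P x)) := by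
    refine continuous_iff_continuousAt.2 fun t => ?_
    rw [ContinuousAt, tendsto_iff_norm_sub_tendsto_zero]
    have h2 := ((continuous_prop (P x)).tendsto t).sub_const (prop t (P x))
    have h3 := h2.norm.const_mul (4 * (3 * M) ^ 3 + 12 * (3 * M) ^ 2)
    rw [sub_self, norm_zero, mul_zero] at h3
    exact squeeze_zero (fun _ => norm_nonneg _) (fun s => isC11_quartic.norm_nl_sub_le
      (aeBound_of_mem_hBall (prop_mem_hBall (hP x) s))
      (aeBound_of_mem_hBall (prop_mem_hBall (hP x) t))) h3
  refine continuous_iff_continuousAt.2 fun t => ?_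
  refine ContinuousAt.const_smul ?_ Complex.I
  rw [ContinuousAt, tendsto_iff_norm_sub_tendsto_zero]
  set g := fun t => nl quartic (prop t (P x))
  have h2 := ((h1.tendsto t).sub_const (g t)).norm
  have h3 := ((((continuous_prop (g t)).comp continuous_neg).tendsto t).sub_const
    (prop (-t) (g t))).norm
  simp only [Function.comp, sub_self, norm_zero] at h2 h3
  have h4 := h2.add h3
  rw [add_zero] at h4
  refine squeeze_zero (fun _ => norm_nonneg _) (fun s => ?_) h4
  calc ‖prop (-s) (g s) - prop (-t) (g t)‖
      = ‖prop (-s) (g s - g t) + (prop (-s) (g t) - prop (-t) (g t))‖ := by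
        rw [map_sub]; congr 1; abel
    _ ≤ _ := (norm_add_le _ _).trans (by rw [norm_prop])

/-- Local existence, with a time of existence controlled by the `H^{3/2}` norm. -/
theorem exists_local_path {Y : ℝ} (hY : 0 ≤ Y) : ∃ δ, 0 < δ ∧ ∀ f : L2R, InH (3 / 2) f →
    hNorm (3 / 2) f ≤ Y → ∃ w v : ℝ → L2R, w 0 = f ∧ IsPath w v (Set.Ioo (-δ) δ) := by
  set M := Y + 1 with hM
  have hM0 : 0 ≤ M := by linarith
  obtain ⟨C, hC, hN⟩ := exists_tame_bound isC11_quartic hM0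
  set B := C * (1 + M) with hB
  have hB0 : 0 ≤ B := by positivity
  -- The field has `H^{3/2}` norm at most `B`, so during this time the solution moves by at most `1`
  -- and stays in the ball of radius `M = Y + 1`, where the cutoff is inactive.
  refine ⟨1 / (B + 1), by positivity, fun f hf hfY => ?_⟩
  set δ := 1 / (B + 1) with hδ
  have hδ0 : 0 < δ := by positivity
  have hBδ : B * δ ≤ 1 := by
    rw [hδ, mul_one_div, div_le_one (by positivity)]; linarith
  have hfM : f ∈ hBall M := mem_hBall.2 ⟨hf, by linarith⟩
  obtain ⟨P, hP, hPid, hPlip⟩ := exists_convex_projection ⟨f, hfM⟩ (isClosed_hBall M)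
    (convex_hBall M)
  obtain ⟨U, hU0, hU⟩ := exists_hasDerivAt_of_lipschitz (F := interField P)
    (L := ⟨4 * (3 * M) ^ 3 + 12 * (3 * M) ^ 2, by positivity⟩) (B := ⟨(3 * M) ^ 3 * M, by positivity⟩)
    (fun t => LipschitzWith.of_dist_le_mul fun x y => by
      rw [dist_eq_norm, dist_eq_norm]; exact norm_interField_sub_le hP hPlip t x y)
    (continuous_interField hP) (norm_interField_le hP) f hδ0
  have hfield (t : ℝ) (x : L2R) : interField P t x ∈ hBall B := by
    have h1 := mem_hBall.1 (prop_mem_hBall (hP x) t)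
    have h2 : hNorm 1 (prop t (P x)) ≤ M :=
      (InH.mono (show (1 : ℝ) ≤ 3 / 2 by norm_num) h1.1).2.trans h1.2
    obtain ⟨h3, h4⟩ := hN _ h1.1 h2
    have h5 := MemMul.smul Complex.I (inH_prop h3 (-t)).1
    refine mem_hBall.2 ⟨h5.1, ?_⟩
    rw [interField, hNorm, h5.2, norm_smul, Complex.norm_I, one_mul]
    refine (hNorm_prop h3 _).trans_le (h4.trans ?_)
    rw [hB]; gcongr; exact h1.2
  -- The ordinary differential equation is solved in `L²`. The mean value inequality applied to each
  -- bounded `high n` recovers Lipschitz continuity in `H^{3/2}`.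
  have hlipU (t s : ℝ) (ht : t ∈ Set.Ioo (-δ) δ) (hs : s ∈ Set.Ioo (-δ) δ) :
      U t - U s ∈ hBall (B * |t - s|) := by
    intro n
    have := (convex_Ioo (-δ) δ).norm_image_sub_le_of_norm_hasDerivWithin_le (𝕜 := ℝ)
      (f := fun t => high n (U t)) (f' := fun t => high n (interField P t (U t))) (C := B)
      (fun x hx => (hasDerivAt_clm_L2 (high n) (hU x hx)).hasDerivWithinAt)
      (fun x hx => hfield x (U x) n) hs ht
    rw [map_sub]
    exact this
  have h0δ : (0 : ℝ) ∈ Set.Ioo (-δ) δ := ⟨by linarith, hδ0⟩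
  have hUM (t : ℝ) (ht : t ∈ Set.Ioo (-δ) δ) : U t ∈ hBall M := by
    have h1 := mem_hBall.1 (hlipU t 0 ht h0δ)
    rw [hU0, sub_zero] at h1
    have h2 : B * |t| ≤ 1 :=
      (mul_le_mul_of_nonneg_left (abs_lt.2 ht).le hB0).trans hBδ
    have h3 := h1.1.add hf
    rw [sub_add_cancel] at h3
    refine mem_hBall.2 ⟨h3.1, ?_⟩
    linarith [hNorm_le_add h3.1 hf]
  set w : ℝ → L2R := fun t => prop t (U t) with hw
  refine ⟨w, fun t => -Complex.I • fmul (wt 1) (w t) + Complex.I • nl quartic (w t),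
    by rw [hw]; simp only; rw [hU0, prop_zero], isOpen_Ioo, fun t ht => ?_, fun t ht => ?_,
    fun t ht => ?_, fun t ht => ?_⟩
  · exact (mem_hBall.1 (prop_mem_hBall (hUM t ht) t)).1
  · have hUt := (mem_hBall.1 (hUM t ht)).1
    have l1 : Tendsto (fun s => B * |s - t| + ‖prop s (fmul (wt (3 / 2)) (U t)) -
        prop t (fmul (wt (3 / 2)) (U t))‖) (𝓝 t) (𝓝 (B * |t - t| +
        ‖prop t (fmul (wt (3 / 2)) (U t)) - prop t (fmul (wt (3 / 2)) (U t))‖)) :=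
      (((continuous_id.sub continuous_const).abs.const_mul B).add
        ((continuous_prop _).sub continuous_const).norm).tendsto t
    simp only [sub_self, abs_zero, mul_zero, norm_zero, add_zero] at l1
    refine squeeze_zero' (Eventually.of_forall fun s => norm_nonneg _) ?_ l1
    filter_upwards [isOpen_Ioo.mem_nhds ht] with s hs
    have h1 := mem_hBall.1 (hlipU s t hs ht)
    have h2 := (inH_prop hUt s).1.sub (inH_prop hUt t).1
    have h3 := (inH_prop h1.1 s).1.add h2.1
    have e : w s - w t = prop s (U s - U t) + (prop s (U t) - prop t (U t)) := by
      rw [hw, map_sub]; simp only; abel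
    rw [e, hNorm, h3.2, h2.2]
    refine (norm_add_le _ _).trans ?_
    rw [(inH_prop hUt s).2, (inH_prop hUt t).2]
    have h4 := (hNorm_prop h1.1 s).trans_le h1.2
    rw [hNorm] at h4
    linarith
  · have hUt := (mem_hBall.1 (hUM t ht)).1
    have h1 := hasDerivAt_prop_comp (hU t ht) (InH.mono (by norm_num) hUt).1
    have e : prop t (interField P t (U t)) = Complex.I • nl quartic (w t) := by
      rw [interField, map_smul, prop_prop, add_neg_cancel, prop_zero, hPid _ (hUM t ht)]
    rw [e] at h1
    exact h1
  · rw [smul_add, smul_smul, smul_smul, mul_neg, Complex.I_mul_I, neg_neg, one_smul, neg_one_smul,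
      sub_eq_add_neg]

/-! ### Uniqueness, gluing and maximality -/

theorem isOpen_timeInterval (Tm Tp : EReal) : IsOpen (timeInterval Tm Tp) :=
  (isOpen_lt continuous_const continuous_coe_real_ereal).inter
    (isOpen_lt continuous_coe_real_ereal continuous_const)

theorem ordConnected_timeInterval (Tm Tp : EReal) : (timeInterval Tm Tp).OrdConnected :=
  ⟨fun _ hx _ hy _ hz => ⟨hx.1.trans_le (EReal.coe_le_coe_iff.2 hz.1),
    (EReal.coe_le_coe_iff.2 hz.2).trans_lt hy.2⟩⟩

theorem zero_mem_timeInterval {Tm Tp : EReal} (hm : 0 < Tm) (hp : 0 < Tp) :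
    (0 : ℝ) ∈ timeInterval Tm Tp := by
  refine ⟨?_, by simpa using hp⟩
  rw [EReal.coe_zero, EReal.neg_lt_comm, neg_zero]; exact hm

theorem IsSolution.exists_isPath {f : L2R} {Tm Tp : EReal} {u : ℝ → L2R}
    (hu : IsSolution f Tm Tp u) : ∃ v, IsPath u v (timeInterval Tm Tp) := by
  classical
  have hmem (t : ℝ) (ht : t ∈ timeInterval Tm Tp) : InH (3 / 2) (u t) :=
    (inH_iff _).2 ((memHs_iff (by norm_num) _).1 (hu.mem t ht))
  choose! v hv using hu.equation
  refine ⟨v, isOpen_timeInterval _ _, hmem, fun t ht => ?_, fun t ht => ?_, fun t ht => ?_⟩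
  · have h1 := (ENNReal.tendsto_toReal ENNReal.zero_ne_top).comp (hu.continuous t ht)
    refine h1.congr' ?_
    filter_upwards [(isOpen_timeInterval Tm Tp).mem_nhds ht] with s hs
    rw [Function.comp, sobolevENorm_eq ((hmem s hs).sub (hmem t ht)).1,
      ENNReal.toReal_ofReal (norm_nonneg _)]
  · obtain ⟨_, _, h, -⟩ := hv t ht
    exact h
  · obtain ⟨Au, N, -, h1, h2, h3⟩ := hv t ht
    have e1 : Au = fmul (wt 1) (u t) := by
      refine (MemMul.eq_fmul ?_).2
      filter_upwards [h1] with ξ hξ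
      rw [hξ, wt_one]
    have e2 : N = nl quartic (u t) := by
      refine Lp.ext ?_
      have h1 := (InH.mono (show (1 : ℝ) ≤ 3 / 2 by norm_num) (hmem t ht)).1
      filter_upwards [h2, isC11_quartic.nl_ae (aeBound_hNorm h1)] with x a1 a2
      rw [a1, a2, quartic]
    rw [h3, e1, e2]

theorem IsPath.isSolution {f : L2R} {Tm Tp : EReal} {u v : ℝ → L2R}
    (h : IsPath u v (timeInterval Tm Tp)) (hm : 0 < Tm) (hp : 0 < Tp) (h0 : u 0 = f) :
    IsSolution f Tm Tp u where
  pos_left := hm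
  pos_right := hp
  initial := h0
  mem t ht := (memHs_iff (by norm_num) _).2 ((inH_iff _).1 (h.mem t ht))
  continuous t ht := by
    have h1 := ENNReal.tendsto_ofReal (h.cont t ht)
    rw [ENNReal.ofReal_zero] at h1
    refine h1.congr' ?_
    filter_upwards [h.mem_nhds ht] with s hs
    rw [sobolevENorm_eq ((h.mem s hs).sub (h.mem t ht)).1]
  equation t ht := by
    have h1 := h.inH_one ht
    refine ⟨v t, fmul (wt 1) (u t), nl quartic (u t), h.deriv t ht, ?_, ?_, h.eq t ht⟩
    · filter_upwards [fourier_fmul h1] with ξ hξ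
      rw [hξ, wt_one]
    · filter_upwards [isC11_quartic.nl_ae (aeBound_hNorm h1)] with x hx
      rw [hx, quartic]

namespace IsPath
variable {u v w z : ℝ → L2R} {J : Set ℝ}

/-- Time translation. -/
theorem comp_sub (h : IsPath u v J) (c : ℝ) :
    IsPath (fun t => u (t - c)) (fun t => v (t - c)) {t | t - c ∈ J} where
  isOpen := h.isOpen.preimage (by fun_prop)
  mem t ht := h.mem _ ht
  cont t ht := by
    have hc : Tendsto (fun s : ℝ => s - c) (𝓝 t) (𝓝 (t - c)) :=
      (continuous_id.sub continuous_const).tendsto t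
    exact (h.cont _ ht).comp hc
  deriv t ht := (h.deriv _ ht).comp_sub_const t c
  eq t ht := h.eq _ ht

/-- Solutions with the same value at some time agree. -/
theorem unique (hu : IsPath u v J) (hw : IsPath w z J) (hJ : J.OrdConnected) {t₀ t : ℝ}
    (h₀ : t₀ ∈ J) (ht : t ∈ J) (h : u t₀ = w t₀) : u t = w t := by
  have hsub : Set.uIcc t₀ t ⊆ J := hJ.uIcc_subset h₀ ht
  obtain ⟨C₁, hC₁⟩ := isCompact_uIcc.exists_bound_of_continuousOn
    (s := Set.uIcc t₀ t) (f := fun s => hNorm 1 (u s))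
    fun s hs => (hu.continuousAt_hNorm_one (hsub hs)).continuousWithinAt
  obtain ⟨C₂, hC₂⟩ := isCompact_uIcc.exists_bound_of_continuousOn
    (s := Set.uIcc t₀ t) (f := fun s => hNorm 1 (w s))
    fun s hs => (hw.continuousAt_hNorm_one (hsub hs)).continuousWithinAt
  set R := 3 * max C₁ C₂ with hR
  set L := 4 * R ^ 3 + 12 * R ^ 2 with hL
  have hbu (s : ℝ) (hs : s ∈ Set.uIcc t₀ t) : AEBound (u s) R := by
    refine (aeBound_hNorm (hu.inH_one (hsub hs))).mono ?_
    have := (le_abs_self _).trans ((hC₁ s hs).trans (le_max_left C₁ C₂))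
    rw [hR]; linarith
  have hbw (s : ℝ) (hs : s ∈ Set.uIcc t₀ t) : AEBound (w s) R := by
    refine (aeBound_hNorm (hw.inH_one (hsub hs))).mono ?_
    have := (le_abs_self _).trans ((hC₂ s hs).trans (le_max_right C₁ C₂))
    rw [hR]; linarith
  -- The linear part drops out of the derivative of `E`, and the nonlinearity is Lipschitz in `L²`
  -- between functions bounded by `R`, so Gronwall applies.
  set E : ℝ → ℝ := fun s => ‖u s - w s‖ ^ 2 with hE
  set E' : ℝ → ℝ := fun s =>
    2 * (inner ℂ (u s - w s) (Complex.I • (nl quartic (u s) - nl quartic (w s)))).re with hE'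
  have hd (s : ℝ) (hs : s ∈ J) : HasDerivAt E (E' s) s := by
    have h1 := (hu.inH_one hs).sub (hw.inH_one hs)
    refine hasDerivAt_norm_sq_multiplier (m := fun _ => 1) (L := ContinuousLinearMap.id ℂ L2R)
      (z := fun s => u s - w s) (z' := v s - z s) (g := nl quartic (u s) - nl quartic (w s))
      (fun f => ?_) ((hu.deriv s hs).sub (hw.deriv s hs)) h1.1 ?_
    · simp only [Complex.ofReal_one]
      exact ⟨(fmul_one f).1, (fmul_one f).2.symm⟩
    · rw [smul_sub, hu.eq s hs, hw.eq s hs, h1.2]; abel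
  have hb (s : ℝ) (hs : s ∈ Set.uIcc t₀ t) : ‖E' s‖ ≤ 2 * L * ‖E s‖ := by
    have h1 := abs_re_inner_le (u s - w s)
      (Complex.I • (nl quartic (u s) - nl quartic (w s)))
    have h2 := isC11_quartic.norm_nl_sub_le (hbu s hs) (hbw s hs)
    rw [norm_smul, Complex.norm_I, one_mul] at h1
    rw [hE', hE, norm_mul, Real.norm_eq_abs, abs_two, norm_pow, norm_norm, Real.norm_eq_abs]
    have h3 := mul_le_mul_of_nonneg_left h2 (norm_nonneg (u s - w s))
    nlinarith
  obtain ⟨σ, r, hσ, hr, hσr⟩ : ∃ σ r : ℝ, σ * σ = 1 ∧ 0 ≤ r ∧ t = t₀ + σ * r := by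
    rcases le_total t₀ t with h | h
    · exact ⟨1, t - t₀, by ring, by linarith, by ring⟩
    · exact ⟨-1, t₀ - t, by ring, by linarith, by ring⟩
  have hmem (s : ℝ) (hs : s ∈ Set.Icc 0 r) : t₀ + σ * s ∈ Set.uIcc t₀ t := by
    rcases mul_self_eq_one_iff.1 hσ with rfl | rfl
    · rw [Set.uIcc_of_le (by linarith)]; constructor <;> linarith [hs.1, hs.2]
    · rw [Set.uIcc_of_ge (by linarith)]; constructor <;> linarith [hs.1, hs.2]
  have hσ1 : ‖σ‖ = 1 := by
    rcases mul_self_eq_one_iff.1 hσ with rfl | rfl <;> simp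
  have hd' (s : ℝ) (hs : s ∈ Set.Icc 0 r) :
      HasDerivAt (fun s => E (t₀ + σ * s)) (E' (t₀ + σ * s) * σ) s := by
    have h1 : HasDerivAt (fun s => t₀ + σ * s) σ s := by
      simpa using ((hasDerivAt_id s).const_mul σ).const_add t₀
    exact (hd _ (hsub (hmem s hs))).comp s h1
  have h0 := eq_zero_of_abs_deriv_le_mul_abs_self_of_eq_zero_right (f := fun s => E (t₀ + σ * s))
    (f' := fun s => E' (t₀ + σ * s) * σ) (K := 2 * L) (a := 0) (b := r)
    (fun s hs => (hd' s hs).continuousAt.continuousWithinAt)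
    (fun s hs => (hd' s (Set.Ico_subset_Icc_self hs)).hasDerivWithinAt)
    (by simp [hE, h])
    (fun s hs => by
      rw [norm_mul, hσ1, mul_one]; exact hb _ (hmem s (Set.Ico_subset_Icc_self hs)))
    r ⟨hr, le_rfl⟩
  rw [← hσr] at h0
  exact sub_eq_zero.1 (norm_eq_zero.1 (pow_eq_zero_iff two_ne_zero |>.1 h0))

/-- Being a solution is a local property. -/
theorem of_locally {U V : ℝ → L2R} {J' : Set ℝ} (hJ' : IsOpen J')
    (H : ∀ t ∈ J', ∃ u v J, IsPath u v J ∧ t ∈ J ∧ U =ᶠ[𝓝 t] u ∧ V t = v t) : IsPath U V J' where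
  isOpen := hJ'
  mem t ht := by
    obtain ⟨u, v, J, h, htJ, e, -⟩ := H t ht
    rw [e.eq_of_nhds]; exact h.mem t htJ
  cont t ht := by
    obtain ⟨u, v, J, h, htJ, e, -⟩ := H t ht
    refine (h.cont t htJ).congr' ?_
    filter_upwards [e] with s hs
    rw [hs, e.eq_of_nhds]
  deriv t ht := by
    obtain ⟨u, v, J, h, htJ, e, e'⟩ := H t ht
    rw [e']; exact (h.deriv t htJ).congr_of_eventuallyEq e
  eq t ht := by
    obtain ⟨u, v, J, h, htJ, e, e'⟩ := H t ht
    rw [e', e.eq_of_nhds]; exact h.eq t htJ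

/-- Gluing of two solutions with a common value. -/
theorem exists_union (hu : IsPath u v J) (hJ : J.OrdConnected) {J' : Set ℝ} (hw : IsPath w z J')
    (hJ' : J'.OrdConnected) {t₀ : ℝ} (h₀ : t₀ ∈ J) (h₀' : t₀ ∈ J') (h : u t₀ = w t₀) :
    ∃ U V, IsPath U V (J ∪ J') ∧ ∀ t ∈ J, U t = u t := by
  classical
  have hI : IsOpen (J ∩ J') := hu.isOpen.inter hw.isOpen
  have hun (t : ℝ) (h1 : t ∈ J) (h2 : t ∈ J') : u t = w t :=
    (hu.restrict hI Set.inter_subset_left).unique (hw.restrict hI Set.inter_subset_right)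
      (hJ.inter hJ') ⟨h₀, h₀'⟩ ⟨h1, h2⟩ h
  refine ⟨fun t => if t ∈ J then u t else w t, fun t => if t ∈ J then v t else z t,
    of_locally (hu.isOpen.union hw.isOpen) fun t ht => ?_, fun t ht => if_pos ht⟩
  by_cases htJ : t ∈ J
  · refine ⟨u, v, J, hu, htJ, ?_, if_pos htJ⟩
    filter_upwards [hu.mem_nhds htJ] with s hs
    exact if_pos hs
  · have ht' : t ∈ J' := ht.resolve_left htJ
    refine ⟨w, z, J', hw, ht', ?_, if_neg htJ⟩
    filter_upwards [hw.mem_nhds ht'] with s hs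
    by_cases hsJ : s ∈ J
    · rw [if_pos hsJ]; exact hun s hsJ hs
    · exact if_neg hsJ

end IsPath

/-- A maximal solution lives at least for the local existence time after (and before) each time. -/
theorem IsMaximalSolution.exists_lower_bound {f : L2R} {Tm Tp : EReal} {u : ℝ → L2R}
    (hu : IsMaximalSolution f Tm Tp u) {Y : ℝ} (hY : 0 ≤ Y) :
    ∃ δ : ℝ, 0 < δ ∧ ∀ t ∈ timeInterval Tm Tp, hNorm (3 / 2) (u t) ≤ Y →
      ((δ - t : ℝ) : EReal) ≤ Tm ∧ ((t + δ : ℝ) : EReal) ≤ Tp := by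
  obtain ⟨v, hp⟩ := hu.solution.exists_isPath
  obtain ⟨δ, hδ, H⟩ := exists_local_path hY
  refine ⟨δ, hδ, fun t₀ ht₀ hYt => ?_⟩
  obtain ⟨w, z, hw0, hw⟩ := H (u t₀) (hp.mem t₀ ht₀) hYt
  have hw' := hw.comp_sub t₀
  have e : {t | t - t₀ ∈ Set.Ioo (-δ) δ} = Set.Ioo (t₀ - δ) (t₀ + δ) := by
    ext t; simp only [Set.mem_ofPred_eq, Set.mem_Ioo]
    constructor <;> rintro ⟨h1, h2⟩ <;> constructor <;> linarith
  rw [e] at hw'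
  obtain ⟨U, V, hU, hUu⟩ := hp.exists_union (ordConnected_timeInterval Tm Tp) hw'
    Set.ordConnected_Ioo ht₀ ⟨by linarith, by linarith⟩ (by simp only [sub_self, hw0])
  -- The left end `t₀ - δ` corresponds to the parameter `δ - t₀`. Since the two intervals share
  -- `t₀`, their union is an interval, and maximality forbids it from being larger.
  have hsub : timeInterval (max Tm ((δ - t₀ : ℝ) : EReal)) (max Tp ((t₀ + δ : ℝ) : EReal)) ⊆
      timeInterval Tm Tp ∪ Set.Ioo (t₀ - δ) (t₀ + δ) := by
    rintro t ⟨h1, h2⟩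
    rw [EReal.neg_lt_comm, lt_max_iff] at h1
    rw [lt_max_iff] at h2
    rcases le_total t₀ t with h | h
    · rcases h2 with h2 | h2
      · exact Or.inl ⟨ht₀.1.trans_le (EReal.coe_le_coe_iff.2 h), h2⟩
      · exact Or.inr ⟨by linarith, EReal.coe_lt_coe_iff.1 h2⟩
    · rcases h1 with h1 | h1
      · exact Or.inl ⟨EReal.neg_lt_comm.1 h1, (EReal.coe_le_coe_iff.2 h).trans_lt ht₀.2⟩
      · rw [← EReal.coe_neg, EReal.coe_lt_coe_iff] at h1
        exact Or.inr ⟨by linarith, by linarith⟩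
  have h0 := zero_mem_timeInterval hu.solution.pos_left hu.solution.pos_right
  have hsol := (hU.restrict (isOpen_timeInterval _ _) hsub).isSolution
    (hu.solution.pos_left.trans_le (le_max_left _ _))
    (hu.solution.pos_right.trans_le (le_max_left _ _)) ((hUu 0 h0).trans hu.solution.initial)
  obtain ⟨m1, m2⟩ := hu.maximal _ _ U (le_max_left _ _) (le_max_left _ _) hsol hUu
  exact ⟨max_eq_left_iff.1 m1, max_eq_left_iff.1 m2⟩

/-- Let `f ∈ H^{3/2}(ℝ)` and let `u` be a solution of `i ∂ₜ u = √(1 - Δ) u - u |u|³`, `u(0) = f`,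
with maximal interval of existence `(-Tm, Tp)`. If the `H^{1/2}` norm of `u` is bounded on
`(-Tm, Tp)`, then `u` is global. -/
theorem mainTheorem6 (f : L2R) (hf : MemHs (3 / 2) f) (Tm Tp : EReal) (u : ℝ → L2R)
    (hu : IsMaximalSolution f Tm Tp u)
    (hbound : ∃ M : ℝ≥0, ∀ t ∈ timeInterval Tm Tp, sobolevENorm (1 / 2) (u t) ≤ M) :
    Tm = ⊤ ∧ Tp = ⊤ := by
  obtain ⟨M, hM⟩ := hbound
  obtain ⟨v, hp⟩ := hu.solution.exists_isPath
  have hm0 := hu.solution.pos_left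
  have hp0 := hu.solution.pos_right
  have h0 := zero_mem_timeInterval hm0 hp0
  have hA (t : ℝ) (ht : t ∈ timeInterval Tm Tp) : hNorm (1 / 2) (u t) ≤ M := by
    have h1 := hM t ht
    rw [sobolevENorm_eq (InH.mono (by norm_num) (hp.mem t ht)).1] at h1
    exact (ENNReal.ofReal_le_ofReal_iff M.coe_nonneg).1 (by rwa [ENNReal.ofReal_coe_nnreal])
  have key (σ T : ℝ) (hσ : σ * σ = 1) (hT : 0 < T)
      (hJ : ∀ t ∈ Set.Ico 0 T, σ * t ∈ timeInterval Tm Tp) : ∃ δ, 0 < δ ∧ ∃ t ∈ Set.Ico 0 T,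
        T < t + δ ∧ ((δ - σ * t : ℝ) : EReal) ≤ Tm ∧ ((σ * t + δ : ℝ) : EReal) ≤ Tp := by
    obtain ⟨Y, hY⟩ := hp.exists_hNorm_bound hσ h0 hJ hA
    have hY0 : 0 ≤ Y := (norm_nonneg _).trans (hY 0 ⟨le_rfl, hT⟩)
    obtain ⟨δ, hδ, H⟩ := hu.exists_lower_bound hY0
    -- A time within `δ/2` of the end, or `0` if the end is nearer than that: the guaranteed
    -- lifespan `δ` then reaches beyond `T`.
    have ht : max 0 (T - δ / 2) ∈ Set.Ico 0 T :=
      ⟨le_max_left _ _, max_lt hT (by linarith)⟩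
    exact ⟨δ, hδ, _, ht, by linarith [le_max_right 0 (T - δ / 2)], H _ (hJ _ ht) (hY _ ht)⟩
  constructor
  · by_contra hT
    lift Tm to ℝ using ⟨hT, (EReal.bot_lt_zero.trans hm0).ne'⟩
    have hm0' : 0 < Tm := EReal.coe_pos.1 hm0
    obtain ⟨δ, -, t, -, h1, h2, -⟩ := key (-1) Tm (by norm_num) hm0' fun t ht => by
      refine ⟨?_, ?_⟩
      · rw [← EReal.coe_neg, EReal.coe_lt_coe_iff]; linarith [ht.2]
      · refine lt_of_le_of_lt ?_ hp0
        rw [← EReal.coe_zero, EReal.coe_le_coe_iff]; linarith [ht.1]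
    rw [EReal.coe_le_coe_iff] at h2
    linarith
  · by_contra hT
    lift Tp to ℝ using ⟨hT, (EReal.bot_lt_zero.trans hp0).ne'⟩
    have hp0' : 0 < Tp := EReal.coe_pos.1 hp0
    obtain ⟨δ, -, t, -, h1, -, h2⟩ := key 1 Tp (by norm_num) hp0' fun t ht => by
      refine ⟨?_, ?_⟩
      · refine h0.1.trans_le ?_
        rw [EReal.coe_le_coe_iff]; linarith [ht.1]
      · rw [EReal.coe_lt_coe_iff]; linarith [ht.2]
    rw [EReal.coe_le_coe_iff] at h2
    linarith

end
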